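/- **Setting.** Let $H\in(1/2,1)$, $\alpha_H=H(2H-1)$ and $R_H(t,s)=\alpha_H\int_0^t\int_0^s|u-v|^{2H-2}\,du\,dv$. Write $\mathcal F h(\xi)=\int e^{-i\xi\cdot x}h(x)\,dx$. Let $f:\mathbb R^d\to\mathbb R_+$ be the Fourier transform in $\mathcal S'(\mathbb R^d)$ of a tempered measure $\mu$, i.e. $\int f h\,dx=\int\mathcal F h\,d\mu$ for all $h\in\mathcal S(\mathbb R^d)$. Let $\mathcal{HP}$ be the real Hilbert space obtained by completing the set $\mathcal E$ of real linear combinations of the functions $1_{[0,t]\times A}$ ($t\ge 0$, $A\subset\mathbb R^d$ bounded Borel) for the inner product $$\langle 1_{[0,t]\times A},1_{[0,s]\times B}\rangle=R_H(t,s)\int_A\int_B f(x-y)\,dx\,dy ,$$ and let $\mathcal{HP}^{\otimes n}$ be its $n$-th Hilbert tensor power, i.e. the completion of $\mathcal E^{\otimes n}$. For $T>0$ let $\mathcal E_{\mathbb C}(0,T)^{\otimes n}$ be the complex span of the indicators of boxes $[0,t_1]\times\dots\times[0,t_n]$, $t_i\in[0,T]$. A function $g$ on $(0,T)^n$ belongs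 to $\mathcal H_{\mathbb C}(0,T)^{\otimes n}$ if it is a limit of elements of $\mathcal E_{\mathbb C}(0,T)^{\otimes n}$ for the norm $$\|g\|^2=\alpha_H^n\int_{(0,T)^{2n}}g(\mathbf u)\overline{g(\mathbf v)}\prod_{i=1}^n|u_i-v_i|^{2H-2}\,d\mathbf u\,d\mathbf v$$ (absolutely convergent Lebesgue integrals). **Theorem.** Let $\mathbf t\mapsto\varphi(t_1,\cdot,\dots,t_n,\cdot)\in\mathcal S'(\mathbb R^{nd})$, $\mathbf t\in(0,T)^n$, be such that for every $\mathbf t\in(0,T)^n$ the Fourier transform $\mathcal F\varphi(t_1,\cdot,\dots,t_n,\cdot)$ is a (locally integrable, everywhere defined) function on $\mathbb R^{nd}$, and $\varphi$ is real, in the sense that $\mathcal F\varphi(t_1,\cdot,\dots,t_n,\cdot)(-\boldsymbol\xi)=\overline{\mathcal F\varphi(t_1,\cdot,\dots,t_n,\cdot)(\boldsymbol\xi)}$ for all $\boldsymbol\xi$. Suppose that: (i) $\mathbf t\mapsto\mathcal F\varphi(t_1,\cdot,\dots,t_n,\cdot)(\boldsymbol\xi)$ belongs to $\mathcal H_{\mathbb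 C}(0,T)^{\otimes n}$ for all $\boldsymbol\xi\in\mathbb R^{nd}$; (ii) $(\mathbf t,\boldsymbol\xi)\mapsto\mathcal F\varphi(t_1,\cdot,\dots,t_n,\cdot)(\boldsymbol\xi)$ is measurable on $(0,T)^n\times\mathbb R^{nd}$; (iii) either $\int_{(0,T)^n}\prod_{i=1}^n 1_{\{u_i\ge s_i\}}u_i^{H-1/2}(u_i-s_i)^{H-3/2}\,|\mathcal F\varphi(u_1,\cdot,\dots,u_n,\cdot)(\boldsymbol\xi)|\,d\mathbf u<\infty$ for all $(\mathbf s,\boldsymbol\xi)\in(0,T)^n\times\mathbb R^{nd}$, or $\mathcal F\varphi(s_1,\cdot,\dots,s_n,\cdot)(\boldsymbol\xi)\ge 0$ for all $(\mathbf s,\boldsymbol\xi)\in(0,T)^n\times\mathbb R^{nd}$. If $$I_T:=\alpha_H^n\int_{\mathbb R^{nd}}\int_{(0,T)^{2n}}\mathcal F\varphi(u_1,\cdot,\dots,u_n,\cdot)(\boldsymbol\xi)\,\overline{\mathcal F\varphi(v_1,\cdot,\dots,v_n,\cdot)(\boldsymbol\xi)}\prod_{i=1}^n|u_i-v_i|^{2H-2}\,d\mathbf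 u\,d\mathbf v\,\mu(d\xi_1)\cdots\mu(d\xi_n)<\infty ,$$ then $\varphi$, extended by $0$ outside $(0,T)^n$, belongs to $\mathcal{HP}^{\otimes n}$ and $\|\varphi\|^2_{\mathcal{HP}^{\otimes n}}=I_T$. Here $\varphi\in\mathcal{HP}^{\otimes n}$ means that $\varphi$ represents an element of $\mathcal{HP}^{\otimes n}$ (which is then unique): there are $\ell_k\in\mathcal E^{\otimes n}$ converging to that element in $\mathcal{HP}^{\otimes n}$ and such that the integral $I_\infty$, defined like $I_T$ with $(0,\infty)$ in place of $(0,T)$ and $\mathcal F(\varphi-\ell_k)$ in place of $\mathcal F\varphi$, tends to $0$. -/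

import Mathlib

open MeasureTheory SchwartzMap Filter Topology
open scoped ENNReal NNReal FourierTransform

namespace FracNoise

noncomputable section

/-- The space `ℝ^d`. -/
abbrev Space (d : ℕ) : Type := EuclideanSpace ℝ (Fin d)

/-- The dilation `x ↦ x / (2π)`. -/
def angularScale (V : Type*) [NormedAddCommGroup V] [InnerProductSpace ℝ V] : V ≃L[ℝ] V :=
  ContinuousLinearEquiv.smulLeft (Units.mk0 ((2 * Real.pi)⁻¹ : ℝ) (by positivity))

/-- The Fourier transform of a Schwartz function with the angular normalisation
`ℱ h (ξ) = ∫ e^{-i ξ·x} h(x) dx` (see `schwartzFourier_apply`). -/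
def schwartzFourier {V : Type*} [NormedAddCommGroup V] [InnerProductSpace ℝ V]
    [FiniteDimensional ℝ V] [MeasurableSpace V] [BorelSpace V] (h : 𝓢(V, ℂ)) : 𝓢(V, ℂ) :=
  SchwartzMap.compCLMOfContinuousLinearEquiv ℂ (angularScale V) (𝓕 h)

theorem schwartzFourier_apply {V : Type*} [NormedAddCommGroup V] [InnerProductSpace ℝ V]
    [FiniteDimensional ℝ V] [MeasurableSpace V] [BorelSpace V] (h : 𝓢(V, ℂ)) (ξ : V) :
    schwartzFourier h ξ = ∫ x, Complex.exp (-((inner ℝ ξ x : ℝ) : ℂ) * Complex.I) * h x := by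
  have h1 : schwartzFourier h ξ = 𝓕 (h : V → ℂ) ((2 * Real.pi)⁻¹ • ξ) := by
    rw [← SchwartzMap.fourier_coe]; rfl
  rw [h1, Real.fourier_eq']
  congr 1; ext x
  rw [smul_eq_mul]
  congr 2
  rw [inner_smul_right, real_inner_comm]
  push_cast
  field_simp

/-- The spatial covariance of the noise: a function `f : ℝ^d → ℝ₊` which is the Fourier transform, in
the sense of tempered distributions, of a tempered measure `μ`. -/
structure SpatialCovariance (d : ℕ) where
  f : Space d → ℝ
  μ : Measure (Space d)
  nonneg : ∀ x, 0 ≤ f x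
  tempered : μ.HasTemperateGrowth
  integrable : ∀ h : 𝓢(Space d, ℂ), Integrable (fun x => (f x : ℂ) * h x)
  fourier : ∀ h : 𝓢(Space d, ℂ), ∫ x, (f x : ℂ) * h x = ∫ ξ, schwartzFourier h ξ ∂μ

/-- Index of an elementary function `1_{[0,t] × A}`, where `t ≥ 0` and `A` is a bounded Borel set
of `ℝ^d`. -/
structure Brick (d : ℕ) where
  time : ℝ≥0
  set : Set (Space d)
  measurableSet : MeasurableSet set
  isBounded : Bornology.IsBounded set

/-- `∫_A ∫_B f(x-y) dx dy`. -/
def spaceCov {d : ℕ} (C : SpatialCovariance d) (A B : Set (Space d)) : ℝ :=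
  ∫ x in A, ∫ y in B, C.f (x - y)

/-- The covariance `R_H(t,s) = α_H ∫_0^t ∫_0^s |u-v|^{2H-2} du dv`, `α_H = H(2H-1)`, of the fractional
Brownian motion. -/
def fbmCov (H t s : ℝ) : ℝ :=
  H * (2 * H - 1) * ∫ u in (0 : ℝ)..t, ∫ v in (0 : ℝ)..s, |u - v| ^ (2 * H - 2)

theorem SpatialCovariance.locallyIntegrable {d : ℕ} (C : SpatialCovariance d) (R : ℝ) :
    IntegrableOn C.f (Metric.closedBall 0 R) := by
  let b : ContDiffBump (0 : Space d) := ⟨|R| + 1, |R| + 2, by positivity, by linarith⟩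
  have hb1 : HasCompactSupport (fun x => ((b x : ℝ) : ℂ)) :=
    b.hasCompactSupport.comp_left (g := fun r : ℝ => (r : ℂ)) (by simp)
  have hb2 : ContDiff ℝ (⊤ : ℕ∞) (fun x => ((b x : ℝ) : ℂ)) :=
    Complex.ofRealCLM.contDiff.comp b.contDiff
  have h := (C.integrable (hb1.toSchwartzMap hb2)).re
  have h2 : IntegrableOn (fun x => C.f x * b x) (Metric.closedBall 0 R) := by
    refine (h.congr ?_).integrableOn
    refine Eventually.of_forall fun x => ?_
    have hx : (hb1.toSchwartzMap hb2) x = ((b x : ℝ) : ℂ) := rfl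
    simp [hx]
  refine h2.congr_fun (fun x hx => ?_) measurableSet_closedBall
  have : b x = 1 := b.one_of_mem_closedBall (by
    rw [Metric.mem_closedBall] at hx ⊢
    have := le_abs_self R
    show dist x 0 ≤ |R| + 1
    linarith)
  simp [this]

theorem posSemidef_gram {ι Z : Type*} [MeasurableSpace Z] (ρ : Measure Z) (P : ι → Z → ℝ)
    (hP : ∀ a b, Integrable (fun z => P a z * P b z) ρ) :
    Matrix.PosSemidef (Matrix.of fun a b => ∫ z, P a z * P b z ∂ρ) := by
  refine ⟨?_, fun c => ?_⟩
  · ext a b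
    simp [mul_comm]
  · have hI : ∀ i j, Integrable (fun z => c i * P i z * (c j * P j z)) ρ := fun i j =>
      ((hP i j).const_mul (c i * c j)).congr (Eventually.of_forall fun z => by ring)
    have key : (c.sum fun i xi => c.sum fun j xj =>
        star xi * (Matrix.of fun a b => ∫ z, P a z * P b z ∂ρ) i j * xj)
        = ∫ z, (∑ i ∈ c.support, c i * P i z) ^ 2 ∂ρ := by
      simp only [Finsupp.sum, pow_two, Finset.sum_mul_sum]
      rw [integral_finsetSum _ fun i _ => integrable_finsetSum _ fun j _ => hI i j]
      refine Finset.sum_congr rfl fun i _ => ?_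
      rw [integral_finsetSum _ fun j _ => hI i j]
      refine Finset.sum_congr rfl fun j _ => ?_
      simp only [Matrix.of_apply, star_trivial]
      rw [mul_right_comm, ← integral_const_mul]
      congr 1; ext z; ring
    rw [key]
    exact integral_nonneg fun z => sq_nonneg _

theorem posSemidef_lgram {ι Z : Type*} [MeasurableSpace Z] (ρ : Measure Z) (P : ι → Z → ℝ≥0∞)
    (hm : ∀ a, Measurable (P a)) (hf : ∀ a z, P a z ≠ ⊤)
    (hP : ∀ a b, ∫⁻ z, P a z * P b z ∂ρ ≠ ⊤) :
    Matrix.PosSemidef (Matrix.of fun a b => (∫⁻ z, P a z * P b z ∂ρ).toReal) := by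
  have h1 : ∀ a b, Integrable (fun z => (P a z).toReal * (P b z).toReal) ρ := by
    intro a b
    have := integrable_toReal_of_lintegral_ne_top ((hm a).mul (hm b)).aemeasurable (hP a b)
    simpa [ENNReal.toReal_mul] using this
  convert posSemidef_gram ρ (fun a z => (P a z).toReal) h1 using 1
  ext a b
  simp only [Matrix.of_apply]
  have h2 := integral_toReal (μ := ρ) ((hm a).mul (hm b)).aemeasurable
    (Eventually.of_forall fun z => ENNReal.mul_lt_top (hf a z).lt_top (hf b z).lt_top)
  simp only [Pi.mul_apply, ENNReal.toReal_mul] at h2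
  exact h2.symm

theorem lintegral_layer {β a : ℝ} (hβ : 0 < β) (ha : 0 < a) :
    ∫⁻ r in Set.Ioi (0 : ℝ), ENNReal.ofReal (r ^ (-β - 2)) * ENNReal.ofReal (r - a)
      = ENNReal.ofReal (1 / (β * (β + 1))) * ENNReal.ofReal (a ^ (-β)) := by
  have hi1 : IntegrableOn (fun r : ℝ => r ^ (-β - 1)) (Set.Ioi a) :=
    integrableOn_Ioi_rpow_of_lt (by linarith) ha
  have hi2 : IntegrableOn (fun r : ℝ => r ^ (-β - 2)) (Set.Ioi a) :=
    integrableOn_Ioi_rpow_of_lt (by linarith) ha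
  have e1 : ∫⁻ r in Set.Ioi (0 : ℝ), ENNReal.ofReal (r ^ (-β - 2)) * ENNReal.ofReal (r - a)
      = ∫⁻ r in Set.Ioi a, ENNReal.ofReal (r ^ (-β - 1) - a * r ^ (-β - 2)) := by
    rw [← lintegral_indicator measurableSet_Ioi, ← lintegral_indicator measurableSet_Ioi]
    congr 1; ext r
    by_cases h : a < r
    · have h0 : 0 < r := ha.trans h
      rw [Set.indicator_of_mem (Set.mem_Ioi.2 h0), Set.indicator_of_mem (Set.mem_Ioi.2 h),
        ← ENNReal.ofReal_mul (by positivity)]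
      congr 1
      have : r ^ (-β - 1) = r ^ (-β - 2) * r := by
        rw [← Real.rpow_add_one h0.ne']; congr 1; ring
      rw [this]; ring
    · rw [Set.indicator_of_notMem (s := Set.Ioi a) (by simpa using h)]
      have h3 : ENNReal.ofReal (r - a) = 0 :=
        ENNReal.ofReal_of_nonpos (by linarith [not_lt.1 h])
      refine Set.indicator_apply_eq_zero.2 fun _ => ?_
      simp [h3]
  have e0 : ∀ r, r ^ (-β - 1) - a * r ^ (-β - 2) =
    ((fun r : ℝ => r ^ (-β - 1)) - fun r => a * r ^ (-β - 2)) r := fun r => rfl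
  simp only [e0] at e1
  rw [e1, ← ofReal_integral_eq_lintegral_ofReal (hi1.sub (hi2.const_mul a)),
    ← ENNReal.ofReal_mul (by positivity)]
  · congr 1
    simp only [Pi.sub_apply]
    rw [integral_sub hi1 (hi2.const_mul a), integral_const_mul,
      integral_Ioi_rpow_of_lt (by linarith) ha, integral_Ioi_rpow_of_lt (by linarith) ha]
    have e2 : -β - 1 + 1 = -β := by ring
    have e3 : -β - 2 + 1 = -β - 1 := by ring
    rw [e2, e3]
    have : a ^ (-β) = a ^ (-β - 1) * a := by
      rw [← Real.rpow_add_one ha.ne']; congr 1; ring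
    rw [this]
    have : -β - 1 ≠ 0 := by linarith
    have : β + 1 ≠ 0 := by linarith
    field_simp
    ring
  · refine (ae_restrict_iff' measurableSet_Ioi).2 (Eventually.of_forall fun r hr => ?_)
    have h0 : 0 < r := ha.trans hr
    have : r ^ (-β - 1) = r ^ (-β - 2) * r := by
      rw [← Real.rpow_add_one h0.ne']; congr 1; ring
    simp only [Pi.zero_apply, Pi.sub_apply, this]
    have : (a:ℝ) < r := hr
    nlinarith [Real.rpow_pos_of_pos h0 (-β - 2)]

/-- The weighted indicator of a window `(y, y+r)` at `u`, for `z = (r, y)`. -/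
def win (β : ℝ) (u : ℝ) (z : ℝ × ℝ) : ℝ≥0∞ :=
  ENNReal.ofReal (z.1 ^ (-β / 2 - 1)) * (if z.2 < u ∧ u < z.2 + z.1 then 1 else 0)

theorem measurable_win (β : ℝ) : Measurable (fun q : ℝ × (ℝ × ℝ) => win β q.1 q.2) := by
  unfold win
  refine Measurable.mul (by fun_prop) (Measurable.ite ?_ measurable_const measurable_const)
  have h1 : MeasurableSet {q : ℝ × ℝ × ℝ | q.2.2 < q.1} :=
    measurableSet_lt (by fun_prop) (by fun_prop)
  have h2 : MeasurableSet {q : ℝ × ℝ × ℝ | q.1 < q.2.2 + q.2.1} :=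
    measurableSet_lt (by fun_prop) (by fun_prop)
  exact h1.inter h2

theorem lintegral_win {β u v : ℝ} (hβ : 0 < β) (huv : u ≠ v) :
    ∫⁻ z, win β u z * win β v z ∂((volume.restrict (Set.Ioi (0 : ℝ))).prod volume)
      = ENNReal.ofReal (1 / (β * (β + 1))) * ENNReal.ofReal (|u - v| ^ (-β)) := by
  have hm : ∀ u, Measurable (win β u) := fun u =>
    (measurable_win β).comp (measurable_prodMk_left (x := u))
  rw [lintegral_prod (fun z => win β u z * win β v z) ((hm u).mul (hm v)).aemeasurable,
    ← lintegral_layer hβ (abs_pos.2 (sub_ne_zero.2 huv))]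
  refine setLIntegral_congr_fun measurableSet_Ioi fun r hr => ?_
  have hr0 : (0:ℝ) < r := hr
  have e : ∀ y, win β u (r, y) * win β v (r, y) = (Set.Ioo (max u v - r) (min u v)).indicator
      (fun _ => ENNReal.ofReal (r ^ (-β - 2))) y := by
    intro y
    have h2 : ENNReal.ofReal (r ^ (-β - 2)) =
        ENNReal.ofReal (r ^ (-β / 2 - 1)) * ENNReal.ofReal (r ^ (-β / 2 - 1)) := by
      rw [← ENNReal.ofReal_mul (by positivity), ← Real.rpow_add hr0]
      congr 2; ring
    unfold win
    by_cases h : y ∈ Set.Ioo (max u v - r) (min u v)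
    · rw [Set.indicator_of_mem h, h2]
      obtain ⟨h3, h4⟩ := h
      rw [sub_lt_iff_lt_add, max_lt_iff] at h3
      rw [lt_min_iff] at h4
      simp [h3, h4]
    · rw [Set.indicator_of_notMem h]
      have : ¬ ((y < u ∧ u < y + r) ∧ (y < v ∧ v < y + r)) := by
        rintro ⟨⟨a1, a2⟩, a3, a4⟩
        exact h ⟨by rw [sub_lt_iff_lt_add, max_lt_iff]; exact ⟨a2, a4⟩, lt_min a1 a3⟩
      by_cases h5 : y < u ∧ u < y + r
      · have : ¬ (y < v ∧ v < y + r) := fun h6 => this ⟨h5, h6⟩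
        simp [this]
      · simp [h5]
  simp only [e]
  rw [lintegral_indicator measurableSet_Ioo, setLIntegral_const, Real.volume_Ioo]
  congr 2
  have : max u v - min u v = |u - v| := by rw [max_sub_min_eq_abs, abs_sub_comm]
  linarith

theorem lintegral_pow_bound {β : ℝ} (h1 : β < 1) (s M : ℝ) (hs : 0 ≤ s) (hM : 0 ≤ M) :
    ∃ K : ℝ≥0∞, K ≠ ⊤ ∧ ∀ u, 0 ≤ u → u ≤ M →
      ∫⁻ v in Set.Ioc 0 s, ENNReal.ofReal (|u - v| ^ (-β)) ≤ K := by
  have hi : IntervalIntegrable (fun w : ℝ => |w| ^ (-β)) volume (-(M + s)) (M + s) := by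
    have h2 : IntervalIntegrable (fun w : ℝ => |w| ^ (-β)) volume 0 (M + s) := by
      refine (intervalIntegral.intervalIntegrable_rpow' (a := 0) (b := M + s)
        (r := -β) (by linarith)).congr ?_
      intro x hx
      rw [Set.uIoc_of_le (by linarith)] at hx
      simp [abs_of_pos hx.1]
    have h3 : IntervalIntegrable (fun w : ℝ => |w| ^ (-β)) volume (-(M+s)) 0 := by
      have := (IntervalIntegrable.iff_comp_neg (f := fun w : ℝ => |w| ^ (-β))).1 h2
      simpa using this.symm
    exact h3.trans h2
  refine ⟨∫⁻ w in Set.Ioc (-(M + s)) (M + s), ENNReal.ofReal (|w| ^ (-β)), ?_, ?_⟩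
  · exact (hi.1.lintegral_lt_top).ne
  · intro u hu huM
    rw [← lintegral_indicator measurableSet_Ioc, ← lintegral_indicator measurableSet_Ioc]
    rw [← lintegral_sub_left_eq_self (fun v => (Set.Ioc 0 s).indicator
      (fun v => ENNReal.ofReal (|u - v| ^ (-β))) v) u]
    have hae : ∀ᵐ w : ℝ, w ≠ -(M+s) := by
      simp [ae_iff]
    refine lintegral_mono_ae (hae.mono fun w hw => ?_)
    by_cases h : u - w ∈ Set.Ioc 0 s
    · rw [Set.indicator_of_mem h, Set.indicator_of_mem]
      · simp
      · obtain ⟨a, b⟩ := h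
        exact ⟨lt_of_le_of_ne (by linarith) (Ne.symm hw), by linarith⟩
    · rw [Set.indicator_of_notMem h]; simp

theorem posSemidef_fbmCov {H : ℝ} (h0 : 1 / 2 < H) (h1 : H < 1) :
    Matrix.PosSemidef (Matrix.of fun t s : ℝ≥0 => fbmCov H t s) := by
  set β : ℝ := 2 - 2 * H with hβ
  have hβ0 : 0 < β := by linarith
  have hβ1 : β < 1 := by linarith
  set ρ : Measure (ℝ × ℝ) := (volume.restrict (Set.Ioi (0 : ℝ))).prod volume with hρ
  set c : ℝ := 1 / (β * (β + 1)) with hc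
  have hc0 : 0 < c := by positivity
  let P : ℝ≥0 → ℝ × ℝ → ℝ≥0∞ := fun t z => ∫⁻ u in Set.Ioc 0 (t : ℝ), win β u z
  have hwm := measurable_win β
  have hwm' : ∀ u, Measurable (win β u) := fun u =>
    hwm.comp (measurable_prodMk_left (x := u))
  have hwz : ∀ z, Measurable fun u => win β u z := fun z =>
    hwm.comp (measurable_prodMk_right (y := z))
  have hPm : ∀ t, Measurable (P t) := fun t =>
    Measurable.lintegral_prod_left' (f := fun q : ℝ × (ℝ × ℝ) => win β q.1 q.2) hwm
  have hPf : ∀ t z, P t z ≠ ⊤ := by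
    intro t z
    refine ne_top_of_le_ne_top ?_ (lintegral_mono (g := fun _ => ENNReal.ofReal (z.1 ^ (-β / 2 - 1)))
      fun u => ?_)
    · simp [ENNReal.mul_eq_top]
    · unfold win
      split_ifs <;> simp
  let J : ℝ≥0 → ℝ≥0 → ℝ≥0∞ := fun t s =>
    ∫⁻ u in Set.Ioc 0 (t : ℝ), ∫⁻ v in Set.Ioc 0 (s : ℝ), ENNReal.ofReal (|u - v| ^ (-β))
  have hPJ : ∀ t s, ∫⁻ z, P t z * P s z ∂ρ = ENNReal.ofReal c * J t s := by
    intro t s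
    calc ∫⁻ z, P t z * P s z ∂ρ
        = ∫⁻ z, (∫⁻ u in Set.Ioc 0 (t : ℝ), ∫⁻ v in Set.Ioc 0 (s : ℝ),
            win β u z * win β v z) ∂ρ := by
          refine lintegral_congr fun z => ?_
          show (∫⁻ u in Set.Ioc 0 (t : ℝ), win β u z) * P s z = _
          rw [← lintegral_mul_const _ (hwz z)]
          refine lintegral_congr fun u => ?_
          rw [← lintegral_const_mul _ (hwz z)]
      _ = ∫⁻ u in Set.Ioc 0 (t : ℝ), ∫⁻ z, (∫⁻ v in Set.Ioc 0 (s : ℝ),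
            win β u z * win β v z) ∂ρ := by
          rw [lintegral_lintegral_swap]
          refine Measurable.aemeasurable ?_
          refine Measurable.lintegral_prod_right'
            (f := fun q : ((ℝ × ℝ) × ℝ) × ℝ => win β q.1.2 q.1.1 * win β q.2 q.1.1) ?_
          exact (hwm.comp (by fun_prop : Measurable fun q : ((ℝ × ℝ) × ℝ) × ℝ =>
            (q.1.2, q.1.1))).mul (hwm.comp (by fun_prop : Measurable
              fun q : ((ℝ × ℝ) × ℝ) × ℝ => (q.2, q.1.1)))
      _ = ∫⁻ u in Set.Ioc 0 (t : ℝ), ∫⁻ v in Set.Ioc 0 (s : ℝ), ∫⁻ z,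
            win β u z * win β v z ∂ρ := by
          refine lintegral_congr fun u => ?_
          rw [lintegral_lintegral_swap]
          refine Measurable.aemeasurable ?_
          exact ((hwm' u).comp measurable_fst).mul (hwm.comp
            (by fun_prop : Measurable fun q : (ℝ × ℝ) × ℝ => (q.2, q.1)))
      _ = ∫⁻ u in Set.Ioc 0 (t : ℝ), ∫⁻ v in Set.Ioc 0 (s : ℝ),
            ENNReal.ofReal c * ENNReal.ofReal (|u - v| ^ (-β)) := by
          refine lintegral_congr fun u => ?_
          refine lintegral_congr_ae (ae_restrict_of_ae ?_)
          have : ∀ᵐ v : ℝ, v ≠ u := by simp [ae_iff]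
          filter_upwards [this] with v hv
          exact lintegral_win hβ0 hv.symm
      _ = ENNReal.ofReal c * J t s := by
          rw [← lintegral_const_mul _ ?_]
          · refine lintegral_congr fun u => ?_
            rw [lintegral_const_mul _ (by fun_prop)]
          · exact Measurable.lintegral_prod_right'
              (f := fun q : ℝ × ℝ => ENNReal.ofReal (|q.1 - q.2| ^ (-β))) (by fun_prop)
  have hJf : ∀ t s, J t s ≠ ⊤ := by
    intro t s
    obtain ⟨K, hK, hb⟩ := lintegral_pow_bound hβ1 s t s.2 t.2
    refine ne_top_of_le_ne_top (b := K * ENNReal.ofReal t) ?_ ?_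
    · exact ENNReal.mul_ne_top hK ENNReal.ofReal_ne_top
    · calc J t s ≤ ∫⁻ u in Set.Ioc 0 (t : ℝ), K :=
            setLIntegral_mono' measurableSet_Ioc fun u hu => hb u hu.1.le hu.2
        _ = _ := by simp
  have hcov : ∀ t s : ℝ≥0, fbmCov H t s = (H * (2 * H - 1)) * (J t s).toReal := by
    intro t s
    unfold fbmCov
    congr 1
    obtain ⟨K, hK, hb⟩ := lintegral_pow_bound hβ1 s t s.2 t.2
    have hexp : 2 * H - 2 = -β := by rw [hβ]; ring
    rw [hexp, intervalIntegral.integral_of_le t.coe_nonneg]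
    rw [integral_congr_ae (g := fun u => (∫⁻ v in Set.Ioc 0 (s : ℝ),
      ENNReal.ofReal (|u - v| ^ (-β))).toReal)]
    · rw [integral_toReal]
      · exact (Measurable.lintegral_prod_right'
              (f := fun q : ℝ × ℝ => ENNReal.ofReal (|q.1 - q.2| ^ (-β))) (by fun_prop)).aemeasurable
      · exact (ae_restrict_iff' measurableSet_Ioc).2 (Eventually.of_forall fun u hu =>
          (hb u hu.1.le hu.2).trans_lt hK.lt_top)
    · refine Eventually.of_forall fun u => ?_
      simp only
      rw [intervalIntegral.integral_of_le s.coe_nonneg, integral_eq_lintegral_of_nonneg_ae]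
      · exact Eventually.of_forall fun v => by positivity
      · exact Measurable.aestronglyMeasurable (by fun_prop)
  have hps := posSemidef_lgram ρ P hPm hPf (fun t s => by
    rw [hPJ]; exact ENNReal.mul_ne_top ENNReal.ofReal_ne_top (hJf t s))
  have hnn : 0 ≤ H * (2 * H - 1) / c := by
    have : 0 ≤ 2 * H - 1 := by linarith
    positivity
  have := hps.smul hnn
  convert this using 1
  ext t s
  simp only [Matrix.smul_apply, Matrix.of_apply, hPJ, hcov, ENNReal.toReal_mul,
    ENNReal.toReal_ofReal hc0.le, smul_eq_mul]
  field_simp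

theorem SpatialCovariance.locInt {d : ℕ} (C : SpatialCovariance d) :
    LocallyIntegrable C.f volume := by
  intro x
  refine ⟨Metric.closedBall 0 (‖x‖ + 1), ?_, C.locallyIntegrable _⟩
  refine Filter.mem_of_superset (Metric.isOpen_ball.mem_nhds
    (?_ : x ∈ Metric.ball 0 (‖x‖ + 1))) Metric.ball_subset_closedBall
  simp

theorem SpatialCovariance.even {d : ℕ} (C : SpatialCovariance d) :
    (fun x => C.f (-x)) =ᵐ[volume] C.f := by
  have hl : LocallyIntegrable (fun x => C.f (-x)) volume := by
    intro x
    refine ⟨Metric.closedBall 0 (‖x‖ + 1), ?_, ?_⟩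
    · refine Filter.mem_of_superset (Metric.isOpen_ball.mem_nhds
        (?_ : x ∈ Metric.ball 0 (‖x‖ + 1))) Metric.ball_subset_closedBall
      simp
    · rw [← integrable_indicator_iff measurableSet_closedBall]
      have := ((integrable_indicator_iff measurableSet_closedBall).2
        (C.locallyIntegrable (‖x‖ + 1))).comp_neg
      refine this.congr (Eventually.of_forall fun y => ?_)
      by_cases h : ‖y‖ ≤ ‖x‖ + 1 <;> simp [Set.indicator, h]
  refine ae_eq_of_integral_contDiff_smul_eq hl C.locInt fun g hg hgs => ?_
  have hc1 : HasCompactSupport (fun x => ((g x : ℝ) : ℂ)) :=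
    hgs.comp_left (g := fun r : ℝ => (r : ℂ)) (by simp)
  have hc2 : ContDiff ℝ (⊤ : ℕ∞) (fun x => ((g x : ℝ) : ℂ)) :=
    Complex.ofRealCLM.contDiff.comp hg
  set h : 𝓢(Space d, ℂ) := hc1.toSchwartzMap hc2 with hh
  have hval : ∀ x, h x = ((g x : ℝ) : ℂ) := fun x => rfl
  set h' : 𝓢(Space d, ℂ) :=
    SchwartzMap.compCLMOfContinuousLinearEquiv ℂ (ContinuousLinearEquiv.neg ℝ) h with hh'
  have hval' : ∀ x, h' x = ((g (-x) : ℝ) : ℂ) := fun x => rfl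
  have e1 : ∀ ξ, schwartzFourier h' ξ = starRingEnd ℂ (schwartzFourier h ξ) := by
    intro ξ
    rw [schwartzFourier_apply, schwartzFourier_apply, ← integral_conj, ← integral_neg_eq_self]
    refine integral_congr_ae (Eventually.of_forall fun x => ?_)
    simp [hval, hval', ← Complex.exp_conj]
  have e2 : ∫ x, (C.f x : ℂ) * h' x = starRingEnd ℂ (∫ x, (C.f x : ℂ) * h x) := by
    rw [C.fourier, C.fourier, ← integral_conj]
    simp only [e1]
  simp only [hval, hval', ← Complex.ofReal_mul] at e2
  rw [integral_complex_ofReal, integral_complex_ofReal, Complex.conj_ofReal] at e2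
  have e3 := Complex.ofReal_injective e2
  rw [← integral_neg_eq_self]
  simp only [neg_neg, smul_eq_mul]
  calc ∫ x, g (-x) * C.f x = ∫ x, C.f x * g (-x) := by simp only [mul_comm]
    _ = _ := by rw [e3]; simp only [mul_comm]

theorem integrable_cov {d : ℕ} (C : SpatialCovariance d) {g h : Space d → ℝ} {M R : ℝ}
    (hg : Measurable g) (hh : Measurable h) (hgM : ∀ x, |g x| ≤ M) (hhM : ∀ x, |h x| ≤ M)
    (hgR : ∀ x, R < ‖x‖ → g x = 0) (hhR : ∀ x, R < ‖x‖ → h x = 0) :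
    Integrable (fun p : Space d × Space d =>
      (Metric.closedBall (0 : Space d) R).indicator (fun _ => M * M) p.1 *
        (Metric.closedBall (0 : Space d) (2 * R)).indicator (fun z => |C.f z|) p.2)
        (volume.prod volume) ∧
    (∀ p : Space d × Space d, ‖g p.1 * h (p.1 - p.2) * C.f p.2‖ ≤
      (Metric.closedBall (0 : Space d) R).indicator (fun _ => M * M) p.1 *
        (Metric.closedBall (0 : Space d) (2 * R)).indicator (fun z => |C.f z|) p.2) ∧
    Integrable (fun p : Space d × Space d => g p.1 * h (p.1 - p.2) * C.f p.2)
      (volume.prod volume) := by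
  have hfm : AEStronglyMeasurable C.f volume := C.locInt.aestronglyMeasurable
  have h1 : Integrable (fun p : Space d × Space d =>
      (Metric.closedBall (0 : Space d) R).indicator (fun _ => M * M) p.1 *
        (Metric.closedBall (0 : Space d) (2 * R)).indicator (fun z => |C.f z|) p.2)
        (volume.prod volume) := by
    refine Integrable.mul_prod ?_ ?_
    · refine (integrable_indicator_iff measurableSet_closedBall).2 ?_
      exact integrableOn_const (measure_closedBall_lt_top.ne)
    · refine (integrable_indicator_iff measurableSet_closedBall).2 ?_
      exact (C.locallyIntegrable _).abs
  have h2 : ∀ p : Space d × Space d, ‖g p.1 * h (p.1 - p.2) * C.f p.2‖ ≤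
      (Metric.closedBall (0 : Space d) R).indicator (fun _ => M * M) p.1 *
        (Metric.closedBall (0 : Space d) (2 * R)).indicator (fun z => |C.f z|) p.2 := by
    rintro ⟨x, z⟩
    have hM : 0 ≤ M := (abs_nonneg _).trans (hgM 0)
    have hR : 0 ≤ (Metric.closedBall (0 : Space d) R).indicator (fun _ => M * M) x *
        (Metric.closedBall (0 : Space d) (2 * R)).indicator (fun z => |C.f z|) z :=
      mul_nonneg (Set.indicator_nonneg (fun _ _ => by positivity) _)
        (Set.indicator_nonneg (fun _ _ => abs_nonneg _) _)
    by_cases h1 : ‖x‖ ≤ R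
    · by_cases h2 : ‖x - z‖ ≤ R
      · have h3 : ‖z‖ ≤ 2 * R := by
          have : z = x - (x - z) := by abel
          rw [this]
          linarith [norm_sub_le x (x - z)]
        rw [Set.indicator_of_mem (by simpa using h1), Set.indicator_of_mem (by simpa using h3)]
        simp only [norm_mul, Real.norm_eq_abs]
        gcongr
        · exact hgM x
        · exact hhM _
      · simp only [hhR _ (not_le.1 h2)]
        simpa using hR
    · simp only [hgR _ (not_le.1 h1)]
      simpa using hR
  refine ⟨h1, h2, h1.mono' ?_ (Eventually.of_forall h2)⟩
  refine AEStronglyMeasurable.mul ?_ hfm.comp_snd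
  exact Measurable.aestronglyMeasurable (by fun_prop)

theorem covForm_nonneg_smooth {d : ℕ} (C : SpatialCovariance d) {g : Space d → ℝ} {M R : ℝ}
    (hg : ContDiff ℝ (⊤ : ℕ∞) g) (hgM : ∀ x, |g x| ≤ M)
    (hgR : ∀ x, R < ‖x‖ → g x = 0) :
    0 ≤ ∫ p : Space d × Space d, g p.1 * g (p.1 - p.2) * C.f p.2 ∂(volume.prod volume) := by
  have hsupp : HasCompactSupport g := by
    refine HasCompactSupport.intro (isCompact_closedBall (0 : Space d) R) fun x hx => ?_
    exact hgR x (by simpa using hx)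
  have hc1 : HasCompactSupport (fun x => ((g x : ℝ) : ℂ)) :=
    hsupp.comp_left (g := fun r : ℝ => (r : ℂ)) (by simp)
  have hc2 : ContDiff ℝ (⊤ : ℕ∞) (fun x => ((g x : ℝ) : ℂ)) :=
    Complex.ofRealCLM.contDiff.comp hg
  set h : 𝓢(Space d, ℂ) := hc1.toSchwartzMap hc2 with hh
  have hval : ∀ x, h x = ((g x : ℝ) : ℂ) := fun x => rfl
  set h' : 𝓢(Space d, ℂ) :=
    SchwartzMap.compCLMOfContinuousLinearEquiv ℂ (ContinuousLinearEquiv.neg ℝ) h with hh'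
  have hval' : ∀ x, h' x = ((g (-x) : ℝ) : ℂ) := fun x => rfl
  set ψ : 𝓢(Space d, ℂ) := SchwartzMap.convolution (ContinuousLinearMap.mul ℂ ℂ) h h' with hψ
  have hψv : ∀ z, ψ z = ((∫ x, g x * g (x - z) : ℝ) : ℂ) := by
    intro z
    rw [hψ, SchwartzMap.convolution_apply, ← integral_complex_ofReal]
    refine integral_congr_ae (Eventually.of_forall fun x => ?_)
    simp [hval, hval']
  have hF : ∀ ξ, schwartzFourier ψ ξ = ((‖schwartzFourier h ξ‖ ^ 2 : ℝ) : ℂ) := by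
    intro ξ
    have e1 : schwartzFourier h' ξ = starRingEnd ℂ (schwartzFourier h ξ) := by
      rw [schwartzFourier_apply, schwartzFourier_apply, ← integral_conj,
        ← integral_neg_eq_self]
      refine integral_congr_ae (Eventually.of_forall fun x => ?_)
      simp [hval, hval', ← Complex.exp_conj]
    have e2 : schwartzFourier ψ ξ = schwartzFourier h ξ * schwartzFourier h' ξ := by
      simp only [schwartzFourier, hψ, SchwartzMap.fourier_convolution]
      rfl
    rw [e2, e1, Complex.mul_conj, Complex.normSq_eq_norm_sq]
  have hint := (integrable_cov C hg.continuous.measurable hg.continuous.measurable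
    hgM hgM hgR hgR).2.2
  have e3 : ∫ p : Space d × Space d, g p.1 * g (p.1 - p.2) * C.f p.2 ∂(volume.prod volume)
      = ∫ z, C.f z * ∫ x, g x * g (x - z) := by
    rw [integral_prod_symm _ hint]
    refine integral_congr_ae (Eventually.of_forall fun z => ?_)
    simp only
    rw [← integral_const_mul]
    congr 1; ext x; ring
  have e4 := C.fourier ψ
  simp only [hψv, hF, ← Complex.ofReal_mul] at e4
  rw [integral_complex_ofReal, integral_complex_ofReal] at e4
  rw [e3, Complex.ofReal_injective e4]
  exact integral_nonneg fun ξ => by positivity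

theorem covForm_nonneg {d : ℕ} (C : SpatialCovariance d) {g : Space d → ℝ} {M R : ℝ}
    (hg : Measurable g) (hgM : ∀ x, |g x| ≤ M) (hgR : ∀ x, R < ‖x‖ → g x = 0) :
    0 ≤ ∫ p : Space d × Space d, g p.1 * g (p.1 - p.2) * C.f p.2 ∂(volume.prod volume) := by
  have hgi : Integrable g volume := by
    have hb : Integrable ((Metric.closedBall (0 : Space d) R).indicator fun _ => M) volume :=
      (integrable_indicator_iff measurableSet_closedBall).2
        (integrableOn_const (measure_closedBall_lt_top.ne))
    refine hb.mono' hg.aestronglyMeasurable (Eventually.of_forall fun x => ?_)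
    by_cases h : ‖x‖ ≤ R
    · rw [Set.indicator_of_mem (by simpa using h)]; exact hgM x
    · rw [hgR x (not_le.1 h), Set.indicator_of_notMem (by simpa using h)]; simp
  let b : ℕ → ContDiffBump (0 : Space d) := fun k =>
    ⟨1 / (2 * (k + 1)), 1 / (k + 1), by positivity, by
      rw [one_div_lt_one_div (by positivity) (by positivity)]
      have : (0 : ℝ) ≤ k := by positivity
      linarith⟩
  have hb1 : Tendsto (fun k => (b k).rOut) atTop (𝓝 0) :=
    tendsto_one_div_add_atTop_nhds_zero_nat
  have hb2 : ∀ k, (b k).rOut ≤ 2 * (b k).rIn := fun k => by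
    show 1 / ((k : ℝ) + 1) ≤ 2 * (1 / (2 * (k + 1)))
    field_simp
    exact le_rfl
  have hb3 : ∀ k, (b k).rOut ≤ 1 := fun k => by
    show 1 / ((k : ℝ) + 1) ≤ 1
    rw [div_le_one (by positivity)]
    have : (0 : ℝ) ≤ k := by positivity
    linarith
  let G : ℕ → Space d → ℝ := fun k =>
    MeasureTheory.convolution ((b k).normed (volume : Measure (Space d))) g (ContinuousLinearMap.lsmul ℝ ℝ) volume
  have hlim := ContDiffBump.ae_convolution_tendsto_right_of_locallyIntegrable
    (μ := (volume : Measure (Space d))) hb1 (Eventually.of_forall hb2) hgi.locallyIntegrable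
  have hGs : ∀ k, ContDiff ℝ (⊤ : ℕ∞) (G k) := fun k =>
    (b k).hasCompactSupport_normed.contDiff_convolution_left _ (b k).contDiff_normed
      hgi.locallyIntegrable
  have hGM : ∀ k x, |G k x| ≤ M := by
    intro k x
    have hI : Integrable (fun t => (b k).normed (volume : Measure (Space d)) t * M) volume :=
      Integrable.mul_const (b k).integrable_normed M
    have h1 : |∫ t, (b k).normed (volume : Measure (Space d)) t * g (x - t)| ≤
        ∫ t, (b k).normed (volume : Measure (Space d)) t * M := by
      rw [← Real.norm_eq_abs]
      refine norm_integral_le_of_norm_le hI (Eventually.of_forall fun t => ?_)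
      rw [norm_mul, Real.norm_eq_abs, Real.norm_eq_abs, abs_of_nonneg ((b k).nonneg_normed t)]
      exact mul_le_mul_of_nonneg_left (hgM _) ((b k).nonneg_normed t)
    rwa [integral_mul_const, (b k).integral_normed, one_mul] at h1
  have hGR : ∀ k x, R + 1 < ‖x‖ → G k x = 0 := by
    intro k x hx
    refine integral_eq_zero_of_ae (Eventually.of_forall fun t => ?_)
    by_cases ht : ‖t‖ < 1
    · have : g (x - t) = 0 := hgR _ (by linarith [norm_sub_norm_le x t])
      simp [this]
    · have : (b k).normed volume t = 0 := by
        have : t ∉ Function.support ((b k).normed volume) := by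
          rw [(b k).support_normed_eq]
          intro h
          rw [Metric.mem_ball, dist_zero_right] at h
          exact ht (h.trans_le (hb3 k))
        simpa using this
      simp [this]
  have hq : ∀ᵐ p : Space d × Space d ∂(volume.prod volume),
      Tendsto (fun k => G k (p.1 - p.2)) atTop (𝓝 (g (p.1 - p.2))) :=
    (quasiMeasurePreserving_sub (volume : Measure (Space d)) volume).ae hlim
  have hq1 : ∀ᵐ p : Space d × Space d ∂(volume.prod volume),
      Tendsto (fun k => G k p.1) atTop (𝓝 (g p.1)) :=
    Measure.quasiMeasurePreserving_fst.ae hlim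
  have hi := fun k => integrable_cov C (hGs k).continuous.measurable
    (hGs k).continuous.measurable (hGM k) (hGM k) (hGR k) (hGR k)
  have hT := tendsto_integral_of_dominated_convergence _ (fun k => (hi k).2.2.1) (hi 0).1
    (fun k => Eventually.of_forall (hi k).2.1)
    (by
      filter_upwards [hq, hq1] with p hp hp1
      exact (hp1.mul hp).mul_const (C.f p.2))
  exact ge_of_tendsto' hT fun k => covForm_nonneg_smooth C (hGs k) (hGM k) (hGR k)

theorem posSemidef_spaceCov {d : ℕ} (C : SpatialCovariance d) :
    Matrix.PosSemidef (Matrix.of fun a b : Brick d => spaceCov C a.set b.set) := by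
  let ind : Brick d → Space d → ℝ := fun a => a.set.indicator 1
  have hm : ∀ a, Measurable (ind a) := fun a => measurable_one.indicator a.measurableSet
  have hM : ∀ a x, |ind a x| ≤ 1 := by
    intro a x
    by_cases h : x ∈ a.set <;> simp [ind, h]
  have hR : ∀ a : Brick d, ∃ R : ℝ, ∀ x, R < ‖x‖ → ind a x = 0 := by
    intro a
    obtain ⟨R, hR⟩ := a.isBounded.exists_norm_le
    refine ⟨R, fun x hx => ?_⟩
    have : x ∉ a.set := fun h => by linarith [hR x h]
    simp [ind, this]
  choose R hR using hR
  have hi : ∀ a b, Integrable (fun p : Space d × Space d =>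
      ind a p.1 * ind b (p.1 - p.2) * C.f p.2) (volume.prod volume) := fun a b =>
    (integrable_cov C (M := 1) (R := max (R a) (R b)) (hm a) (hm b) (hM a) (hM b)
      (fun x hx => hR a x ((le_max_left _ _).trans_lt hx))
      (fun x hx => hR b x ((le_max_right _ _).trans_lt hx))).2.2
  have hQ : ∀ a b : Brick d, spaceCov C a.set b.set =
      ∫ p : Space d × Space d, ind a p.1 * ind b (p.1 - p.2) * C.f p.2 ∂(volume.prod volume) := by
    intro a b
    rw [integral_prod _ (hi a b), spaceCov, ← integral_indicator a.measurableSet]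
    refine integral_congr_ae (Eventually.of_forall fun x => ?_)
    simp only
    by_cases hx : x ∈ a.set
    · rw [Set.indicator_of_mem hx, ← integral_indicator b.measurableSet,
        ← integral_sub_left_eq_self _ volume x]
      refine integral_congr_ae (Eventually.of_forall fun y => ?_)
      by_cases hy : x - y ∈ b.set <;> simp [ind, hx, hy]
    · simp [ind, hx]
  have hsymm : ∀ a b : Brick d, spaceCov C a.set b.set = spaceCov C b.set a.set := by
    have hW : ∀ a b : Brick d, spaceCov C a.set b.set =
        ∫ z, C.f z * ∫ x, ind a x * ind b (x - z) := by
      intro a b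
      rw [hQ, integral_prod_symm _ (hi a b)]
      refine integral_congr_ae (Eventually.of_forall fun z => ?_)
      simp only
      rw [← integral_const_mul]
      congr 1; ext x; ring
    intro a b
    rw [hW a b, hW b a, ← integral_neg_eq_self]
    refine integral_congr_ae (C.even.mono fun z hz => ?_)
    simp only at hz ⊢
    rw [hz]
    congr 1
    rw [← integral_sub_right_eq_self _ z]
    refine integral_congr_ae (Eventually.of_forall fun x => ?_)
    simp [mul_comm]
  refine ⟨?_, fun c => ?_⟩
  · ext a b
    simp [hsymm a b]
  · have key : (c.sum fun i xi => c.sum fun j xj =>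
        star xi * (Matrix.of fun a b : Brick d => spaceCov C a.set b.set) i j * xj)
        = ∫ p : Space d × Space d, (∑ i ∈ c.support, c i * ind i p.1) *
          (∑ i ∈ c.support, c i * ind i (p.1 - p.2)) * C.f p.2 ∂(volume.prod volume) := by
      have hI : ∀ i j, Integrable (fun p : Space d × Space d =>
          c i * ind i p.1 * (c j * ind j (p.1 - p.2)) * C.f p.2) (volume.prod volume) :=
        fun i j => ((hi i j).const_mul (c i * c j)).congr
          (Eventually.of_forall fun p => by ring)
      simp only [Finsupp.sum, Finset.sum_mul_sum]
      simp only [Finset.sum_mul]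
      rw [integral_finsetSum _ fun i _ => integrable_finsetSum _ fun j _ => hI i j]
      refine Finset.sum_congr rfl fun i _ => ?_
      rw [integral_finsetSum _ fun j _ => hI i j]
      refine Finset.sum_congr rfl fun j _ => ?_
      simp only [Matrix.of_apply, star_trivial]
      rw [mul_right_comm, hQ, ← integral_const_mul]
      congr 1; ext z; ring
    rw [key]
    obtain ⟨S, hS⟩ : ∃ S : ℝ, ∀ i ∈ c.support, R i ≤ S := by
      obtain ⟨S, hS⟩ := (c.support.image R).bddAbove
      exact ⟨S, fun i hi => hS (by simpa using ⟨i, by simpa using hi, rfl⟩)⟩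
    refine covForm_nonneg C (g := fun x => ∑ i ∈ c.support, c i * ind i x)
      (M := ∑ i ∈ c.support, |c i|) (R := S) ?_ ?_ ?_
    · exact Finset.measurable_sum _ fun i _ => (hm i).const_mul _
    · intro x
      refine (Finset.abs_sum_le_sum_abs _ _).trans (Finset.sum_le_sum fun i _ => ?_)
      rw [abs_mul]
      exact mul_le_of_le_one_right (abs_nonneg _) (hM i x)
    · intro x hx
      refine Finset.sum_eq_zero fun i hi => ?_
      rw [hR i x ((hS i hi).trans_lt hx), mul_zero]

/-- The elements of `ℰ^{⊗n}`: finite real linear combinations of the functions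
`1_{[0,t₁] × A₁} ⊗ ⋯ ⊗ 1_{[0,tₙ] × Aₙ}`. -/
def ElemTensor {d : ℕ} (_H : Set.Ioo (1 / 2 : ℝ) 1) (_C : SpatialCovariance d) (n : ℕ) : Type :=
  (Fin n → Brick d) →₀ ℝ

section ElemTensor

variable {d : ℕ} (H : Set.Ioo (1 / 2 : ℝ) 1) (C : SpatialCovariance d) (n : ℕ)

instance : AddCommGroup (ElemTensor H C n) :=
  inferInstanceAs (AddCommGroup ((Fin n → Brick d) →₀ ℝ))

instance : Module ℝ (ElemTensor H C n) :=
  inferInstanceAs (Module ℝ ((Fin n → Brick d) →₀ ℝ))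

/-- The inner product of two elementary tensors,
`∏ᵢ ⟨1_{[0,tᵢ] × Aᵢ}, 1_{[0,sᵢ] × Bᵢ}⟩ = ∏ᵢ R_H(tᵢ,sᵢ) ∫_{Aᵢ} ∫_{Bᵢ} f(x-y) dx dy`. -/
def brickCov {d : ℕ} (H : ℝ) (C : SpatialCovariance d) {n : ℕ} (a b : Fin n → Brick d) : ℝ :=
  ∏ i, fbmCov H (a i).time (b i).time * spaceCov C (a i).set (b i).set

theorem posSemidef_brickCov :
    Matrix.PosSemidef (Matrix.of fun a b : Fin n → Brick d => brickCov (H : ℝ) C a b) := by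
  have h1 : Matrix.PosSemidef (Matrix.of fun a b : Brick d =>
      fbmCov H a.time b.time * spaceCov C a.set b.set) :=
    ((posSemidef_fbmCov H.2.1 H.2.2).submatrix Brick.time).hadamard (posSemidef_spaceCov C)
  have h2 : ∀ s : Finset (Fin n), Matrix.PosSemidef (Matrix.of fun a b : Fin n → Brick d =>
      ∏ i ∈ s, fbmCov H (a i).time (b i).time * spaceCov C (a i).set (b i).set) := by
    intro s
    induction s using Finset.induction_on with
    | empty =>
      refine ⟨by ext a b; simp, fun c => ?_⟩
      have : (c.sum fun i xi => c.sum fun j xj => star xi * (Matrix.of fun a b : Fin n → Brick d =>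
          ∏ i ∈ (∅ : Finset (Fin n)), fbmCov H (a i).time (b i).time *
            spaceCov C (a i).set (b i).set) i j * xj) = (∑ i ∈ c.support, c i) ^ 2 := by
        simp [Finsupp.sum, pow_two, Finset.sum_mul_sum]
      rw [this]
      positivity
    | insert i s hi ih =>
      have h3 := (h1.submatrix fun a : Fin n → Brick d => a i).hadamard ih
      have e : (Matrix.of fun a b : Fin n → Brick d =>
          ∏ i ∈ insert i s, fbmCov H (a i).time (b i).time * spaceCov C (a i).set (b i).set) =
          Matrix.hadamard (Matrix.submatrix (Matrix.of fun a b : Brick d =>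
            fbmCov H a.time b.time * spaceCov C a.set b.set) (fun a : Fin n → Brick d => a i)
            fun a => a i) (Matrix.of fun a b : Fin n → Brick d =>
          ∏ i ∈ s, fbmCov H (a i).time (b i).time * spaceCov C (a i).set (b i).set) := by
        ext a b
        simp [Finset.prod_insert hi, Matrix.hadamard]
      rw [e]
      exact h3
  exact h2 Finset.univ

/-- The (semi-definite) inner product of `ℰ^{⊗n}`, extended bilinearly from the elementary
tensors. -/
@[reducible]
def elemCore : PreInnerProductSpace.Core ℝ (ElemTensor H C n) where
  inner x y := Finsupp.sum (M := ℝ) x fun a r => Finsupp.sum (M := ℝ) y fun b s =>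
    r * s * brickCov (H : ℝ) C a b
  conj_inner_symm x y := by
    have hs : ∀ a b : Fin n → Brick d, brickCov (H : ℝ) C a b = brickCov (H : ℝ) C b a :=
      fun a b => (posSemidef_brickCov H C n).1.apply b a
    simp only [Finsupp.sum, conj_trivial]
    rw [Finset.sum_comm]
    refine Finset.sum_congr rfl fun a _ => Finset.sum_congr rfl fun b _ => ?_
    rw [hs a b]; ring
  re_inner_nonneg x := by
    have h := (posSemidef_brickCov H C n).2 x
    simp only [Finsupp.sum, Matrix.of_apply, star_trivial] at h
    simp only [Finsupp.sum, RCLike.re_to_real]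
    refine h.trans_eq (Finset.sum_congr rfl fun a _ => Finset.sum_congr rfl fun b _ => ?_)
    ring
  add_left x y z := by
    refine Finsupp.sum_add_index' (fun a => ?_) (fun a r s => ?_)
    · simp [Finsupp.sum]
    · simp only [Finsupp.sum, ← Finset.sum_add_distrib]
      refine Finset.sum_congr rfl fun b _ => ?_
      ring
  smul_left x y r := by
    refine (Finsupp.sum_smul_index' fun a => ?_).trans ?_
    · simp [Finsupp.sum]
    · simp only [Finsupp.sum, Finset.mul_sum, conj_trivial, smul_eq_mul, mul_assoc]

instance : SeminormedAddCommGroup (ElemTensor H C n) :=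
  @InnerProductSpace.Core.toSeminormedAddCommGroup ℝ (ElemTensor H C n) _ _ _ (elemCore H C n)

instance : InnerProductSpace ℝ (ElemTensor H C n) :=
  InnerProductSpace.ofCore (elemCore H C n)

/-- The elementary tensor `1_{[0,t₁] × A₁} ⊗ ⋯ ⊗ 1_{[0,tₙ] × Aₙ}`. -/
def elemSingle (a : Fin n → Brick d) : ElemTensor H C n := Finsupp.single a (1 : ℝ)

theorem inner_elemSingle (a b : Fin n → Brick d) :
    inner ℝ (elemSingle H C n a) (elemSingle H C n b)
      = ∏ i, fbmCov H (a i).time (b i).time * spaceCov C (a i).set (b i).set := by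
  show Finsupp.sum (M := ℝ) (Finsupp.single a 1) (fun a r => Finsupp.sum (M := ℝ)
    (Finsupp.single b 1) fun b s => r * s * brickCov (H : ℝ) C a b) = _
  rw [Finsupp.sum_single_index, Finsupp.sum_single_index] <;> simp [brickCov, Finsupp.sum]

/-- The Hilbert space `ℋ𝒫^{⊗n}`: the completion of `ℰ^{⊗n}` for its inner product (elements at
distance zero being identified). For `n = 1` this is `ℋ𝒫`. -/
abbrev HPTensor : Type := UniformSpace.Completion (ElemTensor H C n)

end ElemTensor

/-- `ℱ 1_A (ξ) = ∫_A e^{-i ξ·x} dx`. -/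
def indicatorFourier {d : ℕ} (A : Set (Space d)) (ξ : Space d) : ℂ :=
  ∫ x in A, Complex.exp (-((inner ℝ ξ x : ℝ) : ℂ) * Complex.I)

/-- The Fourier transform `ℱ ℓ(u₁,·,…,uₙ,·)(ξ₁,…,ξₙ)` in the space variables of `ℓ ∈ ℰ^{⊗n}`. -/
def ElemTensor.fourier {d n : ℕ} {H : Set.Ioo (1 / 2 : ℝ) 1} {C : SpatialCovariance d}
    (ℓ : ElemTensor H C n) (u : Fin n → ℝ) (ξ : Fin n → Space d) : ℂ :=
  Finsupp.sum (M := ℝ) ℓ fun a r => (r : ℂ) *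
    ∏ i, (Set.Icc (0 : ℝ) (a i).time).indicator (fun _ => 1) (u i) *
      indicatorFourier (a i).set (ξ i)

/-- The cube `Sⁿ`. -/
def timeCube (S : Set ℝ) (n : ℕ) : Set (Fin n → ℝ) := {t | ∀ i, t i ∈ S}

/-- `α_H^n ∫_{Sⁿ × Sⁿ} g(u) \overline{g(v)} ∏ᵢ |uᵢ-vᵢ|^{2H-2} du dv`, the squared norm of a function `g`
for the inner product `⟨g,h⟩ = α_H^n ∫∫ g(u) \overline{h(v)} ∏ᵢ |uᵢ-vᵢ|^{2H-2} du dv`. It takes the value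
`⊤` if the double integral does not converge absolutely. (The integral is a nonnegative real
number.) -/
def timeNormSq {n : ℕ} (H : ℝ) (S : Set ℝ) (g : (Fin n → ℝ) → ℂ) : ℝ≥0∞ :=
  open Classical in
  if IntegrableOn (fun p : (Fin n → ℝ) × (Fin n → ℝ) =>
      g p.1 * starRingEnd ℂ (g p.2) * ((∏ i, |p.1 i - p.2 i| ^ (2 * H - 2) : ℝ) : ℂ))
      (timeCube S n ×ˢ timeCube S n) then
    ENNReal.ofReal ((H * (2 * H - 1)) ^ n *
      (∫ p in timeCube S n ×ˢ timeCube S n,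
        g p.1 * starRingEnd ℂ (g p.2) * ((∏ i, |p.1 i - p.2 i| ^ (2 * H - 2) : ℝ) : ℂ)).re)
  else ⊤

/-- `ℰ_ℂ(0,T)^{⊗n}`: the complex linear combinations of the indicator functions of the boxes
`[0,t₁] × ⋯ × [0,tₙ]`, `tᵢ ∈ [0,T]`. -/
def stepTensor (T : ℝ) (n : ℕ) : Submodule ℂ ((Fin n → ℝ) → ℂ) :=
  Submodule.span ℂ {ψ | ∃ t : Fin n → ℝ, (∀ i, t i ∈ Set.Icc 0 T) ∧
    ψ = fun u => ∏ i, (Set.Icc 0 (t i)).indicator (fun _ => 1) (u i)}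

/-- The function `g` on `(0,T)ⁿ` belongs to `ℋ_ℂ(0,T)^{⊗n}`, the closure of `ℰ_ℂ(0,T)^{⊗n}` for the
above norm. -/
def MemHC {n : ℕ} (H T : ℝ) (g : (Fin n → ℝ) → ℂ) : Prop :=
  ∀ ε : ℝ≥0∞, 0 < ε → ∃ ψ ∈ stepTensor T n, timeNormSq H (Set.Ioo 0 T) (g - ψ) < ε

/-- `α_H^n ∫_{ℝ^{nd}} ∫_{Sⁿ × Sⁿ} g(u)(ξ) \overline{g(v)(ξ)} ∏ᵢ |uᵢ-vᵢ|^{2H-2} du dv μ(dξ₁) ⋯ μ(dξₙ)`. -/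
def energy {d n : ℕ} (H : ℝ) (C : SpatialCovariance d) (S : Set ℝ)
    (g : (Fin n → ℝ) → (Fin n → Space d) → ℂ) : ℝ≥0∞ :=
  ∫⁻ ξ, timeNormSq H S (fun u => g u ξ) ∂(Measure.pi fun _ => C.μ)

/-- `ℝ^{nd}` with its Euclidean structure. -/
abbrev PhaseSpace (n d : ℕ) : Type := PiLp 2 fun _ : Fin n => Space d

/-- The Fourier transform of the tempered distribution `ψ` is the (locally integrable) function `g`:
`(ℱ ψ, h) = (ψ, ℱ h) = ∫ g h` for all test functions `h ∈ C_0^∞(ℝ^{nd})`. -/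
def HasFourierFunction {n d : ℕ} (ψ : 𝓢'(PhaseSpace n d, ℂ)) (g : (Fin n → Space d) → ℂ) : Prop :=
  LocallyIntegrable (fun ξ : PhaseSpace n d => g (WithLp.ofLp ξ)) ∧
    ∀ h : 𝓢(PhaseSpace n d, ℂ), HasCompactSupport h →
      ψ (schwartzFourier h) = ∫ ξ : PhaseSpace n d, g (WithLp.ofLp ξ) * h ξ

/-- The map `t ↦ φ(t₁,·,…,tₙ,·) ∈ 𝒮'(ℝ^{nd})` on `(0,∞)ⁿ`, with Fourier transform `g`, is the element
`h` of `ℋ𝒫^{⊗n}`: there are `ℓ_k ∈ ℰ^{⊗n}` which converge both to `h` in `ℋ𝒫^{⊗n}` and to `φ` with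
respect to the norm given by the spectral form of the inner product. -/
structure RepresentsHP {d n : ℕ} {H : Set.Ioo (1 / 2 : ℝ) 1} {C : SpatialCovariance d}
    (φ : (Fin n → ℝ) → 𝓢'(PhaseSpace n d, ℂ)) (g : (Fin n → ℝ) → (Fin n → Space d) → ℂ)
    (h : HPTensor H C n) : Prop where
  fourier : ∀ t ∈ timeCube (Set.Ioi 0) n, HasFourierFunction (φ t) (g t)
  approx : ∃ ℓ : ℕ → ElemTensor H C n,
    Tendsto (fun k => (ℓ k : HPTensor H C n)) atTop (𝓝 h) ∧
    Tendsto (fun k => energy H C (Set.Ioi 0) fun u ξ => g u ξ - (ℓ k).fourier u ξ) atTop (𝓝 0)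

open Classical in
/-- Extension by zero of a map defined on `(0,T)ⁿ`. -/
def zeroExtend {n : ℕ} {α : Type*} [Zero α] (T : ℝ) (F : (Fin n → ℝ) → α) (t : Fin n → ℝ) : α :=
  if t ∈ timeCube (Set.Ioo 0 T) n then F t else 0

end

end FracNoise

/-! The norm on each side is turned into an `L²` norm, and the theorem becomes a density statement
in one concrete Hilbert space.

In time, put `β = 2 - 2H`. The measure of the set of windows `(y, y + r)` containing both `u` and
`v`, weighted by `r^(-β-2)`, is a constant multiple of `|u - v|^(-β)`. Hence `α_H |u - v|^(2H-2) = ∫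
k(u,z) k(v,z) dρ(z)` with `k ≥ 0` and `z = (r, y)`. Integrating a function of time against `k`
therefore turns the fractional norm into an `L²(ρ)` norm. Since `k` is nonnegative, absolute
convergence of the double integral is exactly what the interchanges of integrals need
(`KernelFactorization.integral_kernel`), and the structure passes to tensor powers. In space, `∫_A
∫_B f(x - y) dx dy = ∫ ℱ1_A conj(ℱ1_B) dμ` for bounded Borel sets (`indicatorFourier_isometry`), by
mollifying the indicators.

Together these embed `ℰ^{⊗n}` isometrically into the complex space `L²(ρ^n ⊗ μ^n)` by `spectralMap`.
A field with Fourier transform `G` is sent to `fieldTransform G`, whose squared norm is `I_T`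
(`energy_eq_lintegral`), and `I_∞` of a difference becomes a squared `L²` distance
(`energy_sub_fourier`). It remains to show that `fieldTransform G` lies in the closure of the image
of `ℰ^{⊗n}`.

Let `w` be orthogonal to all transforms of bricks. For a fixed box in time, the partial integral of
`w` over `z` is a function of `ξ` orthogonal to all `∏ ℱ1_{A_i}`, hence zero almost everywhere by
Fourier uniqueness (`ae_eq_zero_of_integral_indicatorFourier_mul`). Countably many boxes suffice, so
for almost every `ξ` the slice of `w` is orthogonal to every box. By condition (i) it is then
orthogonal to the transform of `G(·, ξ)` (`MemHC.absForm_lt_top`), and integrating over `ξ` gives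
the claim. This yields approximation by complex combinations. As `φ` is real and `μ` is even, taking
real parts of the coefficients does not increase the distance (`exists_norm_sub_spectralMap_le`).
Existence, uniqueness and the norm identity then follow from completeness and isometry. -/

namespace FracNoise

noncomputable section

/-! ### Quadratic forms of kernels that factorize through an `L²` space -/

/-- The kernel `K` on `U` factorizes through the nonnegative function `k` on `U × Z`:
`K (u, v) = ∫ k u z * k v z dρ(z)` for almost all `(u, v)`. -/
structure KernelFactorization {U Z : Type*} [MeasurableSpace U] [MeasurableSpace Z]
    (ν : Measure U) (ρ : Measure Z) (k : U → Z → ℝ) (K : U × U → ℝ) : Prop where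
  measurable_factor : Measurable (fun p : U × Z => k p.1 p.2)
  factor_nonneg : ∀ u z, 0 ≤ k u z
  measurable_kernel : Measurable K
  kernel_nonneg : ∀ p, 0 ≤ K p
  lintegral_factor : ∀ᵐ p ∂(ν.prod ν),
    ∫⁻ z, ENNReal.ofReal (k p.1 z) * ENNReal.ofReal (k p.2 z) ∂ρ = ENNReal.ofReal (K p)

/-- The integral transform with kernel `k`. -/
def kernelTransform {U Z : Type*} [MeasurableSpace U] (ν : Measure U) (k : U → Z → ℝ)
    (g : U → ℂ) (z : Z) : ℂ := ∫ u, g u * (k u z : ℂ) ∂ν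

/-- The quadratic form of the kernel `K` at the absolute value of `g`. -/
def absForm {U : Type*} [MeasurableSpace U] (ν : Measure U) (K : U × U → ℝ) (g : U → ℂ) : ℝ≥0∞ :=
  ∫⁻ p, ‖g p.1‖ₑ * ‖g p.2‖ₑ * ENNReal.ofReal (K p) ∂(ν.prod ν)

namespace KernelFactorization

set_option linter.unusedSectionVars false

variable {U Z : Type*} [MeasurableSpace U] [MeasurableSpace Z] {ν : Measure U} {ρ : Measure Z}
  [SFinite ν] [SFinite ρ] {k : U → Z → ℝ} {K : U × U → ℝ}

/-- Tonelli: expand the product of the two `u`-integrals, and integrate over `z` first. All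
integrands are nonnegative, so no finiteness is needed; the later integrability statements are
deduced from this identity. -/
theorem lintegral_mul_lintegral (hk : KernelFactorization ν ρ k K) {F F' : U → ℝ≥0∞}
    (hF : Measurable F) (hF' : Measurable F') :
    ∫⁻ z, (∫⁻ u, F u * ENNReal.ofReal (k u z) ∂ν) * (∫⁻ u, F' u * ENNReal.ofReal (k u z) ∂ν) ∂ρ
      = ∫⁻ p, F p.1 * F' p.2 * ENNReal.ofReal (K p) ∂(ν.prod ν) := by
  have hm := hk.measurable_factor
  have hmz : ∀ z, Measurable fun u => k u z := fun z => hm.comp measurable_prodMk_right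
  have hmu : ∀ u, Measurable (k u) := fun u => hm.comp measurable_prodMk_left
  calc _ = ∫⁻ z, (∫⁻ p, F p.1 * ENNReal.ofReal (k p.1 z) * (F' p.2 * ENNReal.ofReal (k p.2 z))
            ∂(ν.prod ν)) ∂ρ := by
        refine lintegral_congr fun z => ?_
        rw [lintegral_prod_mul (f := fun u => F u * ENNReal.ofReal (k u z))
          (g := fun u => F' u * ENNReal.ofReal (k u z))
          (hF.mul (hmz z).ennreal_ofReal).aemeasurable (hF'.mul (hmz z).ennreal_ofReal).aemeasurable]
    _ = ∫⁻ p, ∫⁻ z, F p.1 * ENNReal.ofReal (k p.1 z) * (F' p.2 * ENNReal.ofReal (k p.2 z)) ∂ρ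
            ∂(ν.prod ν) := by
        rw [lintegral_lintegral_swap]
        refine Measurable.aemeasurable ?_
        have h1 : Measurable fun q : Z × (U × U) => k q.2.1 q.1 :=
          hm.comp (by fun_prop : Measurable fun q : Z × (U × U) => (q.2.1, q.1))
        have h2 : Measurable fun q : Z × (U × U) => k q.2.2 q.1 :=
          hm.comp (by fun_prop : Measurable fun q : Z × (U × U) => (q.2.2, q.1))
        exact ((hF.comp (by fun_prop)).mul h1.ennreal_ofReal).mul
          ((hF'.comp (by fun_prop)).mul h2.ennreal_ofReal)
    _ = _ := by
        refine lintegral_congr_ae (hk.lintegral_factor.mono fun p hp => ?_)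
        simp only
        have h1 := hmu p.1
        have h2 := hmu p.2
        rw [← hp, ← lintegral_const_mul _ (by fun_prop)]
        refine lintegral_congr fun z => ?_
        ring

theorem measurable_lintegral (hk : KernelFactorization ν ρ k K) {F : U → ℝ≥0∞}
    (hF : Measurable F) : Measurable fun z => ∫⁻ u, F u * ENNReal.ofReal (k u z) ∂ν :=
  Measurable.lintegral_prod_left' (f := fun p : U × Z => F p.1 * ENNReal.ofReal (k p.1 p.2))
    ((hF.comp measurable_fst).mul hk.measurable_factor.ennreal_ofReal)

theorem absForm_eq (hk : KernelFactorization ν ρ k K) {g : U → ℂ} (hg : Measurable g) :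
    absForm ν K g = ∫⁻ z, (∫⁻ u, ‖g u‖ₑ * ENNReal.ofReal (k u z) ∂ν) ^ 2 ∂ρ := by
  simp only [pow_two]
  rw [hk.lintegral_mul_lintegral hg.enorm hg.enorm, absForm]

/-- By `absForm_eq` the absolute form of `g` is the squared `L²` norm of the transform of `|g|`, so
finiteness is stable under sums by the triangle inequality and `(a + b)² ≤ 2a² + 2b²`. -/
theorem absForm_add_lt_top (hk : KernelFactorization ν ρ k K) {g h : U → ℂ} (hg : Measurable g)
    (hh : Measurable h) (hg' : absForm ν K g < ⊤) (hh' : absForm ν K h < ⊤) :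
    absForm ν K (g + h) < ⊤ := by
  rw [hk.absForm_eq hg] at hg'
  rw [hk.absForm_eq hh] at hh'
  rw [hk.absForm_eq (hg.add hh)]
  refine lt_of_le_of_lt (lintegral_mono (g := fun z =>
    2 * (∫⁻ u, ‖g u‖ₑ * ENNReal.ofReal (k u z) ∂ν) ^ 2 +
    2 * (∫⁻ u, ‖h u‖ₑ * ENNReal.ofReal (k u z) ∂ν) ^ 2) fun z => ?_) ?_
  · have hmz : Measurable fun u => ENNReal.ofReal (k u z) :=
      (hk.measurable_factor.comp measurable_prodMk_right).ennreal_ofReal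
    have h1 : ∫⁻ u, ‖(g + h) u‖ₑ * ENNReal.ofReal (k u z) ∂ν ≤
        (∫⁻ u, ‖g u‖ₑ * ENNReal.ofReal (k u z) ∂ν) +
          ∫⁻ u, ‖h u‖ₑ * ENNReal.ofReal (k u z) ∂ν := by
      rw [← lintegral_add_left (by fun_prop)]
      refine lintegral_mono fun u => ?_
      rw [← add_mul]
      gcongr
      exact enorm_add_le _ _
    refine (pow_le_pow_left' h1 2).trans ?_
    have := ENNReal.rpow_add_le_mul_rpow_add_rpow (∫⁻ u, ‖g u‖ₑ * ENNReal.ofReal (k u z) ∂ν)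
      (∫⁻ u, ‖h u‖ₑ * ENNReal.ofReal (k u z) ∂ν) (p := 2) (by norm_num)
    norm_num at this
    rwa [mul_add] at this
  · rw [lintegral_add_left, lintegral_const_mul, lintegral_const_mul]
    · exact ENNReal.add_lt_top.2 ⟨ENNReal.mul_lt_top (by simp) hg', ENNReal.mul_lt_top (by simp) hh'⟩
    · exact (hk.measurable_lintegral hh.enorm).pow_const 2
    · exact (hk.measurable_lintegral hg.enorm).pow_const 2
    · exact ((hk.measurable_lintegral hg.enorm).pow_const 2).const_mul _

/-- A Bochner integral that diverges has the default value `0`, so `kernelTransform` is additive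
only where it converges. The exceptional set is null, since the squared transform of `|g|` has
finite integral. -/
theorem ae_integrable (hk : KernelFactorization ν ρ k K) {g : U → ℂ} (hg : Measurable g)
    (hg' : absForm ν K g < ⊤) : ∀ᵐ z ∂ρ, Integrable (fun u => g u * (k u z : ℂ)) ν := by
  rw [hk.absForm_eq hg] at hg'
  filter_upwards [ae_lt_top ((hk.measurable_lintegral hg.enorm).pow_const 2) hg'.ne] with z hz
  have hmz : Measurable fun u => k u z := hk.measurable_factor.comp measurable_prodMk_right
  refine ⟨(hg.mul (Complex.measurable_ofReal.comp hmz)).aestronglyMeasurable, ?_⟩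
  have := (ENNReal.pow_lt_top_iff.1 hz).resolve_right (by norm_num)
  refine lt_of_le_of_lt (le_of_eq (lintegral_congr fun u => ?_)) this
  rw [enorm_mul]
  congr 1
  rw [← ofReal_norm, Complex.norm_real, Real.norm_of_nonneg (hk.factor_nonneg u z)]

theorem stronglyMeasurable_kernelTransform (hk : KernelFactorization ν ρ k K) {g : U → ℂ}
    (hg : Measurable g) : StronglyMeasurable (kernelTransform ν k g) := by
  refine StronglyMeasurable.integral_prod_left' (f := fun p : U × Z => g p.1 * (k p.1 p.2 : ℂ)) ?_
  exact ((hg.comp measurable_fst).mul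
    (Complex.measurable_ofReal.comp hk.measurable_factor)).stronglyMeasurable

theorem enorm_kernelTransform_le (hk : KernelFactorization ν ρ k K) (g : U → ℂ) (z : Z) :
    ‖kernelTransform ν k g z‖ₑ ≤ ∫⁻ u, ‖g u‖ₑ * ENNReal.ofReal (k u z) ∂ν := by
  refine (enorm_integral_le_lintegral_enorm _).trans (le_of_eq (lintegral_congr fun u => ?_))
  rw [enorm_mul]
  congr 1
  rw [← ofReal_norm, Complex.norm_real, Real.norm_of_nonneg (hk.factor_nonneg u z)]

theorem memLp_kernelTransform (hk : KernelFactorization ν ρ k K) {g : U → ℂ} (hg : Measurable g)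
    (hg' : absForm ν K g < ⊤) : MemLp (kernelTransform ν k g) 2 ρ := by
  refine ⟨(hk.stronglyMeasurable_kernelTransform hg).aestronglyMeasurable, ?_⟩
  rw [eLpNorm_lt_top_iff_lintegral_rpow_enorm_lt_top (by norm_num) (by norm_num)]
  rw [hk.absForm_eq hg] at hg'
  refine lt_of_le_of_lt (lintegral_mono fun z => ?_) hg'
  norm_num
  gcongr
  exact hk.enorm_kernelTransform_le g z

/-- Fubini for `g(u) k(u,z) conj(h(v) k(v,z))` on `(u, v, z)`. The integral of its absolute value is
the mixed absolute form of `g` and `h`, because `k ≥ 0`: no cancellation in `k` is lost by taking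
absolute values. -/
theorem integral_kernel (hk : KernelFactorization ν ρ k K) {g h : U → ℂ} (hg : Measurable g)
    (hh : Measurable h) (hg' : absForm ν K g < ⊤) (hh' : absForm ν K h < ⊤) :
    Integrable (fun p : U × U => g p.1 * starRingEnd ℂ (h p.2) * (K p : ℂ)) (ν.prod ν) ∧
    ∫ p, g p.1 * starRingEnd ℂ (h p.2) * (K p : ℂ) ∂(ν.prod ν) =
      ∫ z, kernelTransform ν k g z * starRingEnd ℂ (kernelTransform ν k h z) ∂ρ := by
  have hm := hk.measurable_factor
  have hmz : ∀ z, Measurable fun u => k u z := fun z => hm.comp measurable_prodMk_right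
  have hmu : ∀ u, Measurable (k u) := fun u => hm.comp measurable_prodMk_left
  have hcj : Measurable (starRingEnd ℂ) := Complex.continuous_conj.measurable
  have hfin : ∫⁻ p, ‖g p.1‖ₑ * ‖h p.2‖ₑ * ENNReal.ofReal (K p) ∂(ν.prod ν) < ⊤ := by
    rw [← hk.lintegral_mul_lintegral hg.enorm hh.enorm]
    rw [hk.absForm_eq hg] at hg'
    rw [hk.absForm_eq hh] at hh'
    -- The mixed form is controlled by the two diagonal forms through `a b ≤ a² + b²`.
    refine lt_of_le_of_lt (lintegral_mono (g := fun z =>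
      (∫⁻ u, ‖g u‖ₑ * ENNReal.ofReal (k u z) ∂ν) ^ 2 +
      (∫⁻ u, ‖h u‖ₑ * ENNReal.ofReal (k u z) ∂ν) ^ 2) fun z => ?_) ?_
    · simp only
      rcases le_total (∫⁻ u, ‖g u‖ₑ * ENNReal.ofReal (k u z) ∂ν)
        (∫⁻ u, ‖h u‖ₑ * ENNReal.ofReal (k u z) ∂ν) with hl | hl
      · refine le_trans ?_ le_add_self
        rw [pow_two]; gcongr
      · refine le_trans ?_ le_self_add
        rw [pow_two]; gcongr
    · rw [lintegral_add_left ((hk.measurable_lintegral hg.enorm).pow_const 2)]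
      exact ENNReal.add_lt_top.2 ⟨hg', hh'⟩
  have hen : ∀ x : ℝ, 0 ≤ x → ‖(x : ℂ)‖ₑ = ENNReal.ofReal x := fun x hx => by
    rw [← ofReal_norm, Complex.norm_real, Real.norm_of_nonneg hx]
  refine ⟨⟨?_, ?_⟩, ?_⟩
  · exact (((hg.comp measurable_fst).mul (hcj.comp (hh.comp measurable_snd))).mul
      (Complex.measurable_ofReal.comp hk.measurable_kernel)).aestronglyMeasurable
  · refine lt_of_le_of_lt (le_of_eq (lintegral_congr fun p => ?_)) hfin
    rw [enorm_mul, enorm_mul, RCLike.enorm_conj, hen _ (hk.kernel_nonneg p)]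
  · have h1 : Measurable fun q : (U × U) × Z => k q.1.1 q.2 :=
      hm.comp (by fun_prop : Measurable fun q : (U × U) × Z => (q.1.1, q.2))
    have h2 : Measurable fun q : (U × U) × Z => k q.1.2 q.2 :=
      hm.comp (by fun_prop : Measurable fun q : (U × U) × Z => (q.1.2, q.2))
    let Q : (U × U) → Z → ℂ := fun p z =>
      g p.1 * (k p.1 z : ℂ) * starRingEnd ℂ (h p.2 * (k p.2 z : ℂ))
    have hQm : Measurable (Function.uncurry Q) :=
      ((hg.comp (by fun_prop)).mul (Complex.measurable_ofReal.comp h1)).mul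
        (hcj.comp ((hh.comp (by fun_prop)).mul (Complex.measurable_ofReal.comp h2)))
    have hQe : ∀ p z, ‖Q p z‖ₑ = ‖g p.1‖ₑ * ‖h p.2‖ₑ *
        (ENNReal.ofReal (k p.1 z) * ENNReal.ofReal (k p.2 z)) := by
      intro p z
      simp only [Q, enorm_mul, RCLike.enorm_conj, hen _ (hk.factor_nonneg _ _)]
      ring
    have hQi : Integrable (Function.uncurry Q) ((ν.prod ν).prod ρ) := by
      refine ⟨hQm.aestronglyMeasurable, ?_⟩
      rw [HasFiniteIntegral, lintegral_prod _ hQm.enorm.aemeasurable]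
      refine lt_of_le_of_lt (le_of_eq (lintegral_congr_ae
        (hk.lintegral_factor.mono fun p hp => ?_))) hfin
      simp only [Function.uncurry_apply_pair, hQe]
      have h3 := hmu p.1
      have h4 := hmu p.2
      rw [lintegral_const_mul _ (by fun_prop), hp]
    calc _ = ∫ p, ∫ z, Q p z ∂ρ ∂(ν.prod ν) := by
          refine integral_congr_ae (hk.lintegral_factor.mono fun p hp => ?_)
          have e1 : ∀ z, Q p z = g p.1 * starRingEnd ℂ (h p.2) * ((k p.1 z * k p.2 z : ℝ) : ℂ) := by
            intro z
            simp only [Q, map_mul, Complex.conj_ofReal, Complex.ofReal_mul]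
            ring
          simp only [e1]
          rw [integral_const_mul, integral_complex_ofReal]
          congr 2
          rw [integral_eq_lintegral_of_nonneg_ae (Eventually.of_forall fun z =>
            mul_nonneg (hk.factor_nonneg _ _) (hk.factor_nonneg _ _))
            ((hmu _).mul (hmu _)).aestronglyMeasurable]
          simp only [ENNReal.ofReal_mul (hk.factor_nonneg _ _)]
          rw [hp, ENNReal.toReal_ofReal (hk.kernel_nonneg p)]
      _ = ∫ z, ∫ p, Q p z ∂(ν.prod ν) ∂ρ := integral_integral_swap hQi
      _ = _ := by
          refine integral_congr_ae (Eventually.of_forall fun z => ?_)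
          simp only [Q, kernelTransform]
          rw [integral_prod_mul (fun u => g u * (k u z : ℂ))
            (fun u => starRingEnd ℂ (h u * (k u z : ℂ))), integral_conj]

theorem integrable_iff_absForm_lt_top (hk : KernelFactorization ν ρ k K) {g : U → ℂ}
    (hg : Measurable g) :
    Integrable (fun p : U × U => g p.1 * starRingEnd ℂ (g p.2) * (K p : ℂ)) (ν.prod ν) ↔
      absForm ν K g < ⊤ := by
  refine ⟨fun h => ?_, fun h => (hk.integral_kernel hg hg h h).1⟩
  refine lt_of_le_of_lt (le_of_eq (lintegral_congr fun p => ?_)) h.2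
  rw [enorm_mul, enorm_mul, RCLike.enorm_conj, ← ofReal_norm (K p : ℂ), Complex.norm_real,
    Real.norm_of_nonneg (hk.kernel_nonneg p)]

/-- The double integral equals `∫ ‖transform‖²`, hence is real and nonnegative; taking the real part
and then `ENNReal.ofReal` discards nothing. -/
theorem lintegral_enorm_kernelTransform (hk : KernelFactorization ν ρ k K) {g : U → ℂ}
    (hg : Measurable g) (hg' : absForm ν K g < ⊤) :
    ∫⁻ z, ‖kernelTransform ν k g z‖ₑ ^ 2 ∂ρ =
      ENNReal.ofReal (∫ p, g p.1 * starRingEnd ℂ (g p.2) * (K p : ℂ) ∂(ν.prod ν)).re := by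
  have hmem := hk.memLp_kernelTransform hg hg'
  rw [(hk.integral_kernel hg hg hg' hg').2]
  have e : ∀ z, kernelTransform ν k g z * starRingEnd ℂ (kernelTransform ν k g z) =
      ((‖kernelTransform ν k g z‖ ^ 2 : ℝ) : ℂ) := fun z => by
    rw [Complex.mul_conj, Complex.normSq_eq_norm_sq]
  simp only [e]
  rw [integral_complex_ofReal, Complex.ofReal_re,
    ofReal_integral_eq_lintegral_ofReal ((memLp_two_iff_integrable_sq_norm hmem.1).1 hmem)
      (Eventually.of_forall fun z => by positivity)]
  refine lintegral_congr fun z => ?_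
  rw [ENNReal.ofReal_pow (norm_nonneg _), ofReal_norm]

end KernelFactorization

/-! ### Linearity and tensor powers of factorized kernels -/

section Generic

variable {U Z : Type*} [MeasurableSpace U] [MeasurableSpace Z] {ν : Measure U} {ρ : Measure Z}
  [SigmaFinite ν] [SigmaFinite ρ] {k : U → Z → ℝ} {K : U × U → ℝ}

theorem absForm_congr {g h : U → ℂ} (hgh : g =ᵐ[ν] h) : absForm ν K g = absForm ν K h := by
  refine lintegral_congr_ae ?_
  filter_upwards [Measure.quasiMeasurePreserving_fst.ae hgh,
    Measure.quasiMeasurePreserving_snd.ae hgh] with p h1 h2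
  rw [h1, h2]

theorem kernelTransform_congr {g h : U → ℂ} (hgh : g =ᵐ[ν] h) :
    kernelTransform ν k g = kernelTransform ν k h := by
  ext z
  refine integral_congr_ae (hgh.mono fun u hu => ?_)
  simp only [hu]

theorem absForm_const_smul (c : ℂ) (g : U → ℂ) :
    absForm ν K (c • g) = ‖c‖ₑ ^ 2 * absForm ν K g := by
  unfold absForm
  rw [← lintegral_const_mul' _ _ (by finiteness)]
  refine lintegral_congr fun p => ?_
  simp only [Pi.smul_apply, enorm_smul]
  ring

theorem kernelTransform_const_smul (c : ℂ) (g : U → ℂ) :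
    kernelTransform ν k (c • g) = c • kernelTransform ν k g := by
  ext z
  simp only [kernelTransform, Pi.smul_apply, smul_eq_mul]
  rw [← integral_const_mul]
  congr 1; ext u; ring

theorem KernelFactorization.kernelTransform_add (hk : KernelFactorization ν ρ k K) {g h : U → ℂ}
    (hg : Measurable g) (hh : Measurable h) (hg' : absForm ν K g < ⊤) (hh' : absForm ν K h < ⊤) :
    kernelTransform ν k (g + h) =ᵐ[ρ] kernelTransform ν k g + kernelTransform ν k h := by
  filter_upwards [hk.ae_integrable hg hg', hk.ae_integrable hh hh'] with z h1 h2
  simp only [kernelTransform, Pi.add_apply, add_mul]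
  exact integral_add h1 h2

theorem KernelFactorization.kernelTransform_sub (hk : KernelFactorization ν ρ k K) {g h : U → ℂ}
    (hg : Measurable g) (hh : Measurable h) (hg' : absForm ν K g < ⊤) (hh' : absForm ν K h < ⊤) :
    kernelTransform ν k (g - h) =ᵐ[ρ] kernelTransform ν k g - kernelTransform ν k h := by
  filter_upwards [hk.ae_integrable hg hg', hk.ae_integrable hh hh'] with z h1 h2
  simp only [kernelTransform, Pi.sub_apply, sub_mul]
  exact integral_sub h1 h2

theorem KernelFactorization.absForm_sub_lt_top (hk : KernelFactorization ν ρ k K) {g h : U → ℂ}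
    (hg : Measurable g) (hh : Measurable h) (hg' : absForm ν K g < ⊤) (hh' : absForm ν K h < ⊤) :
    absForm ν K (g - h) < ⊤ := by
  have e : g - h = g + (-1 : ℂ) • h := by ext u; simp [sub_eq_add_neg]
  rw [e]
  refine hk.absForm_add_lt_top hg (hh.const_smul _) hg' ?_
  rw [absForm_const_smul]
  simpa using hh'

/-- The `n`-fold tensor power of a factorized kernel. -/
theorem KernelFactorization.pi (hk : KernelFactorization ν ρ k K) (n : ℕ) :
    KernelFactorization (Measure.pi fun _ : Fin n => ν) (Measure.pi fun _ : Fin n => ρ)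
      (fun u z => ∏ i, k (u i) (z i)) (fun p => ∏ i, K (p.1 i, p.2 i)) where
  measurable_factor := by
    refine Finset.measurable_prod _ fun i _ => ?_
    exact hk.measurable_factor.comp
      (by fun_prop : Measurable fun p : (Fin n → U) × (Fin n → Z) => (p.1 i, p.2 i))
  factor_nonneg u z := Finset.prod_nonneg fun i _ => hk.factor_nonneg _ _
  measurable_kernel := by
    refine Finset.measurable_prod _ fun i _ => ?_
    exact hk.measurable_kernel.comp
      (by fun_prop : Measurable fun p : (Fin n → U) × (Fin n → U) => (p.1 i, p.2 i))
  kernel_nonneg p := Finset.prod_nonneg fun i _ => hk.kernel_nonneg _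
  lintegral_factor := by
    -- The one-dimensional identity fails at most on a null set of pairs. The preimage of that set
    -- under the `i`-th coordinate pair is again null, since evaluations are
    -- quasi-measure-preserving.
    have hq : ∀ i : Fin n, ∀ᵐ p ∂((Measure.pi fun _ : Fin n => ν).prod (Measure.pi fun _ => ν)),
        ∫⁻ z, ENNReal.ofReal (k (p.1 i) z) * ENNReal.ofReal (k (p.2 i) z) ∂ρ
          = ENNReal.ofReal (K (p.1 i, p.2 i)) := fun i =>
      (MeasureTheory.QuasiMeasurePreserving.prodMap (Measure.quasiMeasurePreserving_eval (fun _ : Fin n => ν) i)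
        (Measure.quasiMeasurePreserving_eval (fun _ : Fin n => ν) i)).ae hk.lintegral_factor
    filter_upwards [ae_all_iff.2 hq] with p hp
    have hmu : ∀ u, Measurable (k u) := fun u => hk.measurable_factor.comp measurable_prodMk_left
    have h0 : ∀ i z, 0 ≤ k (p.1 i) z * k (p.2 i) z := fun i z =>
      mul_nonneg (hk.factor_nonneg _ _) (hk.factor_nonneg _ _)
    have hp' : ∀ i, ∫⁻ z, ENNReal.ofReal (k (p.1 i) z * k (p.2 i) z) ∂ρ
        = ENNReal.ofReal (K (p.1 i, p.2 i)) := fun i => by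
      rw [← hp i]
      exact lintegral_congr fun z => ENNReal.ofReal_mul (hk.factor_nonneg _ _)
    -- The integral over `z` is finite because `K` is real-valued. This permits passing to Bochner
    -- integrals, where the product formula over coordinates is applied.
    have hi : ∀ i, Integrable (fun z => k (p.1 i) z * k (p.2 i) z) ρ := fun i => by
      refine ⟨((hmu _).mul (hmu _)).aestronglyMeasurable, ?_⟩
      rw [hasFiniteIntegral_iff_ofReal (Eventually.of_forall (h0 i)), hp' i]
      exact ENNReal.ofReal_lt_top
    have hI : ∀ i, ∫ z, k (p.1 i) z * k (p.2 i) z ∂ρ = K (p.1 i, p.2 i) := fun i => by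
      rw [integral_eq_lintegral_of_nonneg_ae (Eventually.of_forall (h0 i)) (hi i).1, hp' i,
        ENNReal.toReal_ofReal (hk.kernel_nonneg _)]
    have hprod := Integrable.fintype_prod (μ := fun _ : Fin n => ρ) hi
    calc _ = ∫⁻ z, ENNReal.ofReal (∏ i, k (p.1 i) (z i) * k (p.2 i) (z i))
            ∂(Measure.pi fun _ : Fin n => ρ) := by
          refine lintegral_congr fun z => ?_
          rw [← ENNReal.ofReal_mul (Finset.prod_nonneg fun i _ => hk.factor_nonneg _ _),
            Finset.prod_mul_distrib]
      _ = _ := by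
          rw [← ofReal_integral_eq_lintegral_ofReal hprod
            (Eventually.of_forall fun z => Finset.prod_nonneg fun i _ => h0 i (z i)),
            integral_fintype_prod_eq_prod (fun i z => k (p.1 i) z * k (p.2 i) z)]
          simp only [hI]

end Generic

/-! ### The window factorization of the fractional kernel -/

/-- The measure on the parameters `(r, y)` of the windows `(y, y + r)`. -/
def windowMeasure : Measure (ℝ × ℝ) := (volume.restrict (Set.Ioi (0 : ℝ))).prod volume

instance : SigmaFinite windowMeasure := by unfold windowMeasure; infer_instance

/-- The normalized window function. -/
def wt (H u : ℝ) (z : ℝ × ℝ) : ℝ :=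
  √(H * (2 * H - 1) * ((2 - 2 * H) * (2 - 2 * H + 1))) * (win (2 - 2 * H) u z).toReal

/-- The kernel `α_H |u - v|^{2H-2}`. -/
def fracKernel (H : ℝ) (p : ℝ × ℝ) : ℝ := H * (2 * H - 1) * |p.1 - p.2| ^ (2 * H - 2)

theorem win_ne_top (β u : ℝ) (z : ℝ × ℝ) : win β u z ≠ ⊤ := by
  unfold win; split_ifs <;> simp

theorem kernelFactorization_wt (H : Set.Ioo (1 / 2 : ℝ) 1) :
    KernelFactorization volume windowMeasure (wt H) (fracKernel H) where
  measurable_factor := ((measurable_win _).ennreal_toReal).const_mul _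
  factor_nonneg u z := by unfold wt; positivity
  measurable_kernel := by unfold fracKernel; fun_prop
  kernel_nonneg p := by
    have := H.2.1
    have : (0 : ℝ) < 2 * H - 1 := by linarith
    have : (0 : ℝ) < H := by linarith
    unfold fracKernel; positivity
  lintegral_factor := by
    have h1 := H.2.1
    have h2 := H.2.2
    have hβ : (0 : ℝ) < 2 - 2 * H := by linarith
    have h3 : (0 : ℝ) < 2 * H - 1 := by linarith
    have h4 : (0 : ℝ) < H := by linarith
    -- The window formula needs `u ≠ v`; the diagonal is a null set.
    have hne : ∀ᵐ p : ℝ × ℝ ∂(volume.prod volume), p.1 ≠ p.2 := by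
      refine (Measure.ae_prod_iff_ae_ae (p := fun p : ℝ × ℝ => p.1 ≠ p.2)
        (measurableSet_eq_fun measurable_fst measurable_snd).compl).2 ?_
      refine Eventually.of_forall fun u => ?_
      have : ∀ᵐ v : ℝ, v ≠ u := by simp [ae_iff]
      exact this.mono fun v hv => hv.symm
    refine hne.mono fun p hp => ?_
    have hw := lintegral_win hβ hp
    -- `lintegral_win` produces the constant `1 / (β (β + 1))` with `β = 2 - 2H`. Multiplying by `c
    -- = α_H β (β + 1)`, split as `√c` in each factor, leaves exactly `α_H`.
    set c : ℝ := H * (2 * H - 1) * ((2 - 2 * H) * (2 - 2 * H + 1)) with hc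
    have hc0 : 0 ≤ c := by positivity
    have e : ∀ u z, ENNReal.ofReal (wt H u z) = ENNReal.ofReal (√c) * win (2 - 2 * H) u z :=
      fun u z => by
        rw [wt, ENNReal.ofReal_mul (Real.sqrt_nonneg _), ENNReal.ofReal_toReal (win_ne_top _ _ _)]
    have hm : ∀ u, Measurable (win (2 - 2 * (H : ℝ)) u) := fun u =>
      (measurable_win _).comp (measurable_prodMk_left (x := u))
    simp only [e]
    calc _ = ∫⁻ z, ENNReal.ofReal c * (win (2 - 2 * H) p.1 z * win (2 - 2 * H) p.2 z)
          ∂windowMeasure := by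
          refine lintegral_congr fun z => ?_
          rw [mul_mul_mul_comm, ← ENNReal.ofReal_mul (Real.sqrt_nonneg _), Real.mul_self_sqrt hc0]
      _ = _ := by
          have hm1 := hm p.1
          have hm2 := hm p.2
          rw [lintegral_const_mul _ (by fun_prop), windowMeasure, hw,
            ← ENNReal.ofReal_mul (by positivity), ← ENNReal.ofReal_mul (by positivity), fracKernel]
          congr 1
          have : -(2 - 2 * (H : ℝ)) = 2 * H - 2 := by ring
          rw [this, hc]
          have : (2 - 2 * (H : ℝ)) ≠ 0 := hβ.ne'
          have : (2 - 2 * (H : ℝ) + 1) ≠ 0 := by linarith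
          field_simp

theorem integrable_wt (H : ℝ) (z : ℝ × ℝ) : Integrable (fun u => wt H u z) := by
  set c : ℝ := √(H * (2 * H - 1) * ((2 - 2 * H) * (2 - 2 * H + 1))) *
    (ENNReal.ofReal (z.1 ^ (-(2 - 2 * H) / 2 - 1))).toReal
  have : (fun u => wt H u z) = (Set.Ioo z.2 (z.2 + z.1)).indicator fun _ => c := by
    ext u
    by_cases h : z.2 < u ∧ u < z.2 + z.1
    · rw [Set.indicator_of_mem (by exact h)]
      simp [wt, win, h, c]
    · rw [Set.indicator_of_notMem (by exact h)]
      simp [wt, win, h]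
  rw [this, integrable_indicator_iff measurableSet_Ioo]
  exact integrableOn_const (by simp)

/-- The transform `∫_0^t wt H u z du` of the indicator function of `[0,t]`. -/
def wtPrim (H t : ℝ) (z : ℝ × ℝ) : ℝ := ∫ u in Set.Icc 0 t, wt H u z

theorem wt_nonneg (H u : ℝ) (z : ℝ × ℝ) : 0 ≤ wt H u z := by unfold wt; positivity

theorem wtPrim_nonneg (H t : ℝ) (z : ℝ × ℝ) : 0 ≤ wtPrim H t z :=
  integral_nonneg fun u => wt_nonneg H u z

/-- The indicator function of `[0,t]`, with complex values. -/
def boxInd (t u : ℝ) : ℂ := (Set.Icc 0 t).indicator (fun _ => 1) u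

theorem measurable_boxInd (t : ℝ) : Measurable (boxInd t) :=
  measurable_const.indicator measurableSet_Icc

theorem conj_boxInd (t u : ℝ) : starRingEnd ℂ (boxInd t u) = boxInd t u := by
  unfold boxInd; by_cases h : u ∈ Set.Icc 0 t <;> simp [h]

theorem kernelTransform_boxInd (H t : ℝ) (z : ℝ × ℝ) :
    kernelTransform volume (wt H) (boxInd t) z = wtPrim H t z := by
  rw [kernelTransform, wtPrim, ← integral_complex_ofReal, ← integral_indicator measurableSet_Icc]
  congr 1; ext u
  by_cases h : u ∈ Set.Icc 0 t <;> simp [boxInd, h]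

theorem absForm_boxInd_lt_top (H : Set.Ioo (1 / 2 : ℝ) 1) (t : ℝ≥0) :
    absForm volume (fracKernel H) (boxInd t) < ⊤ := by
  have h1 := H.2.1
  have h2 := H.2.2
  have h4 : (0 : ℝ) < H := by linarith
  have h3 : (0 : ℝ) < 2 * H - 1 := by linarith
  -- Dropping the endpoint `0` matches the half-open intervals of `lintegral_pow_bound`, whose bound
  -- is uniform in `u ∈ [0,t]` because `|·|^(-β)` is locally integrable for `β < 1`.
  have hne : boxInd t =ᵐ[volume] (Set.Ioc 0 (t : ℝ)).indicator fun _ => 1 :=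
    indicator_ae_eq_of_ae_eq_set Ioc_ae_eq_Icc.symm
  rw [absForm_congr hne]
  obtain ⟨M, hM, hb⟩ := lintegral_pow_bound (β := 2 - 2 * H) (by linarith) t t t.2 t.2
  set α : ℝ := H * (2 * H - 1) with hα
  have hα0 : 0 ≤ α := by positivity
  have hmK : Measurable (fracKernel H) := by unfold fracKernel; fun_prop
  have hmi : Measurable ((Set.Ioc 0 (t : ℝ)).indicator fun _ => (1 : ℂ)) :=
    measurable_const.indicator measurableSet_Ioc
  rw [absForm, lintegral_prod _ (by fun_prop)]
  have hle : ∀ u, ∫⁻ v, ‖(Set.Ioc 0 (t : ℝ)).indicator (fun _ => (1 : ℂ)) u‖ₑ *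
      ‖(Set.Ioc 0 (t : ℝ)).indicator (fun _ => (1 : ℂ)) v‖ₑ * ENNReal.ofReal (fracKernel H (u, v))
      ≤ (Set.Ioc 0 (t : ℝ)).indicator (fun _ => ENNReal.ofReal α * M) u := by
    intro u
    by_cases hu : u ∈ Set.Ioc 0 (t : ℝ)
    · rw [Set.indicator_of_mem hu, Set.indicator_of_mem hu]
      have e : ∀ v, ‖(1 : ℂ)‖ₑ * ‖(Set.Ioc 0 (t : ℝ)).indicator (fun _ => (1 : ℂ)) v‖ₑ *
          ENNReal.ofReal (fracKernel H (u, v)) = ENNReal.ofReal α * (Set.Ioc 0 (t : ℝ)).indicator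
            (fun v => ENNReal.ofReal (|u - v| ^ (-(2 - 2 * (H : ℝ))))) v := by
        intro v
        have : -(2 - 2 * (H : ℝ)) = 2 * H - 2 := by ring
        by_cases hv : v ∈ Set.Ioc 0 (t : ℝ)
        · rw [Set.indicator_of_mem hv, Set.indicator_of_mem hv, fracKernel, this,
            ENNReal.ofReal_mul hα0]
          simp
        · simp [Set.indicator_of_notMem hv]
      simp only [e]
      rw [lintegral_const_mul' _ _ ENNReal.ofReal_ne_top, lintegral_indicator measurableSet_Ioc]
      gcongr
      exact hb u hu.1.le hu.2
    · simp [hu]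
  refine (lintegral_mono hle).trans_lt ?_
  rw [lintegral_indicator measurableSet_Ioc, setLIntegral_const]
  exact ENNReal.mul_lt_top (ENNReal.mul_lt_top ENNReal.ofReal_lt_top hM.lt_top) (by simp)

theorem memLp_wtPrim (H : Set.Ioo (1 / 2 : ℝ) 1) (t : ℝ≥0) :
    MemLp (fun z => (wtPrim H t z : ℂ)) 2 windowMeasure := by
  have := (kernelFactorization_wt H).memLp_kernelTransform (measurable_boxInd t)
    (absForm_boxInd_lt_top H t)
  simpa only [funext (kernelTransform_boxInd (H : ℝ) t)] using this

/-- The time half of the spectral isometry: polarized factorization applied to the indicators of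
`[0,t]` and `[0,s]`. -/
theorem integral_wtPrim_mul (H : Set.Ioo (1 / 2 : ℝ) 1) (t s : ℝ≥0) :
    ∫ z, wtPrim H t z * wtPrim H s z ∂windowMeasure = fbmCov H t s := by
  obtain ⟨hi, he⟩ := (kernelFactorization_wt H).integral_kernel (measurable_boxInd t)
    (measurable_boxInd s) (absForm_boxInd_lt_top H t) (absForm_boxInd_lt_top H s)
  simp only [kernelTransform_boxInd, Complex.conj_ofReal, ← Complex.ofReal_mul] at he
  rw [integral_complex_ofReal] at he
  apply Complex.ofReal_injective
  rw [← he, integral_prod _ hi, fbmCov, intervalIntegral.integral_of_le t.coe_nonneg,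
    ← integral_Icc_eq_integral_Ioc, ← integral_const_mul, ← integral_indicator measurableSet_Icc,
    ← integral_complex_ofReal]
  refine integral_congr_ae (Eventually.of_forall fun u => ?_)
  simp only [conj_boxInd]
  by_cases hu : u ∈ Set.Icc 0 (t : ℝ)
  · rw [Set.indicator_of_mem hu, intervalIntegral.integral_of_le s.coe_nonneg,
      ← integral_Icc_eq_integral_Ioc, ← integral_const_mul, ← integral_indicator measurableSet_Icc,
      ← integral_complex_ofReal]
    refine integral_congr_ae (Eventually.of_forall fun v => ?_)
    by_cases hv : v ∈ Set.Icc 0 (s : ℝ) <;> simp [boxInd, hu, hv, fracKernel]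
  · simp [boxInd, hu]

/-! ### Spectral form of the spatial covariance -/

instance {d : ℕ} (C : SpatialCovariance d) : IsLocallyFiniteMeasure C.μ := by
  obtain ⟨m, hm⟩ := C.tempered.exists_integrable
  refine ⟨fun x => ⟨Metric.ball 0 (‖x‖ + 1), Metric.isOpen_ball.mem_nhds (by simp), ?_⟩⟩
  have hpos : 0 < (1 + (‖x‖ + 1)) ^ (-(m : ℝ)) := by positivity
  -- On the ball the integrable function `(1 + ‖y‖)^(-m)` is bounded below by a positive constant,
  -- and its superlevel sets have finite measure.
  refine (measure_mono fun y hy => ?_).trans_lt (hm.measure_norm_ge_lt_top hpos)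
  rw [mem_ball_zero_iff] at hy
  rw [Set.mem_ofPred_eq, Real.norm_of_nonneg (by positivity)]
  exact Real.rpow_le_rpow_of_nonpos (by positivity) (by linarith) (by simp)

theorem norm_exp_neg_ofReal_mul_I (t : ℝ) : ‖Complex.exp (-(t : ℂ) * Complex.I)‖ = 1 := by
  have := Complex.norm_exp_ofReal_mul_I (-t)
  simpa using this

theorem norm_exp_neg_ofReal_mul_I_sub_one_le (t : ℝ) :
    ‖Complex.exp (-(t : ℂ) * Complex.I) - 1‖ ≤ |t| := by
  have := Real.norm_exp_I_mul_ofReal_sub_one_le (x := -t)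
  simpa [mul_comm] using this

/-- The Fourier transform `∫ e^{-i ξ·x} g(x) dx`. -/
def fourierInt {d : ℕ} (g : Space d → ℝ) (ξ : Space d) : ℂ :=
  ∫ x, Complex.exp (-((inner ℝ ξ x : ℝ) : ℂ) * Complex.I) * g x

theorem fourierInt_eq_fourier {d : ℕ} (g : Space d → ℝ) (ξ : Space d) :
    fourierInt g ξ = 𝓕 (fun x => (g x : ℂ)) ((2 * Real.pi)⁻¹ • ξ) := by
  rw [Real.fourier_eq', fourierInt]
  congr 1; ext x
  rw [smul_eq_mul]
  congr 2
  rw [inner_smul_right, real_inner_comm]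
  push_cast
  field_simp

theorem fourierInt_indicator {d : ℕ} {A : Set (Space d)} (hA : MeasurableSet A) (ξ : Space d) :
    fourierInt (A.indicator 1) ξ = indicatorFourier A ξ := by
  rw [fourierInt, indicatorFourier, ← integral_indicator hA]
  congr 1; ext x
  by_cases hx : x ∈ A <;> simp [hx]

theorem fourierInt_convolution {d : ℕ} {g h : Space d → ℝ} (hg : Integrable g) (hh : Integrable h)
    (ξ : Space d) :
    fourierInt (MeasureTheory.convolution g h (ContinuousLinearMap.lsmul ℝ ℝ) volume) ξ =
      fourierInt g ξ * fourierInt h ξ := by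
  simp only [fourierInt_eq_fourier]
  refine Eq.trans ?_ (Real.fourier_mul_convolution_eq (R := ℂ) hg.ofReal hh.ofReal _)
  refine congrArg (fun u : Space d → ℂ => 𝓕 u ((2 * Real.pi)⁻¹ • ξ)) (funext fun x => ?_)
  simp only [MeasureTheory.convolution, ContinuousLinearMap.lsmul_apply, smul_eq_mul,
    ContinuousLinearMap.mul_apply']
  rw [← integral_complex_ofReal]
  simp

/-- The approximate identity used for mollification. -/
def mollifier (d k : ℕ) : ContDiffBump (0 : Space d) :=
  ⟨1 / (2 * (k + 1)), 1 / (k + 1), by positivity, by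
    rw [one_div_lt_one_div (by positivity) (by positivity)]
    have : (0 : ℝ) ≤ k := by positivity
    linarith⟩

/-- The Fourier transform of the mollifier. -/
def mollifierFourier (d k : ℕ) : Space d → ℂ := fourierInt ((mollifier d k).normed volume)

theorem norm_mollifierFourier_le (d k : ℕ) (ξ : Space d) : ‖mollifierFourier d k ξ‖ ≤ 1 := by
  rw [← (mollifier d k).integral_normed (μ := volume)]
  refine norm_integral_le_of_norm_le (mollifier d k).integrable_normed
    (Eventually.of_forall fun x => ?_)
  rw [norm_mul, norm_exp_neg_ofReal_mul_I, one_mul, Complex.norm_real,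
    Real.norm_of_nonneg ((mollifier d k).nonneg_normed x)]

theorem integrable_exp_mul {d : ℕ} {g : Space d → ℝ} (hg : Integrable g) (ξ : Space d) :
    Integrable fun x => Complex.exp (-((inner ℝ ξ x : ℝ) : ℂ) * Complex.I) * g x := by
  refine hg.ofReal.bdd_mul (c := 1) (Continuous.aestronglyMeasurable (by fun_prop))
    (Eventually.of_forall fun x => ?_)
  rw [norm_exp_neg_ofReal_mul_I]

theorem tendsto_mollifierFourier (d : ℕ) (ξ : Space d) :
    Tendsto (fun k => mollifierFourier d k ξ) atTop (𝓝 1) := by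
  rw [tendsto_iff_norm_sub_tendsto_zero]
  -- The bump has mass one and lives in the ball of radius `1 / (k + 1)`, where `|e^{-iξ·x} - 1| ≤
  -- ‖ξ‖ / (k + 1)`.
  have hlim : Tendsto (fun k : ℕ => ‖ξ‖ * (1 / ((k : ℝ) + 1))) atTop (𝓝 0) := by
    simpa using tendsto_one_div_add_atTop_nhds_zero_nat.const_mul ‖ξ‖
  refine squeeze_zero (fun _ => norm_nonneg _) (fun k => ?_) hlim
  set b := mollifier d k
  have hbi : Integrable (b.normed volume) := b.integrable_normed
  have e1 : mollifierFourier d k ξ - 1 =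
      ∫ x, (Complex.exp (-((inner ℝ ξ x : ℝ) : ℂ) * Complex.I) - 1) * b.normed volume x := by
    have h1 : (1 : ℂ) = ∫ x, ((b.normed volume x : ℝ) : ℂ) := by
      rw [integral_complex_ofReal, b.integral_normed, Complex.ofReal_one]
    conv_lhs => rw [h1]
    refine (integral_sub (integrable_exp_mul hbi ξ) hbi.ofReal).symm.trans ?_
    congr 1; ext x
    rw [sub_mul, one_mul]
    rfl
  rw [e1]
  have e2 : ‖ξ‖ * (1 / ((k : ℝ) + 1)) = ∫ x, ‖ξ‖ * (1 / ((k : ℝ) + 1)) * b.normed volume x := by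
    rw [integral_const_mul, b.integral_normed, mul_one]
  rw [e2]
  refine norm_integral_le_of_norm_le (hbi.const_mul _) (Eventually.of_forall fun x => ?_)
  rw [norm_mul, Complex.norm_real, Real.norm_of_nonneg (b.nonneg_normed x)]
  by_cases hx : x ∈ Function.support (b.normed volume)
  · refine mul_le_mul_of_nonneg_right ?_ (b.nonneg_normed x)
    rw [b.support_normed_eq, mem_ball_zero_iff] at hx
    refine (norm_exp_neg_ofReal_mul_I_sub_one_le _).trans ((abs_real_inner_le_norm _ _).trans ?_)
    gcongr
    exact hx.le
  · rw [Function.notMem_support.1 hx]; simp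

theorem integrable_indicator_one {d : ℕ} {A : Set (Space d)} (hA : MeasurableSet A)
    (hA' : Bornology.IsBounded A) : Integrable (A.indicator (1 : Space d → ℝ)) :=
  (integrable_indicator_iff hA).2 (integrableOn_const hA'.measure_lt_top.ne)

/-- Convolving `1_A` with a bump multiplies its Fourier transform by a factor that depends on `k`
only, not on `A`. The uniform bound `1` and the common support are what dominated convergence
requires on the `f` side. -/
theorem exists_mollified {d : ℕ} {A : Set (Space d)} (hA : MeasurableSet A) {R : ℝ}
    (hR : ∀ x ∈ A, ‖x‖ ≤ R) :
    ∃ G : ℕ → Space d → ℝ, (∀ k, ContDiff ℝ (⊤ : ℕ∞) (G k)) ∧ (∀ k x, |G k x| ≤ 1) ∧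
      (∀ k x, R + 1 < ‖x‖ → G k x = 0) ∧
      (∀ᵐ x, Tendsto (fun k => G k x) atTop (𝓝 (A.indicator 1 x))) ∧
      ∀ k ξ, fourierInt (G k) ξ = mollifierFourier d k ξ * indicatorFourier A ξ := by
  set g : Space d → ℝ := A.indicator 1 with hg
  have hbd : Bornology.IsBounded A := isBounded_iff_forall_norm_le.2 ⟨R, hR⟩
  have hgi : Integrable g := integrable_indicator_one hA hbd
  have hg1 : ∀ x, |g x| ≤ 1 := fun x => by by_cases h : x ∈ A <;> simp [hg, h]
  have hgR : ∀ x, R < ‖x‖ → g x = 0 := fun x hx => by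
    have : x ∉ A := fun h => absurd (hR x h) (not_le.2 hx)
    simp [hg, this]
  have hb1 : Tendsto (fun k => (mollifier d k).rOut) atTop (𝓝 0) :=
    tendsto_one_div_add_atTop_nhds_zero_nat
  have hb2 : ∀ k, (mollifier d k).rOut ≤ 2 * (mollifier d k).rIn := fun k => by
    show 1 / ((k : ℝ) + 1) ≤ 2 * (1 / (2 * (k + 1)))
    field_simp
    exact le_rfl
  have hb3 : ∀ k, (mollifier d k).rOut ≤ 1 := fun k => by
    show 1 / ((k : ℝ) + 1) ≤ 1
    rw [div_le_one (by positivity)]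
    have : (0 : ℝ) ≤ k := by positivity
    linarith
  refine ⟨fun k => MeasureTheory.convolution ((mollifier d k).normed volume) g
    (ContinuousLinearMap.lsmul ℝ ℝ) volume, fun k => ?_, fun k x => ?_, fun k x hx => ?_, ?_,
    fun k ξ => ?_⟩
  · exact (mollifier d k).hasCompactSupport_normed.contDiff_convolution_left _
      (mollifier d k).contDiff_normed hgi.locallyIntegrable
  · rw [← (mollifier d k).integral_normed (μ := volume), ← Real.norm_eq_abs]
    refine norm_integral_le_of_norm_le (mollifier d k).integrable_normed
      (Eventually.of_forall fun t => ?_)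
    rw [ContinuousLinearMap.lsmul_apply, norm_smul,
      Real.norm_of_nonneg ((mollifier d k).nonneg_normed t)]
    exact mul_le_of_le_one_right ((mollifier d k).nonneg_normed t) (hg1 _)
  · refine integral_eq_zero_of_ae (Eventually.of_forall fun t => ?_)
    by_cases ht : ‖t‖ < 1
    · have : g (x - t) = 0 := hgR _ (by linarith [norm_sub_norm_le x t])
      simp [this]
    · have : (mollifier d k).normed volume t = 0 := by
        have : t ∉ Function.support ((mollifier d k).normed volume) := by
          rw [(mollifier d k).support_normed_eq, mem_ball_zero_iff]
          exact fun h => ht (h.trans_le (hb3 k))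
        simpa using this
      simp [this]
  · exact ContDiffBump.ae_convolution_tendsto_right_of_locallyIntegrable
      (μ := (volume : Measure (Space d))) hb1 (Eventually.of_forall hb2) hgi.locallyIntegrable
  · rw [fourierInt_convolution (mollifier d k).integrable_normed hgi, fourierInt_indicator hA,
      mollifierFourier]

/-- The correlation `z ↦ ∫ g(x) h(x - z) dx` is a Schwartz function whose Fourier transform is `ℱg ·
conj(ℱh)`. Testing `f = ℱμ` against it gives the identity, and Schwartz functions are integrable for
the tempered measure `μ`. -/
theorem covForm_eq_of_contDiff {d : ℕ} (C : SpatialCovariance d) {g h : Space d → ℝ} {M R : ℝ}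
    (hg : ContDiff ℝ (⊤ : ℕ∞) g) (hh : ContDiff ℝ (⊤ : ℕ∞) h) (hgM : ∀ x, |g x| ≤ M)
    (hhM : ∀ x, |h x| ≤ M) (hgR : ∀ x, R < ‖x‖ → g x = 0) (hhR : ∀ x, R < ‖x‖ → h x = 0) :
    Integrable (fun ξ => fourierInt g ξ * starRingEnd ℂ (fourierInt h ξ)) C.μ ∧
    ∫ ξ, fourierInt g ξ * starRingEnd ℂ (fourierInt h ξ) ∂C.μ =
      ((∫ p : Space d × Space d, g p.1 * h (p.1 - p.2) * C.f p.2 ∂(volume.prod volume) : ℝ) :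
        ℂ) := by
  have key : ∀ g : Space d → ℝ, ContDiff ℝ (⊤ : ℕ∞) g → (∀ x, R < ‖x‖ → g x = 0) →
      ∃ s : 𝓢(Space d, ℂ), ∀ x, s x = ((g x : ℝ) : ℂ) := by
    intro g hg hgR
    have hsupp : HasCompactSupport g :=
      HasCompactSupport.intro (isCompact_closedBall (0 : Space d) R) fun x hx =>
        hgR x (by simpa using hx)
    have hc1 : HasCompactSupport (fun x => ((g x : ℝ) : ℂ)) :=
      hsupp.comp_left (g := fun r : ℝ => (r : ℂ)) (by simp)
    exact ⟨hc1.toSchwartzMap (Complex.ofRealCLM.contDiff.comp hg), fun x => rfl⟩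
  obtain ⟨s, hs⟩ := key g hg hgR
  obtain ⟨w, hw⟩ := key h hh hhR
  have hsF : ∀ ξ, schwartzFourier s ξ = fourierInt g ξ := fun ξ => by
    simp only [schwartzFourier_apply, hs]; rfl
  have hwF : ∀ ξ, schwartzFourier w ξ = fourierInt h ξ := fun ξ => by
    simp only [schwartzFourier_apply, hw]; rfl
  set w' : 𝓢(Space d, ℂ) :=
    SchwartzMap.compCLMOfContinuousLinearEquiv ℂ (ContinuousLinearEquiv.neg ℝ) w with hw'
  have hval' : ∀ x, w' x = ((h (-x) : ℝ) : ℂ) := fun x => hw (-x)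
  set ψ : 𝓢(Space d, ℂ) := SchwartzMap.convolution (ContinuousLinearMap.mul ℂ ℂ) s w' with hψ
  have hψv : ∀ z, ψ z = ((∫ x, g x * h (x - z) : ℝ) : ℂ) := by
    intro z
    rw [hψ, SchwartzMap.convolution_apply, ← integral_complex_ofReal]
    refine integral_congr_ae (Eventually.of_forall fun x => ?_)
    simp [hs, hval']
  have hF : ∀ ξ, schwartzFourier ψ ξ = fourierInt g ξ * starRingEnd ℂ (fourierInt h ξ) := by
    intro ξ
    have e1 : schwartzFourier w' ξ = starRingEnd ℂ (schwartzFourier w ξ) := by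
      rw [schwartzFourier_apply, schwartzFourier_apply, ← integral_conj, ← integral_neg_eq_self]
      refine integral_congr_ae (Eventually.of_forall fun x => ?_)
      simp [hw, hval', ← Complex.exp_conj]
    have e2 : schwartzFourier ψ ξ = schwartzFourier s ξ * schwartzFourier w' ξ := by
      simp only [schwartzFourier, hψ, SchwartzMap.fourier_convolution]
      rfl
    rw [e2, e1, hsF, hwF]
  have hint := (integrable_cov C hg.continuous.measurable hh.continuous.measurable
    hgM hhM hgR hhR).2.2
  have e3 : ∫ p : Space d × Space d, g p.1 * h (p.1 - p.2) * C.f p.2 ∂(volume.prod volume)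
      = ∫ z, C.f z * ∫ x, g x * h (x - z) := by
    rw [integral_prod_symm _ hint]
    refine integral_congr_ae (Eventually.of_forall fun z => ?_)
    simp only
    rw [← integral_const_mul]
    congr 1; ext x; ring
  have := C.tempered
  refine ⟨((schwartzFourier ψ).integrable (μ := C.μ)).congr (Eventually.of_forall hF), ?_⟩
  have e4 := C.fourier ψ
  simp only [hψv, hF, ← Complex.ofReal_mul] at e4
  rw [integral_complex_ofReal] at e4
  rw [e3, ← e4]

theorem spaceCov_eq_covForm {d : ℕ} (C : SpatialCovariance d) {A B : Set (Space d)}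
    (hA : MeasurableSet A) (hB : MeasurableSet B) {R : ℝ} (hAR : ∀ x ∈ A, ‖x‖ ≤ R)
    (hBR : ∀ x ∈ B, ‖x‖ ≤ R) :
    spaceCov C A B = ∫ p : Space d × Space d, A.indicator (1 : Space d → ℝ) p.1 *
      B.indicator (1 : Space d → ℝ) (p.1 - p.2) * C.f p.2 ∂(volume.prod volume) := by
  have h1 : ∀ (A : Set (Space d)) x, |A.indicator (1 : Space d → ℝ) x| ≤ 1 := fun A x => by
    by_cases h : x ∈ A <;> simp [h]
  have h0 : ∀ A : Set (Space d), (∀ x ∈ A, ‖x‖ ≤ R) → ∀ x, R < ‖x‖ →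
      A.indicator (1 : Space d → ℝ) x = 0 := fun A hA x hx => by
    have : x ∉ A := fun h => absurd (hA x h) (not_le.2 hx)
    simp [this]
  have hi := (integrable_cov C (measurable_one.indicator hA) (measurable_one.indicator hB)
    (h1 A) (h1 B) (h0 A hAR) (h0 B hBR)).2.2
  rw [integral_prod _ hi, spaceCov, ← integral_indicator hA]
  refine integral_congr_ae (Eventually.of_forall fun x => ?_)
  simp only
  by_cases hx : x ∈ A
  · rw [Set.indicator_of_mem hx, ← integral_indicator hB, ← integral_sub_left_eq_self _ volume x]
    refine integral_congr_ae (Eventually.of_forall fun y => ?_)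
    by_cases hy : x - y ∈ B <;> simp [hx, hy]
  · simp [hx]

theorem continuous_indicatorFourier {d : ℕ} {A : Set (Space d)}
    (hA' : Bornology.IsBounded A) : Continuous (indicatorFourier A) := by
  refine continuous_of_dominated (bound := fun _ => 1)
    (fun ξ => Continuous.aestronglyMeasurable (by fun_prop))
    (fun ξ => Eventually.of_forall fun x => (norm_exp_neg_ofReal_mul_I _).le)
    (integrableOn_const hA'.measure_lt_top.ne) (Eventually.of_forall fun x => by fun_prop)

/-- The smooth case is applied to mollified indicators. The `f` side converges by local
integrability of `f`. On the `μ` side, square integrability of `ℱ1_A` comes first, from Fatou with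
`A = B`; it then supplies the majorant `|ℱ1_A| |ℱ1_B|` for the general case, as the mollifier
factors are at most one in modulus. -/
theorem indicatorFourier_isometry {d : ℕ} (C : SpatialCovariance d) {A B : Set (Space d)}
    (hA : MeasurableSet A) (hB : MeasurableSet B) (hA' : Bornology.IsBounded A)
    (hB' : Bornology.IsBounded B) :
    MemLp (indicatorFourier A) 2 C.μ ∧
    ∫ ξ, indicatorFourier A ξ * starRingEnd ℂ (indicatorFourier B ξ) ∂C.μ = (spaceCov C A B : ℂ) := by
  have key : ∀ {A B : Set (Space d)}, MeasurableSet A → MeasurableSet B → Bornology.IsBounded A →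
      Bornology.IsBounded B →
      (∀ k, Integrable (fun ξ => (mollifierFourier d k ξ * indicatorFourier A ξ) *
        starRingEnd ℂ (mollifierFourier d k ξ * indicatorFourier B ξ)) C.μ) ∧
      Tendsto (fun k => ∫ ξ, (mollifierFourier d k ξ * indicatorFourier A ξ) *
        starRingEnd ℂ (mollifierFourier d k ξ * indicatorFourier B ξ) ∂C.μ) atTop
        (𝓝 (spaceCov C A B : ℂ)) := by
    intro A B hA hB hA' hB'
    obtain ⟨R₁, hR₁⟩ := hA'.exists_norm_le
    obtain ⟨R₂, hR₂⟩ := hB'.exists_norm_le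
    have hAR : ∀ x ∈ A, ‖x‖ ≤ max R₁ R₂ := fun x hx => (hR₁ x hx).trans (le_max_left _ _)
    have hBR : ∀ x ∈ B, ‖x‖ ≤ max R₁ R₂ := fun x hx => (hR₂ x hx).trans (le_max_right _ _)
    obtain ⟨G, G1, G2, G3, G4, G5⟩ := exists_mollified hA hAR
    obtain ⟨K, K1, K2, K3, K4, K5⟩ := exists_mollified hB hBR
    have hc := fun k => covForm_eq_of_contDiff C (G1 k) (K1 k) (G2 k) (K2 k) (G3 k) (K3 k)
    simp only [G5, K5] at hc
    refine ⟨fun k => (hc k).1, ?_⟩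
    simp only [fun k => (hc k).2]
    refine (Complex.continuous_ofReal.tendsto _).comp ?_
    rw [spaceCov_eq_covForm C hA hB hAR hBR]
    have hi := fun k => integrable_cov C (G1 k).continuous.measurable
      (K1 k).continuous.measurable (G2 k) (K2 k) (G3 k) (K3 k)
    have hq : ∀ᵐ p : Space d × Space d ∂(volume.prod volume),
        Tendsto (fun k => K k (p.1 - p.2)) atTop (𝓝 (B.indicator 1 (p.1 - p.2))) :=
      (quasiMeasurePreserving_sub (volume : Measure (Space d)) volume).ae K4
    have hq1 : ∀ᵐ p : Space d × Space d ∂(volume.prod volume),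
        Tendsto (fun k => G k p.1) atTop (𝓝 (A.indicator 1 p.1)) :=
      Measure.quasiMeasurePreserving_fst.ae G4
    refine tendsto_integral_of_dominated_convergence _ (fun k => (hi k).2.2.1) (hi 0).1
      (fun k => Eventually.of_forall (hi k).2.1) ?_
    filter_upwards [hq, hq1] with p hp hp1
    exact (hp1.mul hp).mul_const (C.f p.2)
  have hlim : ∀ (A : Set (Space d)) ξ,
      Tendsto (fun k => mollifierFourier d k ξ * indicatorFourier A ξ) atTop
        (𝓝 (indicatorFourier A ξ)) := fun A ξ => by
    simpa using (tendsto_mollifierFourier d ξ).mul_const (indicatorFourier A ξ)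
  have hL2 : ∀ {A : Set (Space d)}, MeasurableSet A → Bornology.IsBounded A →
      MemLp (indicatorFourier A) 2 C.μ := by
    intro A hA hA'
    obtain ⟨h1, h2⟩ := key hA hA hA' hA'
    refine ⟨(continuous_indicatorFourier hA').aestronglyMeasurable, ?_⟩
    rw [eLpNorm_lt_top_iff_lintegral_rpow_enorm_lt_top (by norm_num) (by norm_num)]
    have e : ∀ k ξ, mollifierFourier d k ξ * indicatorFourier A ξ *
        starRingEnd ℂ (mollifierFourier d k ξ * indicatorFourier A ξ) =
        ((‖mollifierFourier d k ξ * indicatorFourier A ξ‖ ^ 2 : ℝ) : ℂ) := fun k ξ => by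
      rw [Complex.mul_conj, Complex.normSq_eq_norm_sq]
    simp only [e] at h1 h2
    have h1' : ∀ k, Integrable (fun ξ => ‖mollifierFourier d k ξ * indicatorFourier A ξ‖ ^ 2)
        C.μ := fun k =>
      (h1 k).re.congr (Eventually.of_forall fun ξ => Complex.ofReal_re _)
    have h3 : ∀ k, ∫⁻ ξ, ENNReal.ofReal (‖mollifierFourier d k ξ * indicatorFourier A ξ‖ ^ 2) ∂C.μ =
        ENNReal.ofReal (∫ ξ, ((‖mollifierFourier d k ξ * indicatorFourier A ξ‖ ^ 2 : ℝ) : ℂ)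
          ∂C.μ).re := fun k => by
      rw [integral_complex_ofReal, Complex.ofReal_re, ofReal_integral_eq_lintegral_ofReal (h1' k)
        (Eventually.of_forall fun ξ => by positivity)]
    have h4 := (ENNReal.continuous_ofReal.tendsto _).comp
      ((Complex.continuous_re.tendsto _).comp h2)
    refine lt_of_le_of_lt ?_ (ENNReal.ofReal_lt_top (r := spaceCov C A A))
    -- Fatou: the mollified integrals converge to the finite number `spaceCov C A A`.
    calc _ = ∫⁻ ξ, liminf (fun k =>
          ENNReal.ofReal (‖mollifierFourier d k ξ * indicatorFourier A ξ‖ ^ 2)) atTop ∂C.μ := by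
          refine lintegral_congr fun ξ => ?_
          have h5 := ((ENNReal.continuous_ofReal.tendsto _).comp
            (((hlim A ξ).norm).pow 2)).liminf_eq
          simp only [Function.comp_def] at h5
          rw [h5]
          norm_num
      _ ≤ liminf (fun k => ∫⁻ ξ,
          ENNReal.ofReal (‖mollifierFourier d k ξ * indicatorFourier A ξ‖ ^ 2) ∂C.μ) atTop :=
          lintegral_liminf_le' fun k => (h1' k).1.aemeasurable.ennreal_ofReal
      _ = _ := by
          simp only [h3]
          exact h4.liminf_eq
  refine ⟨hL2 hA hA', ?_⟩
  obtain ⟨h1, h2⟩ := key hA hB hA' hB'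
  refine tendsto_nhds_unique (tendsto_integral_of_dominated_convergence
    (fun ξ => ‖indicatorFourier A ξ‖ * ‖indicatorFourier B ξ‖) (fun k => (h1 k).1)
    ((hL2 hA hA').norm.integrable_mul (hL2 hB hB').norm) (fun k => Eventually.of_forall fun ξ => ?_)
    (Eventually.of_forall fun ξ => ?_)) h2
  · simp only [norm_mul, RCLike.norm_conj]
    have := norm_mollifierFourier_le d k ξ
    gcongr <;> exact mul_le_of_le_one_left (norm_nonneg _) this
  · exact (hlim A ξ).mul ((Complex.continuous_conj.tendsto _).comp (hlim B ξ))

/-! ### Fourier uniqueness and evenness of the spectral measure -/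

section Uniqueness

variable {E : Type*} [NormedAddCommGroup E] [NormedSpace ℝ E] [CompleteSpace E]
  [SecondCountableTopology E] [MeasurableSpace E] [BorelSpace E] {μ : Measure E}

/-- The positive and negative parts of `r` are densities of two finite measures with the same
characteristic function. The measures therefore coincide, and so do the densities. -/
theorem ae_eq_zero_of_integral_exp_mul_ofReal_eq_zero {r : E → ℝ} (hr : Integrable r μ)
    (h : ∀ L : StrongDual ℝ E, ∫ x, Complex.exp ((L x : ℂ) * Complex.I) * r x ∂μ = 0) :
    r =ᵐ[μ] 0 := by
  have hb : ∀ L : StrongDual ℝ E, ∀ {q : E → ℝ}, Integrable q μ →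
      Integrable (fun x => Complex.exp ((L x : ℂ) * Complex.I) * q x) μ := fun L q hq => by
    refine hq.ofReal.bdd_mul (c := 1) (Continuous.aestronglyMeasurable (by fun_prop))
      (Eventually.of_forall fun x => ?_)
    rw [Complex.norm_exp_ofReal_mul_I]
  have hfin : ∀ {q : E → ℝ}, Integrable q μ → ∫⁻ x, ENNReal.ofReal (q x) ∂μ ≠ ⊤ := fun hq =>
    hq.lintegral_lt_top.ne
  have hchar : ∀ {q : E → ℝ}, Integrable q μ → ∀ L : StrongDual ℝ E,
      charFunDual (μ.withDensity fun x => ENNReal.ofReal (q x)) L =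
        ∫ x, Complex.exp ((L x : ℂ) * Complex.I) * (max (q x) 0 : ℝ) ∂μ := by
    intro q hq L
    rw [charFunDual_apply, integral_withDensity_eq_integral_toReal_smul₀
      hq.1.aemeasurable.ennreal_ofReal (Eventually.of_forall fun x => ENNReal.ofReal_lt_top)]
    refine integral_congr_ae (Eventually.of_forall fun x => ?_)
    simp only [ENNReal.toReal_ofReal', Complex.real_smul]
    ring
  have : IsFiniteMeasure (μ.withDensity fun x => ENNReal.ofReal (r x)) :=
    isFiniteMeasure_withDensity (hfin hr)
  have : IsFiniteMeasure (μ.withDensity fun x => ENNReal.ofReal (-r x)) :=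
    isFiniteMeasure_withDensity (hfin hr.neg)
  have heq : (μ.withDensity fun x => ENNReal.ofReal (r x)) =
      μ.withDensity fun x => ENNReal.ofReal (-r x) := by
    refine Measure.ext_of_charFunDual (funext fun L => ?_)
    have hneg := hchar hr.neg L
    simp only [Pi.neg_apply] at hneg
    rw [hchar hr L, hneg, ← sub_eq_zero,
      ← integral_sub (hb L hr.pos_part) (hb L hr.neg_part), ← h L]
    refine integral_congr_ae (Eventually.of_forall fun x => ?_)
    simp only
    rw [← mul_sub, ← Complex.ofReal_sub, max_zero_sub_max_neg_zero_eq_self]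
  have h2 := (withDensity_eq_iff hr.1.aemeasurable.ennreal_ofReal
    hr.1.aemeasurable.neg.ennreal_ofReal (hfin hr)).1 heq
  filter_upwards [h2] with x hx
  have := congrArg ENNReal.toReal hx
  simp only [ENNReal.toReal_ofReal', Pi.neg_apply] at this
  have h3 := max_zero_sub_max_neg_zero_eq_self (r x)
  simp only [Pi.zero_apply]
  linarith

/-- Conjugating the hypothesis at `-L` shows that the conjugate of `G` also satisfies it, hence so
do the real and imaginary parts. -/
theorem ae_eq_zero_of_integral_exp_mul_eq_zero {G : E → ℂ} (hG : Integrable G μ)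
    (h : ∀ L : StrongDual ℝ E, ∫ x, Complex.exp ((L x : ℂ) * Complex.I) * G x ∂μ = 0) :
    G =ᵐ[μ] 0 := by
  have hb : ∀ L : StrongDual ℝ E, ∀ {q : E → ℂ}, Integrable q μ →
      Integrable (fun x => Complex.exp ((L x : ℂ) * Complex.I) * q x) μ := fun L q hq => by
    refine hq.bdd_mul (c := 1) (Continuous.aestronglyMeasurable (by fun_prop))
      (Eventually.of_forall fun x => ?_)
    rw [Complex.norm_exp_ofReal_mul_I]
  have hGc : Integrable (fun x => starRingEnd ℂ (G x)) μ :=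
    Complex.conjLIE.toContinuousLinearEquiv.integrable_comp_iff.2 hG
  have hc : ∀ L : StrongDual ℝ E,
      ∫ x, Complex.exp ((L x : ℂ) * Complex.I) * starRingEnd ℂ (G x) ∂μ = 0 := by
    intro L
    rw [← map_zero (starRingEnd ℂ), ← h (-L), ← integral_conj]
    refine integral_congr_ae (Eventually.of_forall fun x => ?_)
    simp [← Complex.exp_conj]
  have hre := ae_eq_zero_of_integral_exp_mul_ofReal_eq_zero hG.re fun L => by
    have e : ∀ x, Complex.exp ((L x : ℂ) * Complex.I) * ((RCLike.re (G x) : ℝ) : ℂ) =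
        (1 / 2 : ℂ) * (Complex.exp ((L x : ℂ) * Complex.I) * G x +
          Complex.exp ((L x : ℂ) * Complex.I) * starRingEnd ℂ (G x)) := fun x => by
      rw [RCLike.re_eq_complex_re, Complex.re_eq_add_conj]; ring
    simp only [e]
    rw [integral_const_mul, integral_add (hb L hG) (hb L hGc), h L, hc L]
    simp
  have him := ae_eq_zero_of_integral_exp_mul_ofReal_eq_zero hG.im fun L => by
    have e : ∀ x, Complex.exp ((L x : ℂ) * Complex.I) * ((RCLike.im (G x) : ℝ) : ℂ) =
        (1 / (2 * Complex.I) : ℂ) * (Complex.exp ((L x : ℂ) * Complex.I) * G x -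
          Complex.exp ((L x : ℂ) * Complex.I) * starRingEnd ℂ (G x)) := fun x => by
      rw [RCLike.im_eq_complex_im, Complex.im_eq_sub_conj]; ring
    simp only [e]
    rw [integral_const_mul, integral_sub (hb L hG) (hb L hGc), h L, hc L]
    simp
  filter_upwards [hre, him] with x h1 h2
  exact Complex.ext h1 h2

end Uniqueness

/-- Both measures have densities bounded by one with respect to their sum. These are locally
integrable, so they are determined by integrals against smooth compactly supported functions. -/
theorem measure_eq_of_integral_contDiff_eq {E : Type*} [NormedAddCommGroup E] [NormedSpace ℝ E]
    [FiniteDimensional ℝ E] [MeasurableSpace E] [BorelSpace E] {μ μ' : Measure E}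
    [IsLocallyFiniteMeasure μ] [IsLocallyFiniteMeasure μ']
    (h : ∀ g : E → ℝ, ContDiff ℝ (⊤ : ℕ∞) g → HasCompactSupport g →
      ∫ x, g x ∂μ = ∫ x, g x ∂μ') : μ = μ' := by
  set σ := μ + μ' with hσ
  have h1 : μ ≤ σ := Measure.le_add_right le_rfl
  have h2 : μ' ≤ σ := Measure.le_add_left le_rfl
  have : IsFiniteMeasureOnCompacts σ := ⟨fun K hK => by
    rw [hσ, Measure.add_apply]
    exact ENNReal.add_lt_top.2 ⟨hK.measure_lt_top, hK.measure_lt_top⟩⟩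
  have : IsLocallyFiniteMeasure σ := isLocallyFiniteMeasure_of_isFiniteMeasureOnCompacts
  have hloc : ∀ {τ : Measure E} [SigmaFinite τ], τ ≤ σ →
      LocallyIntegrable (fun x => (τ.rnDeriv σ x).toReal) σ := by
    intro τ _ hτ
    refine (locallyIntegrable_const (1 : ℝ)).mono
      (Measure.measurable_rnDeriv _ _).ennreal_toReal.aestronglyMeasurable ?_
    filter_upwards [Measure.rnDeriv_le_one_of_le hτ] with x hx
    rw [Real.norm_of_nonneg ENNReal.toReal_nonneg, norm_one]
    exact ENNReal.toReal_le_of_le_ofReal zero_le_one (by simpa using hx)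
  have hae := ae_eq_of_integral_contDiff_smul_eq (hloc h1) (hloc h2) fun g hg hgs => by
    have e1 := integral_rnDeriv_smul (Measure.absolutelyContinuous_of_le h1) (f := g)
    have e2 := integral_rnDeriv_smul (Measure.absolutelyContinuous_of_le h2) (f := g)
    simp only [smul_eq_mul] at e1 e2 ⊢
    simp only [mul_comm (g _)]
    rw [e1, e2]
    exact h g hg hgs
  rw [← Measure.withDensity_rnDeriv_eq μ σ (Measure.absolutelyContinuous_of_le h1),
    ← Measure.withDensity_rnDeriv_eq μ' σ (Measure.absolutelyContinuous_of_le h2)]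
  refine withDensity_congr_ae ?_
  filter_upwards [hae, Measure.rnDeriv_lt_top μ σ, Measure.rnDeriv_lt_top μ' σ] with x hx a b
  exact (ENNReal.toReal_eq_toReal_iff' a.ne b.ne).1 hx

theorem exists_schwartzFourier_eq {d : ℕ} (s : 𝓢(Space d, ℂ)) :
    ∃ h : 𝓢(Space d, ℂ), schwartzFourier h = s := by
  refine ⟨𝓕⁻ (SchwartzMap.compCLMOfContinuousLinearEquiv ℂ (angularScale (Space d)).symm s), ?_⟩
  ext x
  simp [schwartzFourier]

/-- Every smooth compactly supported `g` is the Fourier transform of a Schwartz function `h`, and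
reflecting `h` reflects `g`. The almost everywhere evenness of `f` thus passes to `μ`. -/
theorem measurePreserving_neg_spectral {d : ℕ} (C : SpatialCovariance d) :
    MeasurePreserving (fun ξ => -ξ) C.μ C.μ := by
  refine ⟨measurable_neg, ?_⟩
  have hlf : IsLocallyFiniteMeasure (C.μ.map fun ξ => -ξ) := by
    have : IsFiniteMeasureOnCompacts (C.μ.map fun ξ => -ξ) := ⟨fun K hK => by
      rw [Measure.map_apply measurable_neg hK.measurableSet]
      exact (hK.neg).measure_lt_top⟩
    exact isLocallyFiniteMeasure_of_isFiniteMeasureOnCompacts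
  refine measure_eq_of_integral_contDiff_eq fun g hg hgs => ?_
  have hc1 : HasCompactSupport (fun x => ((g x : ℝ) : ℂ)) :=
    hgs.comp_left (g := fun r : ℝ => (r : ℂ)) (by simp)
  obtain ⟨h, hh⟩ := exists_schwartzFourier_eq
    (hc1.toSchwartzMap (Complex.ofRealCLM.contDiff.comp hg))
  have hv : ∀ ξ, schwartzFourier h ξ = ((g ξ : ℝ) : ℂ) := fun ξ => by rw [hh]; rfl
  set h' : 𝓢(Space d, ℂ) :=
    SchwartzMap.compCLMOfContinuousLinearEquiv ℂ (ContinuousLinearEquiv.neg ℝ) h with hh'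
  have hval' : ∀ x, h' x = h (-x) := fun x => rfl
  have hv' : ∀ ξ, schwartzFourier h' ξ = ((g (-ξ) : ℝ) : ℂ) := fun ξ => by
    rw [← hv, schwartzFourier_apply, schwartzFourier_apply, ← integral_neg_eq_self]
    refine integral_congr_ae (Eventually.of_forall fun x => ?_)
    simp [hval']
  have e1 := C.fourier h
  have e2 := C.fourier h'
  simp only [hv, hv'] at e1 e2
  rw [integral_complex_ofReal] at e1 e2
  rw [integral_map measurable_neg.aemeasurable hg.continuous.aestronglyMeasurable]
  apply Complex.ofReal_injective
  refine e2.symm.trans (Eq.trans ?_ e1)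
  rw [← integral_neg_eq_self]
  refine integral_congr_ae (C.even.mono fun x hx => ?_)
  simp only at hx
  simp [hval', hx]

theorem indicatorFourier_closedBall {d : ℕ} (a : Space d) (r : ℝ) (ξ : Space d) :
    indicatorFourier (Metric.closedBall a r) ξ =
      Complex.exp (-((inner ℝ ξ a : ℝ) : ℂ) * Complex.I) *
        indicatorFourier (Metric.closedBall 0 r) ξ := by
  simp only [indicatorFourier]
  rw [← integral_const_mul, ← integral_indicator measurableSet_closedBall,
    ← integral_indicator measurableSet_closedBall, ← integral_add_left_eq_self _ a]
  congr 1; ext x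
  by_cases hx : ‖x‖ ≤ r
  · rw [Set.indicator_of_mem (by simpa using hx), Set.indicator_of_mem (by simpa using hx),
      ← Complex.exp_add]
    congr 1
    rw [inner_add_right]; push_cast; ring
  · rw [Set.indicator_of_notMem (by simpa using hx), Set.indicator_of_notMem (by simpa using hx)]

/-- On the ball `|e^{-iξ·x} - 1| ≤ ‖ξ‖ r < 1`, so the integral of the exponential differs from the
volume by less than the volume. -/
theorem indicatorFourier_closedBall_ne_zero {d : ℕ} {r : ℝ} (hr : 0 < r) {ξ : Space d}
    (h : ‖ξ‖ * r < 1) : indicatorFourier (Metric.closedBall 0 r) ξ ≠ 0 := by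
  set B := Metric.closedBall (0 : Space d) r
  have hB : volume B < ⊤ := measure_closedBall_lt_top
  have hB0 : 0 < (volume B).toReal :=
    ENNReal.toReal_pos (Metric.measure_closedBall_pos _ _ hr).ne' hB.ne
  intro h0
  have e : ∫ x in B, (Complex.exp (-((inner ℝ ξ x : ℝ) : ℂ) * Complex.I) - 1) =
      -((volume B).toReal : ℂ) := by
    rw [integral_sub]
    · rw [show ∫ x in B, Complex.exp (-((inner ℝ ξ x : ℝ) : ℂ) * Complex.I) = 0 from h0]
      simp [Measure.real]
    · refine Measure.integrableOn_of_bounded (M := 1) hB.ne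
        (Continuous.aestronglyMeasurable (by fun_prop)) (Eventually.of_forall fun x => ?_)
      rw [norm_exp_neg_ofReal_mul_I]
    · exact integrableOn_const hB.ne
  have hle : ‖∫ x in B, (Complex.exp (-((inner ℝ ξ x : ℝ) : ℂ) * Complex.I) - 1)‖ ≤
      ‖ξ‖ * r * (volume B).toReal := by
    refine norm_setIntegral_le_of_norm_le_const hB fun x hx => ?_
    refine (norm_exp_neg_ofReal_mul_I_sub_one_le _).trans ((abs_real_inner_le_norm _ _).trans ?_)
    gcongr
    simpa [B] using hx
  rw [e, norm_neg, Complex.norm_real, Real.norm_of_nonneg hB0.le] at hle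
  nlinarith

/-- Translating a ball multiplies the Fourier transform of its indicator by a character. Testing
against products of translated balls of radius `r` thus says that the integrable function `∏
ℱ1_{B(0,r)}(ξ_i) V(ξ)` has zero Fourier transform, and so vanishes almost everywhere. Only this
product is known to be integrable; letting `r → 0` along a sequence removes the zeros of its first
factor. -/
theorem ae_eq_zero_of_integral_indicatorFourier_mul {d n : ℕ} {ν : Measure (Fin n → Space d)}
    {V : (Fin n → Space d) → ℂ}
    (hV : ∀ A : Fin n → Set (Space d), (∀ i, MeasurableSet (A i)) →
      (∀ i, Bornology.IsBounded (A i)) →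
      Integrable (fun ξ => (∏ i, indicatorFourier (A i) (ξ i)) * V ξ) ν ∧
      ∫ ξ, (∏ i, indicatorFourier (A i) (ξ i)) * V ξ ∂ν = 0) : V =ᵐ[ν] 0 := by
  have key : ∀ k : ℕ, (fun ξ => (∏ i, indicatorFourier (Metric.closedBall 0 (1 / ((k : ℝ) + 1)))
      (ξ i)) * V ξ) =ᵐ[ν] 0 := by
    intro k
    refine ae_eq_zero_of_integral_exp_mul_eq_zero (hV _ (fun i => measurableSet_closedBall)
      fun i => Metric.isBounded_closedBall).1 fun L => ?_
    -- The centres represent `-L`, so that the phase `e^{-iξ·a}` produced by the translation is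
    -- `e^{iL(ξ)}`.
    set a : Fin n → Space d := fun i =>
      -(InnerProductSpace.toDual ℝ (Space d)).symm (L.comp (ContinuousLinearMap.single ℝ (fun _ : Fin n => Space d) i))
    have hL : ∀ ξ, L ξ = ∑ i, -(inner ℝ (ξ i) (a i) : ℝ) := by
      intro ξ
      have : ∀ i, -(inner ℝ (ξ i) (a i) : ℝ) = L (Pi.single i (ξ i)) := fun i => by
        rw [inner_neg_right, neg_neg, real_inner_comm, InnerProductSpace.toDual_symm_apply]
        rfl
      simp only [this, ← map_sum]
      congr 1
      exact (Finset.univ_sum_single ξ).symm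
    rw [← (hV (fun i => Metric.closedBall (a i) (1 / ((k : ℝ) + 1)))
      (fun i => measurableSet_closedBall) fun i => Metric.isBounded_closedBall).2]
    refine integral_congr_ae (Eventually.of_forall fun ξ => ?_)
    simp only [indicatorFourier_closedBall (a _)]
    rw [Finset.prod_mul_distrib, ← Complex.exp_sum, mul_assoc, hL]
    congr 2
    push_cast
    rw [Finset.sum_mul]
  filter_upwards [ae_all_iff.2 key] with ξ hξ
  -- At a given `ξ` some radius is small enough for all `n` factors to be nonzero.
  have hev : ∀ᶠ k : ℕ in atTop, ∀ i, ‖ξ i‖ * (1 / ((k : ℝ) + 1)) < 1 := by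
    rw [eventually_all]
    intro i
    have : Tendsto (fun k : ℕ => ‖ξ i‖ * (1 / ((k : ℝ) + 1))) atTop (𝓝 0) := by
      simpa using tendsto_one_div_add_atTop_nhds_zero_nat.const_mul ‖ξ i‖
    exact this.eventually_lt_const one_pos
  obtain ⟨k, hk⟩ := hev.exists
  exact (mul_eq_zero.1 (hξ k)).resolve_left (Finset.prod_ne_zero_iff.2 fun i _ =>
    indicatorFourier_closedBall_ne_zero (by positivity) (hk i))

/-! ### The time norm as an `L²` norm -/

/-- The factor of the `n`-fold tensor power of the fractional kernel. -/
def timeFactor (H : ℝ) {n : ℕ} (u : Fin n → ℝ) (z : Fin n → ℝ × ℝ) : ℝ := ∏ i, wt H (u i) (z i)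

/-- The `n`-fold tensor power of the fractional kernel. -/
def timeKernel (H : ℝ) {n : ℕ} (p : (Fin n → ℝ) × (Fin n → ℝ)) : ℝ :=
  ∏ i, fracKernel H (p.1 i, p.2 i)

/-- The measure on the parameters of the products of `n` windows. -/
def windowsMeasure (n : ℕ) : Measure (Fin n → ℝ × ℝ) := Measure.pi fun _ => windowMeasure

instance (n : ℕ) : SigmaFinite (windowsMeasure n) := by unfold windowsMeasure; infer_instance

theorem kernelFactorization_time (H : Set.Ioo (1 / 2 : ℝ) 1) (n : ℕ) :
    KernelFactorization volume (windowsMeasure n) (timeFactor (H : ℝ)) (timeKernel (H : ℝ)) :=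
  (kernelFactorization_wt H).pi n

/-- The integral transform of functions on `ℝⁿ` which turns the fractional norm into an `L²` norm. -/
def timeTransform (H : ℝ) {n : ℕ} (g : (Fin n → ℝ) → ℂ) : (Fin n → ℝ × ℝ) → ℂ :=
  kernelTransform volume (timeFactor H) g

theorem timeKernel_eq (H : ℝ) {n : ℕ} (p : (Fin n → ℝ) × (Fin n → ℝ)) :
    timeKernel H p = (H * (2 * H - 1)) ^ n * ∏ i, |p.1 i - p.2 i| ^ (2 * H - 2) := by
  simp [timeKernel, fracKernel, Finset.prod_mul_distrib]

theorem measurableSet_timeCube {S : Set ℝ} (hS : MeasurableSet S) (n : ℕ) :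
    MeasurableSet (timeCube S n) := by
  have : timeCube S n = Set.univ.pi fun _ => S := by ext u; simp [timeCube]
  rw [this]
  exact MeasurableSet.univ_pi fun _ => hS

section TimeNorm

variable (H : Set.Ioo (1 / 2 : ℝ) 1) {n : ℕ} {S : Set ℝ} {g : (Fin n → ℝ) → ℂ}

theorem alpha_pos : 0 < (H : ℝ) * (2 * H - 1) := by
  have := H.2.1
  have : (0 : ℝ) < 2 * H - 1 := by linarith
  have : (0 : ℝ) < H := by linarith
  positivity

theorem indicator_timeCube_kernel (p : (Fin n → ℝ) × (Fin n → ℝ)) :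
    (timeCube S n ×ˢ timeCube S n).indicator (fun p : (Fin n → ℝ) × (Fin n → ℝ) =>
      g p.1 * starRingEnd ℂ (g p.2) * ((∏ i, |p.1 i - p.2 i| ^ (2 * (H : ℝ) - 2) : ℝ) : ℂ)) p =
    (((H : ℝ) * (2 * H - 1)) ^ n : ℝ)⁻¹ • ((timeCube S n).indicator g p.1 *
      starRingEnd ℂ ((timeCube S n).indicator g p.2) * (timeKernel (H : ℝ) p : ℂ)) := by
  have h0 : (((H : ℝ) * (2 * H - 1)) ^ n : ℝ) ≠ 0 := (pow_pos (alpha_pos H) n).ne'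
  by_cases h1 : p.1 ∈ timeCube S n
  · by_cases h2 : p.2 ∈ timeCube S n
    · rw [Set.indicator_of_mem (Set.mem_prod.2 ⟨h1, h2⟩), Set.indicator_of_mem h1,
        Set.indicator_of_mem h2, timeKernel_eq, Complex.real_smul, Complex.ofReal_mul,
        Complex.ofReal_inv]
      have h3 : ((((H : ℝ) * (2 * H - 1)) ^ n : ℝ) : ℂ) ≠ 0 := by exact_mod_cast h0
      field_simp
    · rw [Set.indicator_of_notMem (fun h => h2 h.2), Set.indicator_of_notMem h2]; simp
  · rw [Set.indicator_of_notMem (fun h => h1 h.1), Set.indicator_of_notMem h1]; simp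

theorem integrableOn_timeCube_iff (hS : MeasurableSet S)
    (hg : Measurable ((timeCube S n).indicator g)) :
    IntegrableOn (fun p : (Fin n → ℝ) × (Fin n → ℝ) =>
      g p.1 * starRingEnd ℂ (g p.2) * ((∏ i, |p.1 i - p.2 i| ^ (2 * (H : ℝ) - 2) : ℝ) : ℂ))
      (timeCube S n ×ˢ timeCube S n) ↔
    absForm volume (timeKernel (H : ℝ)) ((timeCube S n).indicator g) < ⊤ := by
  have h0 : (((H : ℝ) * (2 * H - 1)) ^ n : ℝ)⁻¹ ≠ 0 := inv_ne_zero (pow_pos (alpha_pos H) n).ne'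
  rw [← integrable_indicator_iff ((measurableSet_timeCube hS n).prod (measurableSet_timeCube hS n)),
    funext (indicator_timeCube_kernel H),
    ← (kernelFactorization_time H n).integrable_iff_absForm_lt_top hg]
  exact integrable_fun_smul_iff h0 _

theorem timeNormSq_eq (hS : MeasurableSet S) (hg : Measurable ((timeCube S n).indicator g))
    (hg' : absForm volume (timeKernel (H : ℝ)) ((timeCube S n).indicator g) < ⊤) :
    timeNormSq (H : ℝ) S g =
      ∫⁻ z, ‖timeTransform (H : ℝ) ((timeCube S n).indicator g) z‖ₑ ^ 2 ∂(windowsMeasure n) := by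
  have h0 : (((H : ℝ) * (2 * H - 1)) ^ n : ℝ) ≠ 0 := (pow_pos (alpha_pos H) n).ne'
  rw [timeNormSq, if_pos ((integrableOn_timeCube_iff H hS hg).2 hg'),
    ← integral_indicator ((measurableSet_timeCube hS n).prod (measurableSet_timeCube hS n)),
    funext (indicator_timeCube_kernel H), integral_smul, Complex.smul_re, smul_eq_mul,
    mul_inv_cancel_left₀ h0]
  exact ((kernelFactorization_time H n).lintegral_enorm_kernelTransform hg hg').symm

theorem absForm_lt_top_of_timeNormSq (hS : MeasurableSet S)
    (hg : Measurable ((timeCube S n).indicator g)) (hg' : timeNormSq (H : ℝ) S g < ⊤) :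
    absForm volume (timeKernel (H : ℝ)) ((timeCube S n).indicator g) < ⊤ := by
  by_contra h
  rw [timeNormSq, if_neg (fun h' => h ((integrableOn_timeCube_iff H hS hg).1 h'))] at hg'
  exact lt_irrefl _ hg'

end TimeNorm

theorem memLp_timeTransform (H : Set.Ioo (1 / 2 : ℝ) 1) {n : ℕ} {g : (Fin n → ℝ) → ℂ}
    (hg : Measurable g) (hg' : absForm volume (timeKernel (H : ℝ)) g < ⊤) :
    MemLp (timeTransform (H : ℝ) g) 2 (windowsMeasure n) :=
  (kernelFactorization_time H n).memLp_kernelTransform hg hg'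

/-- The indicator function of the box `[0,t₁] × ⋯ × [0,tₙ]`. -/
def boxFun {n : ℕ} (t u : Fin n → ℝ) : ℂ := ∏ i, boxInd (t i) (u i)

theorem measurable_boxFun {n : ℕ} (t : Fin n → ℝ) : Measurable (boxFun t) :=
  Finset.measurable_prod _ fun i _ => (measurable_boxInd (t i)).comp (measurable_pi_apply i)

theorem boxFun_eq_zero {n : ℕ} {t u : Fin n → ℝ} {i : Fin n} (h : u i ∉ Set.Icc 0 (t i)) :
    boxFun t u = 0 :=
  Finset.prod_eq_zero (Finset.mem_univ i) (by simp [boxInd, Set.indicator_of_notMem h])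

theorem integrable_boxInd_mul_wt (H t : ℝ) (z : ℝ × ℝ) :
    Integrable fun u => boxInd t u * (wt H u z : ℂ) := by
  refine (integrable_wt H z).ofReal.bdd_mul (c := 1) (measurable_boxInd t).aestronglyMeasurable
    (Eventually.of_forall fun u => ?_)
  by_cases h : u ∈ Set.Icc 0 t <;> simp [boxInd, h]

theorem integrable_boxFun_mul_timeFactor (H : ℝ) {n : ℕ} (t : Fin n → ℝ) (z : Fin n → ℝ × ℝ) :
    Integrable fun u => boxFun t u * (timeFactor H u z : ℂ) := by
  simp only [boxFun, timeFactor, Complex.ofReal_prod, ← Finset.prod_mul_distrib]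
  exact Integrable.fintype_prod_dep (f := fun i u => boxInd (t i) u * (wt H u (z i) : ℂ))
    fun i => integrable_boxInd_mul_wt H (t i) (z i)

theorem timeTransform_boxFun (H : ℝ) {n : ℕ} (t : Fin n → ℝ) (z : Fin n → ℝ × ℝ) :
    timeTransform H (boxFun t) z = ∏ i, (wtPrim H (t i) (z i) : ℂ) := by
  simp only [timeTransform, kernelTransform, boxFun, timeFactor, Complex.ofReal_prod,
    ← Finset.prod_mul_distrib]
  rw [integral_fintype_prod_volume_eq_prod (fun i u => boxInd (t i) u * (wt H u (z i) : ℂ))]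
  exact Finset.prod_congr rfl fun i _ => kernelTransform_boxInd H (t i) (z i)

theorem memLp_prod_wtPrim (H : Set.Ioo (1 / 2 : ℝ) 1) {n : ℕ} (t : Fin n → ℝ≥0) :
    MemLp (fun z : Fin n → ℝ × ℝ => ∏ i, (wtPrim H (t i) (z i) : ℂ)) 2 (windowsMeasure n) := by
  have hm : ∀ i, AEStronglyMeasurable (fun z : Fin n → ℝ × ℝ => (wtPrim H (t i) (z i) : ℂ))
      (windowsMeasure n) := fun i =>
    (memLp_wtPrim H (t i)).1.comp_quasiMeasurePreserving (Measure.quasiMeasurePreserving_eval _ i)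
  rw [memLp_two_iff_integrable_sq_norm (Finset.aestronglyMeasurable_fun_prod _ fun i _ => hm i)]
  simp only [norm_prod, ← Finset.prod_pow]
  exact Integrable.fintype_prod_dep (f := fun i z => ‖(wtPrim H (t i) z : ℂ)‖ ^ 2)
    fun i => (memLp_two_iff_integrable_sq_norm (memLp_wtPrim H (t i)).1).1 (memLp_wtPrim H (t i))

/-- Boxes and windows are nonnegative, so the transform of the absolute value is the transform
itself: a product of one-dimensional functions, each in `L²`. -/
theorem absForm_boxFun_lt_top (H : Set.Ioo (1 / 2 : ℝ) 1) {n : ℕ} (t : Fin n → ℝ≥0) :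
    absForm volume (timeKernel (H : ℝ)) (boxFun fun i => (t i : ℝ)) < ⊤ := by
  rw [(kernelFactorization_time H n).absForm_eq (measurable_boxFun _)]
  have h := (memLp_prod_wtPrim H t).2
  rw [eLpNorm_lt_top_iff_lintegral_rpow_enorm_lt_top (by norm_num) (by norm_num)] at h
  refine lt_of_le_of_lt (le_of_eq (lintegral_congr fun z => ?_)) h
  norm_num
  congr 1
  have hnn : ∀ u, (boxFun (fun i => (t i : ℝ)) u * (timeFactor H u z : ℂ)) =
      ((‖boxFun (fun i => (t i : ℝ)) u‖ * timeFactor H u z : ℝ) : ℂ) := by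
    intro u
    rw [Complex.ofReal_mul]
    congr 1
    rw [boxFun, norm_prod, Complex.ofReal_prod]
    refine Finset.prod_congr rfl fun i _ => ?_
    by_cases h : u i ∈ Set.Icc 0 (t i : ℝ) <;> simp [boxInd, Set.indicator, h]
  have h0 : ∀ u, 0 ≤ ‖boxFun (fun i => (t i : ℝ)) u‖ * timeFactor (H : ℝ) u z := fun u =>
    mul_nonneg (norm_nonneg _) ((kernelFactorization_time H n).factor_nonneg u z)
  have hi := integrable_boxFun_mul_timeFactor (H : ℝ) (fun i => (t i : ℝ)) z
  have hi' : Integrable fun u => ‖boxFun (fun i => (t i : ℝ)) u‖ * timeFactor (H : ℝ) u z := by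
    refine hi.norm.congr (Eventually.of_forall fun u => ?_)
    simp only [hnn, Complex.norm_real, Real.norm_of_nonneg (h0 u)]
  rw [← timeTransform_boxFun, timeTransform, kernelTransform]
  simp only [hnn]
  rw [integral_complex_ofReal, ← ofReal_norm, Complex.norm_real,
    Real.norm_of_nonneg (integral_nonneg h0),
    ofReal_integral_eq_lintegral_ofReal hi' (Eventually.of_forall h0)]
  refine lintegral_congr fun u => ?_
  rw [ENNReal.ofReal_mul (norm_nonneg _), ofReal_norm]

/-! ### Orthogonality to boxes and condition (i) -/

/-- A function whose integrals against the transforms of all boxes vanish. -/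
def OrthogonalToBoxes (H : ℝ) {n : ℕ} (w : (Fin n → ℝ × ℝ) → ℂ) : Prop :=
  ∀ t : Fin n → ℝ≥0, ∫ z, w z * timeTransform H (boxFun fun i => (t i : ℝ)) z ∂(windowsMeasure n) = 0

/-- Properties that hold for boxes and pass to the complex span. The pairing `∫ w · transform` is
bilinear, without conjugation, so orthogonality survives complex scalars. The finiteness carried
along is what makes the transform additive. -/
theorem stepTensor_properties (H : Set.Ioo (1 / 2 : ℝ) 1) {n : ℕ} {T : ℝ}
    {w : (Fin n → ℝ × ℝ) → ℂ} (hw : MemLp w 2 (windowsMeasure n)) (hw0 : OrthogonalToBoxes (H : ℝ) w)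
    {ψ : (Fin n → ℝ) → ℂ} (hψ : ψ ∈ stepTensor T n) :
    Measurable ψ ∧ absForm volume (timeKernel (H : ℝ)) ψ < ⊤ ∧
      (∀ u, (∃ i, u i ∉ Set.Icc 0 T) → ψ u = 0) ∧
      ∫ z, w z * timeTransform (H : ℝ) ψ z ∂(windowsMeasure n) = 0 := by
  have hk := kernelFactorization_time H n
  induction hψ using Submodule.span_induction with
  | mem ψ h =>
    obtain ⟨t, ht, rfl⟩ := h
    have e : (fun u => ∏ i, (Set.Icc 0 (t i)).indicator (fun _ => (1 : ℂ)) (u i)) =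
        boxFun fun i => ((⟨t i, (ht i).1⟩ : ℝ≥0) : ℝ) := rfl
    rw [e]
    refine ⟨measurable_boxFun _, absForm_boxFun_lt_top H _, ?_, hw0 _⟩
    rintro u ⟨i, hi⟩
    exact boxFun_eq_zero fun h => hi ⟨h.1, h.2.trans (ht i).2⟩
  | zero =>
    refine ⟨measurable_zero, ?_, fun u _ => rfl, ?_⟩
    · simp [absForm]
    · simp [timeTransform, kernelTransform]
  | add ψ χ _ _ h1 h2 =>
    obtain ⟨a1, a2, a3, a4⟩ := h1
    obtain ⟨b1, b2, b3, b4⟩ := h2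
    refine ⟨a1.add b1, hk.absForm_add_lt_top a1 b1 a2 b2, fun u hu => ?_, ?_⟩
    · simp [a3 u hu, b3 u hu]
    · have e : ∀ᵐ z ∂(windowsMeasure n), w z * timeTransform (H : ℝ) (ψ + χ) z =
          w z * timeTransform (H : ℝ) ψ z + w z * timeTransform (H : ℝ) χ z := by
        filter_upwards [hk.kernelTransform_add a1 b1 a2 b2] with z hz
        rw [← mul_add]
        exact congrArg _ hz
      have i1 : Integrable (fun z => w z * timeTransform (H : ℝ) ψ z) (windowsMeasure n) :=
        hw.integrable_mul (memLp_timeTransform H a1 a2)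
      have i2 : Integrable (fun z => w z * timeTransform (H : ℝ) χ z) (windowsMeasure n) :=
        hw.integrable_mul (memLp_timeTransform H b1 b2)
      rw [integral_congr_ae e, integral_add i1 i2, a4, b4, add_zero]
  | smul c ψ _ h1 =>
    obtain ⟨a1, a2, a3, a4⟩ := h1
    refine ⟨a1.const_smul c, ?_, fun u hu => ?_, ?_⟩
    · rw [absForm_const_smul]
      exact ENNReal.mul_lt_top (by finiteness) a2
    · simp [a3 u hu]
    · have e : ∀ z, w z * timeTransform (H : ℝ) (c • ψ) z =
          c * (w z * timeTransform (H : ℝ) ψ z) := by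
        intro z
        simp only [timeTransform]
        rw [kernelTransform_const_smul, Pi.smul_apply, smul_eq_mul]; ring
      simp only [e]
      rw [integral_const_mul, a4, mul_zero]

theorem indicator_timeCube_Ioo_ae_eq {n : ℕ} {T : ℝ} {ψ : (Fin n → ℝ) → ℂ}
    (hψ : ∀ u, (∃ i, u i ∉ Set.Icc 0 T) → ψ u = 0) :
    (timeCube (Set.Ioo 0 T) n).indicator ψ =ᵐ[volume] ψ := by
  have h : ∀ (c : ℝ) (i : Fin n), ∀ᵐ u : Fin n → ℝ, u i ≠ c := fun c i =>
    Measure.ae_eval_ne (α := fun _ : Fin n => ℝ) (fun _ => volume) i c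
  filter_upwards [ae_all_iff.2 (h 0), ae_all_iff.2 (h T)] with u h0 hT
  by_cases hu : u ∈ timeCube (Set.Ioo 0 T) n
  · rw [Set.indicator_of_mem hu]
  · rw [Set.indicator_of_notMem hu, hψ u]
    simp only [timeCube, Set.mem_ofPred_eq, not_forall] at hu
    obtain ⟨i, hi⟩ := hu
    exact ⟨i, fun hi' => hi ⟨lt_of_le_of_ne hi'.1 (h0 i).symm, lt_of_le_of_ne hi'.2 (hT i)⟩⟩

/-- Write `g = (g - ψ) + ψ` with a step function `ψ` close to `g`. The `ψ` part is orthogonal to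
`w`, and Cauchy–Schwarz bounds the rest by `‖w‖` times the fractional norm of `g - ψ`, which is
arbitrarily small. -/
theorem MemHC.absForm_lt_top {H : Set.Ioo (1 / 2 : ℝ) 1} {n : ℕ} {T : ℝ} {g : (Fin n → ℝ) → ℂ}
    (hg : MemHC (H : ℝ) T g) (hm : Measurable ((timeCube (Set.Ioo 0 T) n).indicator g)) :
    absForm volume (timeKernel (H : ℝ)) ((timeCube (Set.Ioo 0 T) n).indicator g) < ⊤ ∧
    ∀ w : (Fin n → ℝ × ℝ) → ℂ, MemLp w 2 (windowsMeasure n) → OrthogonalToBoxes (H : ℝ) w →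
      ∫ z, w z * timeTransform (H : ℝ) ((timeCube (Set.Ioo 0 T) n).indicator g) z
        ∂(windowsMeasure n) = 0 := by
  have hk := kernelFactorization_time H n
  set S := timeCube (Set.Ioo 0 T) n with hS
  have hSm : MeasurableSet S := measurableSet_timeCube measurableSet_Ioo n
  have key : ∀ w : (Fin n → ℝ × ℝ) → ℂ, MemLp w 2 (windowsMeasure n) →
      OrthogonalToBoxes (H : ℝ) w → ∀ ε : ℝ≥0∞, 0 < ε →
      absForm volume (timeKernel (H : ℝ)) (S.indicator g) < ⊤ ∧
      ‖∫ z, w z * timeTransform (H : ℝ) (S.indicator g) z ∂(windowsMeasure n)‖ₑ ≤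
        (∫⁻ z, ‖w z‖ₑ ^ (2 : ℝ) ∂(windowsMeasure n)) ^ (1 / (2 : ℝ)) * ε ^ (1 / (2 : ℝ)) := by
    intro w hw hw0 ε hε
    -- The minimum with `1` keeps the norm finite when `ε = ⊤`, which forces absolute convergence
    -- for `g - ψ`.
    obtain ⟨ψ, hψ, hlt⟩ := hg (min ε 1) (lt_min hε one_pos)
    obtain ⟨p1, p2, p3, p4⟩ := stepTensor_properties H hw hw0 hψ
    have hae := indicator_timeCube_Ioo_ae_eq p3
    have hsub : S.indicator (g - ψ) = S.indicator g - S.indicator ψ := Set.indicator_sub' _ _ _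
    have hm1 : Measurable (S.indicator (g - ψ)) := by
      rw [hsub]; exact hm.sub (p1.indicator hSm)
    have hfin := absForm_lt_top_of_timeNormSq H measurableSet_Ioo hm1
      (hlt.trans_le ((min_le_right _ _).trans le_top))
    have heq : S.indicator g =ᵐ[volume] S.indicator (g - ψ) + ψ := by
      filter_upwards [hae] with u hu
      rw [hsub, Pi.add_apply, Pi.sub_apply, hu, sub_add_cancel]
    refine ⟨by rw [absForm_congr heq]; exact hk.absForm_add_lt_top hm1 p1 hfin p2, ?_⟩
    have hN := timeNormSq_eq H measurableSet_Ioo hm1 hfin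
    have e : ∀ᵐ z ∂(windowsMeasure n), w z * timeTransform (H : ℝ) (S.indicator g) z =
        w z * timeTransform (H : ℝ) (S.indicator (g - ψ)) z + w z * timeTransform (H : ℝ) ψ z := by
      filter_upwards [hk.kernelTransform_add hm1 p1 hfin p2] with z hz
      rw [← mul_add, timeTransform, kernelTransform_congr heq]
      exact congrArg _ hz
    have hmem := memLp_timeTransform H hm1 hfin
    have i1 : Integrable (fun z => w z * timeTransform (H : ℝ) (S.indicator (g - ψ)) z)
      (windowsMeasure n) := hw.integrable_mul hmem
    have i2 : Integrable (fun z => w z * timeTransform (H : ℝ) ψ z) (windowsMeasure n) :=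
      hw.integrable_mul (memLp_timeTransform H p1 p2)
    rw [integral_congr_ae e, integral_add i1 i2, p4, add_zero]
    refine (enorm_integral_le_lintegral_enorm _).trans ?_
    simp only [enorm_mul]
    refine (ENNReal.lintegral_mul_le_Lp_mul_Lq _ Real.HolderConjugate.two_two
      hw.1.enorm hmem.1.enorm).trans ?_
    gcongr
    refine le_trans (le_of_eq ?_) (hlt.le.trans (min_le_left _ _))
    rw [hN]
    norm_num
    rfl
  -- Finiteness does not involve `w`, so `w = 0` gives it.
  refine ⟨(key 0 MemLp.zero (fun t => by simp) 1 one_pos).1, fun w hw hw0 => ?_⟩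
  rw [← enorm_eq_zero, ← nonpos_iff_eq_zero]
  set Cw := (∫⁻ z, ‖w z‖ₑ ^ (2 : ℝ) ∂(windowsMeasure n)) ^ (1 / (2 : ℝ)) with hCw
  have hCw' : Cw ≠ ⊤ := by
    have := hw.2
    rw [eLpNorm_lt_top_iff_lintegral_rpow_enorm_lt_top (by norm_num) (by norm_num)] at this
    exact (ENNReal.rpow_lt_top_of_nonneg (by norm_num) (by simpa using this.ne)).ne
  have hlim : Tendsto (fun ε : ℝ≥0∞ => Cw * ε ^ (1 / (2 : ℝ))) (𝓝[>] 0) (𝓝 0) := by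
    have h1 : Tendsto (fun ε : ℝ≥0∞ => ε ^ (1 / (2 : ℝ))) (𝓝[>] 0) (𝓝 0) := by
      have := (ENNReal.continuous_rpow_const (y := 1 / (2 : ℝ))).tendsto 0
      rw [ENNReal.zero_rpow_of_pos (by norm_num)] at this
      exact this.mono_left nhdsWithin_le_nhds
    simpa using ENNReal.Tendsto.const_mul h1 (Or.inr hCw')
  exact ge_of_tendsto hlim (eventually_mem_nhdsWithin.mono fun ε hε => (key w hw hw0 ε hε).2)

theorem wtPrim_mono (H : ℝ) {t s : ℝ} (hts : t ≤ s) (z : ℝ × ℝ) : wtPrim H t z ≤ wtPrim H s z :=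
  setIntegral_mono_set (integrable_wt H z).integrableOn
    (Eventually.of_forall fun u => wt_nonneg H u z) (Set.Icc_subset_Icc_right hts).eventuallyLE

theorem continuous_wtPrim (H : ℝ) (z : ℝ × ℝ) : Continuous fun t : ℝ≥0 => wtPrim H t z := by
  have h := intervalIntegral.continuous_primitive
    (fun a b => (integrable_wt H z).intervalIntegrable (a := a) (b := b)) 0
  refine (h.comp NNReal.continuous_coe).congr fun t => ?_
  simp only [Function.comp_apply]
  rw [intervalIntegral.integral_of_le t.coe_nonneg, wtPrim, integral_Icc_eq_integral_Ioc]

/-- The pairing with a box is continuous in its side lengths. Reducing to countably many boxes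
allows the exceptional sets of frequencies, one for each box, to be united into a null set. -/
theorem orthogonalToBoxes_of_denseSeq (H : Set.Ioo (1 / 2 : ℝ) 1) {n : ℕ}
    {w : (Fin n → ℝ × ℝ) → ℂ} (hw : MemLp w 2 (windowsMeasure n))
    (hw0 : ∀ t : Fin n → ℕ, ∫ z, w z * timeTransform (H : ℝ)
      (boxFun fun i => (TopologicalSpace.denseSeq ℝ≥0 (t i) : ℝ)) z ∂(windowsMeasure n) = 0) :
    OrthogonalToBoxes (H : ℝ) w := by
  have hcont : Continuous fun t : Fin n → ℝ≥0 => ∫ z, w z * timeTransform (H : ℝ)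
      (boxFun fun i => (t i : ℝ)) z ∂(windowsMeasure n) := by
    simp only [timeTransform_boxFun]
    rw [continuous_iff_continuousAt]
    intro t₀
    -- Window transforms of boxes increase with the sides, so the box with sides `t₀ i + 1`
    -- dominates all nearby ones.
    have hev : ∀ᶠ t in 𝓝 t₀, ∀ i, t i ≤ t₀ i + 1 := by
      rw [eventually_all]
      intro i
      exact ((continuous_apply i).tendsto t₀).eventually_le_const (by simp)
    refine continuousAt_of_dominated (bound := fun z => ‖w z‖ *
      ‖∏ i, (wtPrim (H : ℝ) ((t₀ i + 1 : ℝ≥0) : ℝ) (z i) : ℂ)‖)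
      (Eventually.of_forall fun t => hw.1.mul (memLp_prod_wtPrim H t).1)
      (hev.mono fun t ht => Eventually.of_forall fun z => ?_)
      (hw.norm.integrable_mul (memLp_prod_wtPrim H fun i => t₀ i + 1).norm)
      (Eventually.of_forall fun z => ?_)
    · rw [norm_mul, norm_prod, norm_prod]
      gcongr with i
      rw [Complex.norm_real, Complex.norm_real, Real.norm_of_nonneg (wtPrim_nonneg _ _ _),
        Real.norm_of_nonneg (wtPrim_nonneg _ _ _)]
      exact wtPrim_mono _ (by exact_mod_cast ht i) _
    · refine Continuous.continuousAt (continuous_const.mul (continuous_finsetProd _ fun i _ => ?_))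
      exact Complex.continuous_ofReal.comp ((continuous_wtPrim H (z i)).comp (continuous_apply i))
  have hdense : DenseRange fun (t : Fin n → ℕ) (i : Fin n) => TopologicalSpace.denseSeq ℝ≥0 (t i) :=
    DenseRange.piMap fun _ => TopologicalSpace.denseRange_denseSeq _
  have := hdense.equalizer hcont (continuous_const (y := (0 : ℂ))) (funext fun t => hw0 t)
  exact fun t => congrFun this t

/-! ### The spectral isometry on elementary tensors -/

theorem enorm_toLp_two_sq {X : Type*} [MeasurableSpace X] {μ : Measure X} {f : X → ℂ}
    (hf : MemLp f 2 μ) : ‖hf.toLp f‖ₑ ^ 2 = ∫⁻ x, ‖f x‖ₑ ^ 2 ∂μ := by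
  rw [Lp.enorm_toLp, eLpNorm_eq_lintegral_rpow_enorm_toReal (by norm_num) (by norm_num)]
  norm_num
  rw [← ENNReal.rpow_natCast, ← ENNReal.rpow_mul]
  norm_num

/-- The measure on the parameters `(z, ξ)` of windows and frequencies. -/
def phaseMeasure {d : ℕ} (C : SpatialCovariance d) (n : ℕ) :
    Measure ((Fin n → ℝ × ℝ) × (Fin n → Space d)) :=
  (windowsMeasure n).prod (Measure.pi fun _ => C.μ)

/-- The transform of an elementary tensor: window transform in time and Fourier transform in
space. -/
def brickTransform {d n : ℕ} (H : ℝ) (a : Fin n → Brick d)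
    (x : (Fin n → ℝ × ℝ) × (Fin n → Space d)) : ℂ :=
  (∏ i, (wtPrim H (a i).time (x.1 i) : ℂ)) * ∏ i, indicatorFourier (a i).set (x.2 i)

section Bricks

variable {d n : ℕ} (H : Set.Ioo (1 / 2 : ℝ) 1) (C : SpatialCovariance d)

theorem memLp_indicatorFourier {A : Set (Space d)} (hA : MeasurableSet A)
    (hA' : Bornology.IsBounded A) : MemLp (indicatorFourier A) 2 C.μ :=
  (indicatorFourier_isometry C hA hA hA' hA').1

theorem memLp_prod_indicatorFourier (a : Fin n → Brick d) :
    MemLp (fun ξ : Fin n → Space d => ∏ i, indicatorFourier (a i).set (ξ i)) 2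
      (Measure.pi fun _ => C.μ) := by
  have hm : ∀ i, AEStronglyMeasurable (fun ξ : Fin n → Space d => indicatorFourier (a i).set (ξ i))
      (Measure.pi fun _ => C.μ) := fun i =>
    ((continuous_indicatorFourier (a i).isBounded).comp
      (continuous_apply i)).aestronglyMeasurable
  rw [memLp_two_iff_integrable_sq_norm (Finset.aestronglyMeasurable_fun_prod _ fun i _ => hm i)]
  simp only [norm_prod, ← Finset.prod_pow]
  have h := fun i => memLp_indicatorFourier C (a i).measurableSet (a i).isBounded
  exact Integrable.fintype_prod_dep (f := fun i ξ => ‖indicatorFourier (a i).set ξ‖ ^ 2)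
    fun i => (memLp_two_iff_integrable_sq_norm (h i).1).1 (h i)

theorem memLp_brickTransform (a : Fin n → Brick d) :
    MemLp (brickTransform (H : ℝ) a) 2 (phaseMeasure C n) := by
  have h1 := memLp_prod_wtPrim H fun i => (a i).time
  have h2 := memLp_prod_indicatorFourier C a
  have hm : AEStronglyMeasurable (brickTransform (H : ℝ) a) (phaseMeasure C n) :=
    h1.1.comp_fst.mul h2.1.comp_snd
  rw [memLp_two_iff_integrable_sq_norm hm]
  simp only [brickTransform, norm_mul, mul_pow]
  exact ((memLp_two_iff_integrable_sq_norm h1.1).1 h1).mul_prod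
    ((memLp_two_iff_integrable_sq_norm h2.1).1 h2)

/-- The integrand factors over time, space and coordinates, leaving the one-dimensional isometries
for `fbmCov` and `spaceCov`. -/
theorem integral_brickTransform (a b : Fin n → Brick d) :
    ∫ x, brickTransform (H : ℝ) a x * starRingEnd ℂ (brickTransform (H : ℝ) b x)
      ∂(phaseMeasure C n) = (brickCov (H : ℝ) C a b : ℂ) := by
  have e : ∀ x, brickTransform (H : ℝ) a x * starRingEnd ℂ (brickTransform (H : ℝ) b x) =
      (∏ i, ((wtPrim (H : ℝ) (a i).time (x.1 i) * wtPrim (H : ℝ) (b i).time (x.1 i) : ℝ) : ℂ)) *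
      ∏ i, indicatorFourier (a i).set (x.2 i) *
        starRingEnd ℂ (indicatorFourier (b i).set (x.2 i)) := by
    intro x
    simp only [brickTransform, map_mul, map_prod, Complex.conj_ofReal, Complex.ofReal_mul,
      Finset.prod_mul_distrib]
    ring
  simp only [e]
  rw [phaseMeasure, integral_prod_mul
    (fun z : Fin n → ℝ × ℝ => ∏ i, ((wtPrim (H : ℝ) (a i).time (z i) *
      wtPrim (H : ℝ) (b i).time (z i) : ℝ) : ℂ))
    (fun ξ : Fin n → Space d => ∏ i, indicatorFourier (a i).set (ξ i) *
        starRingEnd ℂ (indicatorFourier (b i).set (ξ i))), windowsMeasure,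
    integral_fintype_prod_eq_prod (fun i z => ((wtPrim (H : ℝ) (a i).time z *
      wtPrim (H : ℝ) (b i).time z : ℝ) : ℂ)),
    integral_fintype_prod_eq_prod (fun i ξ => indicatorFourier (a i).set ξ *
        starRingEnd ℂ (indicatorFourier (b i).set ξ)), brickCov, Complex.ofReal_prod,
    ← Finset.prod_mul_distrib]
  refine Finset.prod_congr rfl fun i _ => ?_
  rw [integral_complex_ofReal, integral_wtPrim_mul, (indicatorFourier_isometry C
    (a i).measurableSet (b i).measurableSet (a i).isBounded (b i).isBounded).2, Complex.ofReal_mul]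

/-- The elementary tensors in the spectral `L²` space. -/
def spectralBrick (a : Fin n → Brick d) : Lp ℂ 2 (phaseMeasure C n) :=
  (memLp_brickTransform H C a).toLp _

theorem inner_spectralBrick (a b : Fin n → Brick d) :
    inner ℂ (spectralBrick H C b) (spectralBrick H C a) = (brickCov (H : ℝ) C a b : ℂ) := by
  rw [L2.inner_def, ← integral_brickTransform H C a b]
  refine integral_congr_ae ?_
  filter_upwards [(memLp_brickTransform H C a).coeFn_toLp,
    (memLp_brickTransform H C b).coeFn_toLp] with x h1 h2
  rw [spectralBrick, spectralBrick, h1, h2, RCLike.inner_apply]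

variable {H C} in
/-- The coefficients of an element of `ℰ^{⊗n}`. -/
def ElemTensor.toFinsupp (ℓ : ElemTensor H C n) : (Fin n → Brick d) →₀ ℝ := ℓ

variable {H C} in
/-- The transform of an element of `ℰ^{⊗n}`: window transform in time and Fourier transform in
space. -/
def ElemTensor.transform (ℓ : ElemTensor H C n)
    (x : (Fin n → ℝ × ℝ) × (Fin n → Space d)) : ℂ :=
  ∑ a ∈ ℓ.toFinsupp.support, (ℓ.toFinsupp a : ℂ) * brickTransform (H : ℝ) a x

/-- The spectral isometry on `ℰ^{⊗n}`. -/
def spectralMap : ElemTensor H C n →ₗ[ℝ] Lp ℂ 2 (phaseMeasure C n) :=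
  (Finsupp.linearCombination ℝ (spectralBrick H C) : ((Fin n → Brick d) →₀ ℝ) →ₗ[ℝ] _)

theorem spectralMap_apply (ℓ : ElemTensor H C n) :
    spectralMap H C ℓ =
      ∑ a ∈ ℓ.toFinsupp.support, (ℓ.toFinsupp a : ℂ) • spectralBrick H C a := by
  refine (Finsupp.linearCombination_apply ℝ _).trans ?_
  refine Finset.sum_congr rfl fun a _ => ?_
  exact (Complex.coe_smul _ _).symm

/-- The Gram matrices of the bricks agree on both sides, and the coefficients are real. The real
inner product of `ℰ^{⊗n}` is thus the complex one in `L²`. -/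
theorem norm_spectralMap (ℓ : ElemTensor H C n) : ‖spectralMap H C ℓ‖ = ‖ℓ‖ := by
  have h1 : inner ℂ (spectralMap H C ℓ) (spectralMap H C ℓ) = ((inner ℝ ℓ ℓ : ℝ) : ℂ) := by
    rw [spectralMap_apply]
    have e : (inner ℝ ℓ ℓ : ℝ) = ∑ a ∈ ℓ.toFinsupp.support, ∑ b ∈ ℓ.toFinsupp.support,
      ℓ.toFinsupp a * ℓ.toFinsupp b * brickCov (H : ℝ) C a b := rfl
    rw [e]
    simp only [inner_sum, sum_inner, inner_smul_left, inner_smul_right,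
      inner_spectralBrick, Complex.conj_ofReal]
    push_cast
    refine Finset.sum_congr rfl fun a _ => ?_
    rw [Finset.mul_sum]
    refine Finset.sum_congr rfl fun b _ => ?_
    ring
  have h2 : ‖spectralMap H C ℓ‖ ^ 2 = ‖ℓ‖ ^ 2 := by
    rw [← real_inner_self_eq_norm_sq ℓ, ← inner_self_eq_norm_sq (𝕜 := ℂ) (spectralMap H C ℓ), h1]
    exact Complex.ofReal_re _
  exact (pow_left_inj₀ (norm_nonneg _) (norm_nonneg _) two_ne_zero).1 h2

theorem isometry_spectralMap : Isometry (spectralMap (n := n) H C) :=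
  AddMonoidHomClass.isometry_of_norm _ (norm_spectralMap H C)

theorem spectralMap_coeFn (ℓ : ElemTensor H C n) :
    (spectralMap H C ℓ : _ → ℂ) =ᵐ[phaseMeasure C n]
      ℓ.transform := by
  rw [spectralMap_apply]
  refine (Lp.coeFn_fun_finsetSum _ _).trans ?_
  have h : ∀ a : Fin n → Brick d, ∀ r : ℂ, ∀ᵐ x ∂(phaseMeasure C n),
      (r • spectralBrick H C a : Lp ℂ 2 (phaseMeasure C n)) x = r * brickTransform (H : ℝ) a x := by
    intro a r
    filter_upwards [Lp.coeFn_smul r (spectralBrick H C a),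
      (memLp_brickTransform H C a).coeFn_toLp] with x h1 h2
    rw [h1, Pi.smul_apply, spectralBrick, h2, smul_eq_mul]
  filter_upwards [(Finset.eventually_all ℓ.toFinsupp.support).2 fun a _ =>
    h a (ℓ.toFinsupp a : ℂ)] with x hx
  exact Finset.sum_congr rfl fun a ha => hx a ha

end Bricks

/-! ### The energy of a field as a squared `L²` norm -/

/-- The transform of a function of time and frequency: window transform in time. -/
def fieldTransform {d n : ℕ} (H : ℝ) (G : (Fin n → ℝ) → (Fin n → Space d) → ℂ)
    (x : (Fin n → ℝ × ℝ) × (Fin n → Space d)) : ℂ :=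
  timeTransform H (fun u => G u x.2) x.1

section Field

variable {d n : ℕ} (H : Set.Ioo (1 / 2 : ℝ) 1) (C : SpatialCovariance d)
  {G : (Fin n → ℝ) → (Fin n → Space d) → ℂ}

theorem stronglyMeasurable_fieldTransform
    (hG : Measurable fun p : (Fin n → ℝ) × (Fin n → Space d) => G p.1 p.2) :
    StronglyMeasurable (fieldTransform (H : ℝ) G) := by
  have h1 : Measurable fun p : (Fin n → ℝ) × ((Fin n → ℝ × ℝ) × (Fin n → Space d)) =>
      (p.1, p.2.2) := by fun_prop
  have h2 : Measurable fun p : (Fin n → ℝ) × ((Fin n → ℝ × ℝ) × (Fin n → Space d)) =>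
      (p.1, p.2.1) := by fun_prop
  have h3 := Complex.measurable_ofReal.comp
    ((kernelFactorization_time H n).measurable_factor.comp h2)
  have h4 := ((hG.comp h1).mul h3).stronglyMeasurable
  exact h4.integral_prod_left' (μ := volume)

/-- The time isometry at each frequency, followed by Tonelli. Separating `F` from `G` lets the
values on the boundary of the time cube differ, as these are invisible to the transform. -/
theorem energy_eq_lintegral {S : Set ℝ} (hS : MeasurableSet S)
    (hG : Measurable fun p : (Fin n → ℝ) × (Fin n → Space d) => G p.1 p.2)
    (hG' : ∀ ξ, absForm volume (timeKernel (H : ℝ)) (fun u => G u ξ) < ⊤)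
    {F : (Fin n → ℝ) → (Fin n → Space d) → ℂ}
    (hm : ∀ ξ, Measurable ((timeCube S n).indicator fun u => F u ξ))
    (hF : ∀ ξ, (timeCube S n).indicator (fun u => F u ξ) =ᵐ[volume] fun u => G u ξ) :
    energy (H : ℝ) C S F = ∫⁻ x, ‖fieldTransform (H : ℝ) G x‖ₑ ^ 2 ∂(phaseMeasure C n) := by
  rw [phaseMeasure, lintegral_prod_symm _
    ((stronglyMeasurable_fieldTransform H hG).measurable.enorm.pow_const 2).aemeasurable, energy]
  refine lintegral_congr fun ξ => ?_
  rw [timeNormSq_eq H hS (hm ξ) (by rw [absForm_congr (hF ξ)]; exact hG' ξ), timeTransform,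
    kernelTransform_congr (hF ξ)]
  rfl

variable {C}

theorem ElemTensor.fourier_eq_sum (ℓ : ElemTensor H C n) (ξ : Fin n → Space d) :
    (fun u => ℓ.fourier u ξ) = ∑ a ∈ ℓ.toFinsupp.support,
      ((ℓ.toFinsupp a : ℂ) * ∏ i, indicatorFourier (a i).set (ξ i)) •
        boxFun fun i => ((a i).time : ℝ) := by
  ext u
  rw [Finset.sum_apply]
  refine Finset.sum_congr rfl fun a _ => ?_
  show (ℓ.toFinsupp a : ℂ) * ∏ i, boxInd (a i).time (u i) * indicatorFourier (a i).set (ξ i) = _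
  rw [Pi.smul_apply, smul_eq_mul, Finset.prod_mul_distrib, boxFun]
  ring

theorem measurable_fourier (ℓ : ElemTensor H C n) :
    Measurable fun p : (Fin n → ℝ) × (Fin n → Space d) => ℓ.fourier p.1 p.2 := by
  refine Finset.measurable_sum _ fun a _ => measurable_const.mul
    (Finset.measurable_prod _ fun i _ => Measurable.mul ?_ ?_)
  · exact (measurable_boxInd ((a i).time : ℝ)).comp (by fun_prop :
      Measurable fun p : (Fin n → ℝ) × (Fin n → Space d) => p.1 i)
  · exact (continuous_indicatorFourier (a i).isBounded).measurable.comp (by fun_prop :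
      Measurable fun p : (Fin n → ℝ) × (Fin n → Space d) => p.2 i)

theorem absForm_fourier_lt_top (ℓ : ElemTensor H C n) (ξ : Fin n → Space d) :
    absForm volume (timeKernel (H : ℝ)) (fun u => ℓ.fourier u ξ) < ⊤ := by
  rw [ElemTensor.fourier_eq_sum]
  have h : ∀ s : Finset (Fin n → Brick d), Measurable (∑ a ∈ s,
      ((ℓ.toFinsupp a : ℂ) * ∏ i, indicatorFourier (a i).set (ξ i)) •
        boxFun fun i => ((a i).time : ℝ)) ∧ absForm volume (timeKernel (H : ℝ)) (∑ a ∈ s,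
      ((ℓ.toFinsupp a : ℂ) * ∏ i, indicatorFourier (a i).set (ξ i)) •
        boxFun fun i => ((a i).time : ℝ)) < ⊤ := by
    intro s
    classical
    induction s using Finset.induction_on with
    | empty => exact ⟨measurable_zero, by simp [absForm]⟩
    | insert a s ha ih =>
      have hm := (measurable_boxFun fun i => ((a i).time : ℝ)).const_smul
        ((ℓ.toFinsupp a : ℂ) * ∏ i, indicatorFourier (a i).set (ξ i))
      rw [Finset.sum_insert ha]
      refine ⟨hm.add ih.1,
        (kernelFactorization_time H n).absForm_add_lt_top hm ih.1 ?_ ih.2⟩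
      rw [absForm_const_smul]
      exact ENNReal.mul_lt_top (by finiteness) (absForm_boxFun_lt_top H fun i => (a i).time)
  exact (h _).2

theorem fieldTransform_fourier (ℓ : ElemTensor H C n)
    (x : (Fin n → ℝ × ℝ) × (Fin n → Space d)) :
    fieldTransform (H : ℝ) ℓ.fourier x = ℓ.transform x := by
  rw [fieldTransform, ElemTensor.fourier_eq_sum, timeTransform, kernelTransform]
  simp only [Finset.sum_apply, Pi.smul_apply, smul_eq_mul, Finset.sum_mul, mul_assoc]
  rw [integral_finsetSum _ fun a _ => ((integrable_boxFun_mul_timeFactor (H : ℝ)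
    (fun i => ((a i).time : ℝ)) x.1).const_mul _).const_mul _]
  refine Finset.sum_congr rfl fun a _ => ?_
  rw [integral_const_mul, integral_const_mul, brickTransform]
  have := timeTransform_boxFun (H : ℝ) (fun i => ((a i).time : ℝ)) x.1
  rw [timeTransform, kernelTransform] at this
  rw [this]
  ring

theorem fourier_eq_zero (ℓ : ElemTensor H C n) {u : Fin n → ℝ} {i : Fin n} (hu : u i < 0)
    (ξ : Fin n → Space d) : ℓ.fourier u ξ = 0 := by
  have := congrFun (ElemTensor.fourier_eq_sum H ℓ ξ) u
  simp only [Finset.sum_apply, Pi.smul_apply] at this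
  rw [this]
  refine Finset.sum_eq_zero fun a _ => ?_
  rw [boxFun_eq_zero (i := i) fun h => absurd h.1 (not_le.2 hu), smul_zero]

end Field

section Field

variable {d n : ℕ} (H : Set.Ioo (1 / 2 : ℝ) 1) {C : SpatialCovariance d}
  {G : (Fin n → ℝ) → (Fin n → Space d) → ℂ}

theorem memLp_transform (ℓ : ElemTensor H C n) : MemLp ℓ.transform 2 (phaseMeasure C n) :=
  (memLp_congr_ae (spectralMap_coeFn H C ℓ)).1 (Lp.memLp _)

theorem measurable_fourier_apply (ℓ : ElemTensor H C n) (ξ : Fin n → Space d) :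
    Measurable fun u => ℓ.fourier u ξ := by
  rw [ElemTensor.fourier_eq_sum]
  rw [Finset.sum_fn]
  exact Finset.measurable_sum _ fun (a : Fin n → Brick d) _ =>
    Measurable.const_smul (measurable_boxFun fun i => ((a i).time : ℝ)) (_ : ℂ)

theorem spectralMap_eq_toLp (ℓ : ElemTensor H C n) :
    spectralMap H C ℓ = (memLp_transform H ℓ).toLp ℓ.transform :=
  Lp.ext ((spectralMap_coeFn H C ℓ).trans (memLp_transform H ℓ).coeFn_toLp.symm)

/-- Boxes are closed at `0`, whereas the energy runs over the open orthant. The two differ only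
where some time coordinate is zero, a null set. -/
theorem indicator_sub_fourier_ae_eq (hG0 : ∀ u ξ, u ∉ timeCube (Set.Ioi 0) n → G u ξ = 0)
    (ℓ : ElemTensor H C n) (ξ : Fin n → Space d) :
    (timeCube (Set.Ioi 0) n).indicator (fun u => G u ξ - ℓ.fourier u ξ) =ᵐ[volume]
      fun u => G u ξ - ℓ.fourier u ξ := by
  have hae0 : ∀ i : Fin n, ∀ᵐ u : Fin n → ℝ, u i ≠ 0 := fun i =>
    Measure.ae_eval_ne (α := fun _ : Fin n => ℝ) (fun _ => volume) i 0
  filter_upwards [ae_all_iff.2 hae0] with u hu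
  by_cases hu' : u ∈ timeCube (Set.Ioi 0) n
  · rw [Set.indicator_of_mem hu']
  · rw [Set.indicator_of_notMem hu', hG0 u ξ hu']
    simp only [timeCube, Set.mem_ofPred_eq, not_forall, Set.mem_Ioi, not_lt] at hu'
    obtain ⟨i, hi⟩ := hu'
    rw [fourier_eq_zero H ℓ (lt_of_le_of_ne hi (hu i)), sub_zero]

/-- For each `ξ` the transform is additive only for almost every `z`, so the integrands are compared
slice by slice. -/
theorem lintegral_fieldTransform_sub_fourier
    (hG : Measurable fun p : (Fin n → ℝ) × (Fin n → Space d) => G p.1 p.2)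
    (hG' : ∀ ξ, absForm volume (timeKernel (H : ℝ)) (fun u => G u ξ) < ⊤)
    (ℓ : ElemTensor H C n) :
    ∫⁻ x, ‖fieldTransform (H : ℝ) (fun u ξ => G u ξ - ℓ.fourier u ξ) x‖ₑ ^ 2 ∂(phaseMeasure C n) =
      ∫⁻ x, ‖fieldTransform (H : ℝ) G x - ℓ.transform x‖ₑ ^ 2 ∂(phaseMeasure C n) := by
  have hm1 : ∀ ξ, Measurable fun u => G u ξ := fun ξ => hG.comp measurable_prodMk_right
  have hm2 : ∀ ξ, Measurable fun u => ℓ.fourier u ξ := measurable_fourier_apply H ℓ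
  have hGl : Measurable fun p : (Fin n → ℝ) × (Fin n → Space d) =>
    G p.1 p.2 - ℓ.fourier p.1 p.2 := hG.sub (measurable_fourier H ℓ)
  have hmL : AEStronglyMeasurable ℓ.transform
    ((windowsMeasure n).prod (Measure.pi fun _ => C.μ)) := (memLp_transform H ℓ).1
  have hms : AEMeasurable (fun x => ‖fieldTransform (H : ℝ) G x - ℓ.transform x‖ₑ ^ 2)
      ((windowsMeasure n).prod (Measure.pi fun _ => C.μ)) :=
    ((stronglyMeasurable_fieldTransform H hG).aestronglyMeasurable.sub hmL).enorm.pow_const 2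
  rw [phaseMeasure, lintegral_prod_symm _ hms, lintegral_prod_symm _
    ((stronglyMeasurable_fieldTransform H hGl).measurable.enorm.pow_const 2).aemeasurable]
  refine lintegral_congr fun ξ => lintegral_congr_ae ?_
  filter_upwards [(kernelFactorization_time H n).kernelTransform_sub (hm1 ξ) (hm2 ξ) (hG' ξ)
    (absForm_fourier_lt_top H ℓ ξ)] with z hz
  rw [← fieldTransform_fourier H ℓ (z, ξ)]
  exact congrArg (fun y : ℂ => ‖y‖ₑ ^ 2) hz

theorem energy_sub_fourier
    (hG : Measurable fun p : (Fin n → ℝ) × (Fin n → Space d) => G p.1 p.2)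
    (hG' : ∀ ξ, absForm volume (timeKernel (H : ℝ)) (fun u => G u ξ) < ⊤)
    (hG0 : ∀ u ξ, u ∉ timeCube (Set.Ioi 0) n → G u ξ = 0)
    (hmem : MemLp (fieldTransform (H : ℝ) G) 2 (phaseMeasure C n)) (ℓ : ElemTensor H C n) :
    energy (H : ℝ) C (Set.Ioi 0) (fun u ξ => G u ξ - ℓ.fourier u ξ) =
      ‖hmem.toLp (fieldTransform (H : ℝ) G) - spectralMap H C ℓ‖ₑ ^ 2 := by
  have hm1 : ∀ ξ, Measurable fun u => G u ξ := fun ξ => hG.comp measurable_prodMk_right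
  have hm2 : ∀ ξ, Measurable fun u => ℓ.fourier u ξ := measurable_fourier_apply H ℓ
  have hGl : Measurable fun p : (Fin n → ℝ) × (Fin n → Space d) =>
    G p.1 p.2 - ℓ.fourier p.1 p.2 := hG.sub (measurable_fourier H ℓ)
  rw [spectralMap_eq_toLp, ← MemLp.toLp_sub hmem (memLp_transform H ℓ), enorm_toLp_two_sq,
    energy_eq_lintegral H C (F := fun u ξ => G u ξ - ℓ.fourier u ξ)
    (G := fun u ξ => G u ξ - ℓ.fourier u ξ) measurableSet_Ioi hGl
    (fun ξ => (kernelFactorization_time H n).absForm_sub_lt_top (hm1 ξ) (hm2 ξ) (hG' ξ)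
      (absForm_fourier_lt_top H ℓ ξ))
    (fun ξ => ((hm1 ξ).sub (hm2 ξ)).indicator (measurableSet_timeCube measurableSet_Ioi n))
    (indicator_sub_fourier_ae_eq H hG0 ℓ), lintegral_fieldTransform_sub_fourier H hG hG' ℓ]
  rfl

/-- The closure is the double orthogonal complement. Orthogonality to all bricks is disintegrated:
uniqueness in `ξ` at a fixed box gives orthogonality of almost every slice to that box, and the
hypothesis on `G(·, ξ)` then applies slice by slice. -/
theorem fieldTransform_mem_topologicalClosure
    (hG' : ∀ ξ w, MemLp w 2 (windowsMeasure n) → OrthogonalToBoxes (H : ℝ) w →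
      ∫ z, w z * timeTransform (H : ℝ) (fun u => G u ξ) z ∂(windowsMeasure n) = 0)
    (hmem : MemLp (fieldTransform (H : ℝ) G) 2 (phaseMeasure C n)) :
    hmem.toLp (fieldTransform (H : ℝ) G) ∈
      (Submodule.span ℂ (Set.range (spectralBrick (n := n) H C))).topologicalClosure := by
  rw [← Submodule.orthogonal_orthogonal_eq_closure, Submodule.mem_orthogonal]
  intro w hw
  rw [Submodule.mem_orthogonal'] at hw
  have hwm := Lp.memLp w
  -- Conjugating `w` turns the inner product into the bilinear pairing of `OrthogonalToBoxes`.
  set w' : (Fin n → ℝ × ℝ) × (Fin n → Space d) → ℂ := fun x => starRingEnd ℂ (w x) with hw'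
  have hwm' : MemLp w' 2 (phaseMeasure C n) := by
    refine ⟨Complex.continuous_conj.comp_aestronglyMeasurable hwm.1, ?_⟩
    rw [eLpNorm_congr_norm_ae (g := w) (Eventually.of_forall fun x => RCLike.norm_conj _)]
    exact hwm.2
  have hbrick : ∀ a : Fin n → Brick d,
      ∫ x, w' x * brickTransform (H : ℝ) a x ∂(phaseMeasure C n) = 0 := by
    intro a
    rw [← hw _ (Submodule.subset_span ⟨a, rfl⟩), L2.inner_def]
    refine integral_congr_ae ?_
    filter_upwards [(memLp_brickTransform H C a).coeFn_toLp] with x h1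
    rw [spectralBrick, h1, RCLike.inner_apply, mul_comm]
  have hV : ∀ t : Fin n → ℝ≥0, (fun ξ : Fin n → Space d => ∫ z, w' (z, ξ) *
      timeTransform (H : ℝ) (boxFun fun i => (t i : ℝ)) z ∂(windowsMeasure n))
      =ᵐ[Measure.pi fun _ => C.μ] 0 := by
    intro t
    refine ae_eq_zero_of_integral_indicatorFourier_mul fun A hA hA' => ?_
    let a : Fin n → Brick d := fun i => ⟨t i, A i, hA i, hA' i⟩
    have hi : Integrable (fun x => w' x * brickTransform (H : ℝ) a x)
      ((windowsMeasure n).prod (Measure.pi fun _ => C.μ)) :=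
      hwm'.integrable_mul (memLp_brickTransform H C a)
    have e : ∀ ξ : Fin n → Space d,
        ∫ z, w' (z, ξ) * brickTransform (H : ℝ) a (z, ξ) ∂(windowsMeasure n) =
        (∏ i, indicatorFourier (A i) (ξ i)) * ∫ z, w' (z, ξ) *
          timeTransform (H : ℝ) (boxFun fun i => (t i : ℝ)) z ∂(windowsMeasure n) := by
      intro ξ
      rw [← integral_const_mul]
      refine integral_congr_ae (Eventually.of_forall fun z => ?_)
      simp only [brickTransform, timeTransform_boxFun, a]
      ring
    have h1 := hi.integral_prod_right
    have h2 := hbrick a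
    rw [phaseMeasure, integral_prod_symm _ hi] at h2
    simp only [e] at h1 h2
    exact ⟨h1, h2⟩
  have hsec : ∀ᵐ ξ : Fin n → Space d ∂(Measure.pi fun _ => C.μ),
      MemLp (fun z => w' (z, ξ)) 2 (windowsMeasure n) := by
    have hi : Integrable (fun x => ‖w' x‖ ^ 2) ((windowsMeasure n).prod (Measure.pi fun _ => C.μ)) :=
      (memLp_two_iff_integrable_sq_norm hwm'.1).1 hwm'
    have hsm : AEStronglyMeasurable w' ((windowsMeasure n).prod (Measure.pi fun _ => C.μ)) :=
      hwm'.1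
    filter_upwards [hi.prod_left_ae, hsm.prod_swap.prodMk_left] with ξ h1 h2
    exact (memLp_two_iff_integrable_sq_norm h2).2 h1
  have hi : Integrable (fun x => w' x * fieldTransform (H : ℝ) G x)
    ((windowsMeasure n).prod (Measure.pi fun _ => C.μ)) := hwm'.integrable_mul hmem
  calc inner ℂ w (hmem.toLp (fieldTransform (H : ℝ) G))
      = ∫ x, w' x * fieldTransform (H : ℝ) G x ∂(phaseMeasure C n) := by
        rw [L2.inner_def]
        refine integral_congr_ae ?_
        filter_upwards [hmem.coeFn_toLp] with x h1
        rw [h1, RCLike.inner_apply, mul_comm]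
    _ = 0 := by
        rw [phaseMeasure, integral_prod_symm _ hi]
        refine integral_eq_zero_of_ae ?_
        -- One null set of frequencies serves all boxes with sides in the dense sequence.
        filter_upwards [hsec, ae_all_iff.2 fun t : Fin n → ℕ =>
          hV fun i => TopologicalSpace.denseSeq ℝ≥0 (t i)] with ξ h1 h2
        exact hG' ξ _ h1 (orthogonalToBoxes_of_denseSeq H h1 h2)

end Field

/-! ### Real coefficients from the reflection symmetry -/

section Symmetry

variable {d n : ℕ}

theorem indicatorFourier_neg (A : Set (Space d)) (ξ : Space d) :
    indicatorFourier A (-ξ) = starRingEnd ℂ (indicatorFourier A ξ) := by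
  rw [indicatorFourier, indicatorFourier, ← integral_conj]
  refine integral_congr_ae (Eventually.of_forall fun x => ?_)
  simp [← Complex.exp_conj]

/-- The reflection `(z, ξ) ↦ (z, -ξ)` of the frequencies. -/
def reflect (x : (Fin n → ℝ × ℝ) × (Fin n → Space d)) : (Fin n → ℝ × ℝ) × (Fin n → Space d) :=
  (x.1, -x.2)

theorem measurePreserving_reflect (C : SpatialCovariance d) :
    MeasurePreserving reflect (phaseMeasure C n) (phaseMeasure C n) := by
  have h : MeasurePreserving (fun ξ : Fin n → Space d => -ξ) (Measure.pi fun _ => C.μ)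
      (Measure.pi fun _ => C.μ) :=
    measurePreserving_pi (fun _ : Fin n => C.μ) (fun _ => C.μ)
      fun _ => measurePreserving_neg_spectral C
  exact (MeasurePreserving.id (windowsMeasure n)).prod h

theorem brickTransform_reflect (H : ℝ) (a : Fin n → Brick d)
    (x : (Fin n → ℝ × ℝ) × (Fin n → Space d)) :
    brickTransform H a (reflect x) = starRingEnd ℂ (brickTransform H a x) := by
  simp only [brickTransform, reflect, map_mul, map_prod, Complex.conj_ofReal, Pi.neg_apply,
    indicatorFourier_neg]

theorem fieldTransform_reflect (H : ℝ) {G : (Fin n → ℝ) → (Fin n → Space d) → ℂ}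
    (hG : ∀ u ξ, G u (-ξ) = starRingEnd ℂ (G u ξ))
    (x : (Fin n → ℝ × ℝ) × (Fin n → Space d)) :
    fieldTransform H G (reflect x) = starRingEnd ℂ (fieldTransform H G x) := by
  simp only [fieldTransform, timeTransform, kernelTransform, reflect, ← integral_conj, hG, map_mul,
    Complex.conj_ofReal]

variable (H : Set.Ioo (1 / 2 : ℝ) 1) {C : SpatialCovariance d}

/-- The map `J f(z, ξ) = conj f(z, -ξ)` preserves the `L²` norm because `μ` is even. It fixes `F`
and the bricks and conjugates coefficients. Averaging an approximant with its image under `J` gives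
real coefficients, and convexity of the norm shows that the error does not grow. -/
theorem exists_norm_sub_spectralMap_le {F : (Fin n → ℝ × ℝ) × (Fin n → Space d) → ℂ}
    (hF : MemLp F 2 (phaseMeasure C n)) (hF' : ∀ x, F (reflect x) = starRingEnd ℂ (F x))
    {k : Lp ℂ 2 (phaseMeasure C n)} (hk : k ∈ Submodule.span ℂ (Set.range (spectralBrick H C))) :
    ∃ ℓ : ElemTensor H C n, ‖hF.toLp F - spectralMap H C ℓ‖ ≤ ‖hF.toLp F - k‖ := by
  obtain ⟨c, rfl⟩ := Finsupp.mem_span_range_iff_exists_finsupp.1 hk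
  let c' : (Fin n → Brick d) →₀ ℝ := c.mapRange Complex.re Complex.zero_re
  let ℓ : ElemTensor H C n := c'
  have hℓ : ∀ x, ℓ.transform x =
      ∑ a ∈ c.support, (((c a).re : ℝ) : ℂ) * brickTransform (H : ℝ) a x := fun x =>
    Finset.sum_subset (s₁ := c'.support) Finsupp.support_mapRange
      (f := fun a => ((c' a : ℝ) : ℂ) * brickTransform (H : ℝ) a x) fun a _ ha => by
        rw [Finsupp.notMem_support_iff.1 ha]; simp
  set f : (Fin n → ℝ × ℝ) × (Fin n → Space d) → ℂ := fun x =>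
    F x - ∑ a ∈ c.support, c a * brickTransform (H : ℝ) a x with hf
  have hfm : MemLp f 2 (phaseMeasure C n) :=
    hF.sub (memLp_finsetSum _ fun a _ => (memLp_brickTransform H C a).const_mul (c a))
  have hfLp : hF.toLp F - (c.sum fun a r => r • spectralBrick H C a) = hfm.toLp f := by
    refine Lp.ext ?_
    have hb : ∀ a, ∀ᵐ x ∂(phaseMeasure C n),
        (c a • spectralBrick H C a : Lp ℂ 2 (phaseMeasure C n)) x =
          c a * brickTransform (H : ℝ) a x := by
      intro a
      filter_upwards [Lp.coeFn_smul (c a) (spectralBrick H C a),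
        (memLp_brickTransform H C a).coeFn_toLp] with x h1 h2
      rw [h1, Pi.smul_apply, spectralBrick, h2, smul_eq_mul]
    filter_upwards [Lp.coeFn_sub (hF.toLp F) (c.sum fun a r => r • spectralBrick H C a),
      hF.coeFn_toLp, hfm.coeFn_toLp,
      Lp.coeFn_fun_finsetSum c.support fun a => c a • spectralBrick H C a,
      (Finset.eventually_all c.support).2 fun a _ => hb a] with x h1 h2 h3 h4 h5
    rw [h1, h3, Pi.sub_apply, h2, hf, Finsupp.sum, h4]
    exact congrArg _ (Finset.sum_congr rfl h5)
  have hτ := measurePreserving_reflect (n := n) C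
  have hfc : MemLp (fun x => starRingEnd ℂ (f (reflect x))) 2 (phaseMeasure C n) ∧
      eLpNorm (fun x => starRingEnd ℂ (f (reflect x))) 2 (phaseMeasure C n) =
        eLpNorm f 2 (phaseMeasure C n) := by
    have e : eLpNorm (fun x => starRingEnd ℂ (f (reflect x))) 2 (phaseMeasure C n) =
        eLpNorm f 2 (phaseMeasure C n) := by
      rw [← eLpNorm_comp_measurePreserving hfm.1 hτ]
      exact eLpNorm_congr_norm_ae (Eventually.of_forall fun x => RCLike.norm_conj _)
    exact ⟨⟨Complex.continuous_conj.comp_aestronglyMeasurable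
      (hfm.comp_measurePreserving hτ).1, e ▸ hfm.2⟩, e⟩
  -- With `f = F - k`, the error of the real approximant is `(f + J f) / 2`.
  have hhalf : hF.toLp F - spectralMap H C ℓ = (1 / 2 : ℂ) • (hfm.toLp f + hfc.1.toLp _) := by
    rw [spectralMap_eq_toLp, ← MemLp.toLp_sub hF (memLp_transform H ℓ), ← MemLp.toLp_add,
      ← MemLp.toLp_const_smul]
    congr 1
    ext x
    simp only [Pi.sub_apply, Pi.smul_apply, Pi.add_apply, hℓ, hf, hF', map_sub, map_sum, map_mul,
      brickTransform_reflect, Complex.conj_conj, smul_eq_mul]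
    have e : ∑ a ∈ c.support, (((c a).re : ℝ) : ℂ) * brickTransform (H : ℝ) a x =
        (1 / 2 : ℂ) * (∑ a ∈ c.support, c a * brickTransform (H : ℝ) a x +
          ∑ a ∈ c.support, starRingEnd ℂ (c a) * brickTransform (H : ℝ) a x) := by
      rw [← Finset.sum_add_distrib, Finset.mul_sum]
      refine Finset.sum_congr rfl fun a _ => ?_
      rw [Complex.re_eq_add_conj]; ring
    rw [e]; ring
  refine ⟨ℓ, ?_⟩
  have hn : ‖hfc.1.toLp _‖ = ‖hfm.toLp f‖ := by rw [Lp.norm_toLp, Lp.norm_toLp, hfc.2]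
  rw [hhalf, hfLp, norm_smul]
  have := norm_add_le (hfm.toLp f) (hfc.1.toLp _)
  rw [hn] at this
  have h2 : ‖(1 / 2 : ℂ)‖ = 1 / 2 := by norm_num
  rw [h2]
  linarith

end Symmetry

/-! ### Extension by zero in time -/

section ZeroExtension

variable {d n : ℕ} {T : ℝ} {φhat : (Fin n → ℝ) → (Fin n → Space d) → ℂ}

theorem zeroExtend_eq_indicator (u : Fin n → ℝ) (ξ : Fin n → Space d) :
    zeroExtend T φhat u ξ = (timeCube (Set.Ioo 0 T) n).indicator (fun u => φhat u ξ) u := by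
  by_cases hu : u ∈ timeCube (Set.Ioo 0 T) n <;> simp [zeroExtend, hu]

theorem measurable_zeroExtend
    (h : Measurable fun p : timeCube (Set.Ioo 0 T) n × (Fin n → Space d) => φhat p.1 p.2) :
    Measurable fun p : (Fin n → ℝ) × (Fin n → Space d) => zeroExtend T φhat p.1 p.2 := by
  have hS := measurableSet_timeCube (measurableSet_Ioo (a := (0 : ℝ)) (b := T)) n
  have hS' : MeasurableSet {p : (Fin n → ℝ) × (Fin n → Space d) |
      p.1 ∈ timeCube (Set.Ioo 0 T) n} := measurable_fst hS
  refine measurable_of_restrict_of_restrict_compl hS' ?_ ?_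
  · have h1 : Measurable fun p : {p : (Fin n → ℝ) × (Fin n → Space d) |
        p.1 ∈ timeCube (Set.Ioo 0 T) n} =>
        ((⟨p.1.1, p.2⟩, p.1.2) : timeCube (Set.Ioo 0 T) n × (Fin n → Space d)) :=
      ((measurable_fst.comp measurable_subtype_coe).subtype_mk).prodMk
        (measurable_snd.comp measurable_subtype_coe)
    convert h.comp h1 using 1
    funext p
    have hp : p.1.1 ∈ timeCube (Set.Ioo 0 T) n := p.2
    simp [zeroExtend, hp]
  · convert measurable_const (a := (0 : ℂ)) using 1
    funext p
    have hp : p.1.1 ∉ timeCube (Set.Ioo 0 T) n := p.2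
    simp [zeroExtend, hp]

theorem zeroExtend_neg (hreal : ∀ t ∈ timeCube (Set.Ioo 0 T) n, ∀ ξ,
    φhat t (-ξ) = starRingEnd ℂ (φhat t ξ)) (u : Fin n → ℝ) (ξ : Fin n → Space d) :
    zeroExtend T φhat u (-ξ) = starRingEnd ℂ (zeroExtend T φhat u ξ) := by
  by_cases hu : u ∈ timeCube (Set.Ioo 0 T) n
  · simp [zeroExtend, hu, hreal u hu]
  · simp [zeroExtend, hu]

theorem hasFourierFunction_zeroExtend {φ : (Fin n → ℝ) → 𝓢'(PhaseSpace n d, ℂ)}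
    (hφ : ∀ t ∈ timeCube (Set.Ioo 0 T) n, HasFourierFunction (φ t) (φhat t)) (t : Fin n → ℝ) :
    HasFourierFunction (zeroExtend T φ t) (zeroExtend T φhat t) := by
  by_cases ht : t ∈ timeCube (Set.Ioo 0 T) n
  · simpa [zeroExtend, ht] using hφ t ht
  · simp only [zeroExtend, if_neg ht]
    exact ⟨locallyIntegrable_zero, fun h _ => by simp⟩

end ZeroExtension

/-! ### Passage to the completion and proof of the theorem -/

/-- The extension of the spectral isometry to `ℋ𝒫^{⊗n}`. -/
def spectralExtension {d n : ℕ} (H : Set.Ioo (1 / 2 : ℝ) 1) (C : SpatialCovariance d) :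
    HPTensor H C n → Lp ℂ 2 (phaseMeasure C n) :=
  UniformSpace.Completion.extension (spectralMap H C)

theorem isometry_spectralExtension {d n : ℕ} (H : Set.Ioo (1 / 2 : ℝ) 1)
    (C : SpatialCovariance d) : Isometry (spectralExtension (n := n) H C) :=
  (isometry_spectralMap H C).completion_extension

theorem spectralExtension_coe {d n : ℕ} (H : Set.Ioo (1 / 2 : ℝ) 1) (C : SpatialCovariance d)
    (ℓ : ElemTensor H C n) : spectralExtension H C (ℓ : HPTensor H C n) = spectralMap H C ℓ :=
  UniformSpace.Completion.extension_coe (isometry_spectralMap H C).uniformContinuous ℓ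

theorem norm_spectralExtension {d n : ℕ} (H : Set.Ioo (1 / 2 : ℝ) 1) (C : SpatialCovariance d)
    (h : HPTensor H C n) : ‖spectralExtension H C h‖ = ‖h‖ := by
  have h0 : spectralExtension H C (0 : HPTensor H C n) = 0 := by
    rw [← UniformSpace.Completion.coe_zero, spectralExtension_coe, map_zero]
  have := (isometry_spectralExtension H C).dist_eq h 0
  rwa [h0, dist_zero_right, dist_zero_right] at this

end

end FracNoise

open FracNoise in
theorem theorem2p2 {d n : ℕ} (H : Set.Ioo (1 / 2 : ℝ) 1) (C : SpatialCovariance d)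
    (T : ℝ) (hT : 0 < T)
    (φ : (Fin n → ℝ) → 𝓢'(PhaseSpace n d, ℂ))
    (φhat : (Fin n → ℝ) → (Fin n → Space d) → ℂ)
    (hφ : ∀ t ∈ timeCube (Set.Ioo 0 T) n, HasFourierFunction (φ t) (φhat t))
    (hreal : ∀ t ∈ timeCube (Set.Ioo 0 T) n, ∀ ξ, φhat t (-ξ) = starRingEnd ℂ (φhat t ξ))
    (h_i : ∀ ξ, MemHC (H : ℝ) T fun t => φhat t ξ)
    (h_ii : Measurable fun p : timeCube (Set.Ioo 0 T) n × (Fin n → Space d) => φhat p.1 p.2)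
    (h_iii : (∀ s ∈ timeCube (Set.Ioo 0 T) n, ∀ ξ,
        ∫⁻ u in {u ∈ timeCube (Set.Ioo 0 T) n | ∀ i, s i ≤ u i},
          ENNReal.ofReal (∏ i, u i ^ ((H : ℝ) - 1 / 2) * (u i - s i) ^ ((H : ℝ) - 3 / 2)) *
            ‖φhat u ξ‖ₑ < ⊤) ∨
      (∀ s ∈ timeCube (Set.Ioo 0 T) n, ∀ ξ, (φhat s ξ).im = 0 ∧ 0 ≤ (φhat s ξ).re))
    (h_IT : energy H C (Set.Ioo 0 T) φhat < ⊤) :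
    ∃ h : HPTensor H C n, RepresentsHP (zeroExtend T φ) (zeroExtend T φhat) h ∧
      (∀ h' : HPTensor H C n, RepresentsHP (zeroExtend T φ) (zeroExtend T φhat) h' → h' = h) ∧
      ENNReal.ofReal (‖h‖ ^ 2) = energy H C (Set.Ioo 0 T) φhat := by
  set G := zeroExtend T φhat with hGdef
  have hG : Measurable fun p : (Fin n → ℝ) × (Fin n → Space d) => G p.1 p.2 :=
    measurable_zeroExtend h_ii
  have hGi : ∀ ξ, (timeCube (Set.Ioo 0 T) n).indicator (fun u => φhat u ξ) = fun u => G u ξ :=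
    fun ξ => funext fun u => (zeroExtend_eq_indicator u ξ).symm
  have hGm : ∀ ξ, Measurable ((timeCube (Set.Ioo 0 T) n).indicator fun u => φhat u ξ) :=
    fun ξ => by rw [hGi ξ]; exact hG.comp (measurable_prodMk_right (y := ξ))
  have hmem := fun ξ => (h_i ξ).absForm_lt_top (hGm ξ)
  simp only [hGi] at hmem
  have hG0 : ∀ u ξ, u ∉ timeCube (Set.Ioi 0) n → G u ξ = 0 := fun u ξ hu => by
    rw [hGdef, zeroExtend_eq_indicator, Set.indicator_of_notMem fun h => hu fun i => (h i).1]
  have hE : energy H C (Set.Ioo 0 T) φhat =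
      ∫⁻ x, ‖fieldTransform (H : ℝ) G x‖ₑ ^ 2 ∂(phaseMeasure C n) :=
    energy_eq_lintegral H C measurableSet_Ioo hG (fun ξ => (hmem ξ).1) hGm
      fun ξ => by rw [hGi ξ]
  have hL2 : MemLp (fieldTransform (H : ℝ) G) 2 (phaseMeasure C n) := by
    refine ⟨(stronglyMeasurable_fieldTransform H hG).aestronglyMeasurable, ?_⟩
    rw [eLpNorm_lt_top_iff_lintegral_rpow_enorm_lt_top (by norm_num) (by norm_num)]
    rw [hE] at h_IT
    simpa using h_IT
  set g := hL2.toLp (fieldTransform (H : ℝ) G) with hg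
  have hsub : ∀ ℓ : ElemTensor H C n,
      energy H C (Set.Ioi 0) (fun u ξ => G u ξ - ℓ.fourier u ξ) = ‖g - spectralMap H C ℓ‖ₑ ^ 2 :=
    energy_sub_fourier H hG (fun ξ => (hmem ξ).1) hG0 hL2
  -- Convergence of the energies to zero is the same as `L²` convergence of the images to `g`.
  have hlim : ∀ ℓ : ℕ → ElemTensor H C n,
      Tendsto (fun k => energy H C (Set.Ioi 0) fun u ξ => G u ξ - (ℓ k).fourier u ξ) atTop (𝓝 0) ↔
        Tendsto (fun k => spectralMap H C (ℓ k)) atTop (𝓝 g) := by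
    intro ℓ
    simp only [hsub]
    rw [tendsto_iff_norm_sub_tendsto_zero]
    have h1 : ∀ k, ‖g - spectralMap H C (ℓ k)‖ₑ ^ 2 =
        ENNReal.ofReal (‖spectralMap H C (ℓ k) - g‖ ^ 2) := fun k => by
      rw [norm_sub_rev, ENNReal.ofReal_pow (norm_nonneg _), ofReal_norm]
    simp only [h1]
    constructor
    · intro h
      have h2 := (ENNReal.tendsto_toReal ENNReal.zero_ne_top).comp h
      simp only [Function.comp_def, ENNReal.toReal_ofReal (sq_nonneg _), ENNReal.toReal_zero] at h2
      simpa using h2.sqrt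
    · intro h
      have h2 := (ENNReal.continuous_ofReal.tendsto _).comp (h.pow 2)
      rwa [zero_pow two_ne_zero, ENNReal.ofReal_zero] at h2
  -- Any represented element is sent to `g`; injectivity of the isometry gives uniqueness, and its
  -- norm preservation gives the value of the norm.
  have hrep : ∀ h : HPTensor H C n, RepresentsHP (zeroExtend T φ) G h →
      spectralExtension H C h = g := by
    rintro h ⟨_, ℓ, h1, h2⟩
    have h3 := ((isometry_spectralExtension H C).continuous.tendsto h).comp h1
    simp only [Function.comp_def, spectralExtension_coe] at h3
    exact tendsto_nhds_unique h3 ((hlim ℓ).1 h2)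
  have hdense : ∀ k : ℕ, ∃ ℓ : ElemTensor H C n, ‖spectralMap H C ℓ - g‖ < 1 / ((k : ℝ) + 1) := by
    intro k
    have hcl := fieldTransform_mem_topologicalClosure H (C := C)
      (fun ξ w hw hw0 => (hmem ξ).2 w hw hw0) hL2
    rw [← SetLike.mem_coe, Submodule.topologicalClosure_coe, Metric.mem_closure_iff] at hcl
    obtain ⟨b, hb, hlt⟩ := hcl (1 / ((k : ℝ) + 1)) (by positivity)
    obtain ⟨ℓ, hℓ⟩ := exists_norm_sub_spectralMap_le H hL2
      (fieldTransform_reflect (H : ℝ) (zeroExtend_neg hreal)) hb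
    refine ⟨ℓ, ?_⟩
    rw [norm_sub_rev]
    exact hℓ.trans_lt (by rwa [← dist_eq_norm])
  choose ℓ hℓ using hdense
  have htend : Tendsto (fun k => spectralMap H C (ℓ k)) atTop (𝓝 g) := by
    rw [tendsto_iff_norm_sub_tendsto_zero]
    exact squeeze_zero (fun _ => norm_nonneg _) (fun k => (hℓ k).le)
      tendsto_one_div_add_atTop_nhds_zero_nat
  -- An isometry reflects Cauchy sequences, so the convergence of the images yields a limit in the
  -- completion.
  have hcauchy : CauchySeq fun k => (ℓ k : HPTensor H C n) := by
    refine (isometry_spectralExtension H C).isUniformInducing.cauchy_map_iff.1 ?_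
    rw [Filter.map_map]
    simp only [Function.comp_def, spectralExtension_coe]
    exact htend.cauchySeq
  obtain ⟨h, hh⟩ := cauchySeq_tendsto_of_complete hcauchy
  have hR : RepresentsHP (zeroExtend T φ) G h :=
    ⟨fun t _ => hasFourierFunction_zeroExtend hφ t, ℓ, hh, (hlim ℓ).2 htend⟩
  refine ⟨h, hR, fun h' hR' => ?_, ?_⟩
  · exact (isometry_spectralExtension H C).injective ((hrep h' hR').trans (hrep h hR).symm)
  · rw [← norm_spectralExtension, hrep h hR, hE, ← enorm_toLp_two_sq hL2,
      ENNReal.ofReal_pow (norm_nonneg _), ofReal_norm]
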